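/- Let $k$ be a field of characteristic zero. A filtered complex is a cochain complex $V$ of $k$-vector spaces with a decreasing $\mathbb{Z}$-indexed filtration by subcomplexes $F^pV$ such that $V=\bigcup_p F^pV$; it is complete if, in each degree, $V\to\lim_p V/F^pV$ is an isomorphism. Maps are chain maps preserving the filtration, and $F^r(V\otimes W)=\sum_{p+q=r}F^pV\otimes F^qW$. A complete operad $\mathcal{P}$ is a unital symmetric operad in complete complexes with respect to the completed tensor product; equivalently, it consists of complete complexes $\mathcal{P}(n)$, $n\ge 0$, with actions of the symmetric groups, a unit $k\to\mathcal{P}(1)$ (with $k$ in degree $0$ and filtration weight $0$) and composition maps $\mathcal{P}(m)\otimes\mathcal{P}(n_1)\otimes\dots\otimes\mathcal{P}(n_m)\to\mathcal{P}(n_1+\dots+n_m)$ of filtered complexes satisfying the usual associativity, unit and equivariance axioms with Koszul signs. A complete $\mathcal{P}$-algebra is a complete complex $A$ with maps of filtered complexes $\mathcal{P}(n)\otimes A^{\otimes n}\to A$ that are associative, unital and equivariant; a map of complete $\mathcal{P}$-algebras is a map of filtered complexes commuting with these actions. **Theorem 2.5.** Let $\mathcal{P}$ be a complete operad over $k$.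 The category of complete $\mathcal{P}$-algebras has all small limits and colimits and admits a cofibrantly generated model structure such that: - the weak equivalences are the maps $f\colon A\to B$ that induce a quasi-isomorphism $\mathrm{Gr}^p(A)\to\mathrm{Gr}^p(B)$ for every $p\in\mathbb{Z}$, where $\mathrm{Gr}^p(A)=F^pA/F^{p+1}A$; - the fibrations are the maps $f\colon A\to B$ for which $F^pA\to F^pB$ is surjective for every $p\in\mathbb{Z}$. In particular, every complete $\mathcal{P}$-algebra is fibrant. Here cofibrantly generated means that there are sets $I$ and $J$ of maps, both permitting the small object argument, such that the trivial fibrations (resp. the fibrations) are exactly the maps with the right lifting property against $I$ (resp. $J$). -/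

import Mathlib

open CategoryTheory CategoryTheory.Limits HomotopicalAlgebra

universe u

noncomputable section

/-! ### Filtered and complete complexes -/

/-- A filtered complex over `k`: a cochain complex `V` of `k`-vector spaces with a decreasing
`ℤ`-indexed filtration by subcomplexes `F^p V`, where `F p n` is the degree `n` part of `F^p V`,
such that `V` is the union of the `F^p V`. -/
structure FilteredComplex (k : Type u) [Field k] where
  /-- the underlying cochain complex (differential of degree `1`) -/
  cx : CochainComplex (ModuleCat.{u} k) ℤ
  /-- `F p n` is `F^p V^n` -/
  F : ℤ → ∀ n : ℤ, Submodule k (cx.X n)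
  anti : ∀ {p q : ℤ}, p ≤ q → ∀ n, F q n ≤ F p n
  d_mem : ∀ (p i j : ℤ) (x : cx.X i), x ∈ F p i → (cx.d i j).hom x ∈ F p j
  exhaustive : ∀ (n : ℤ) (x : cx.X n), ∃ p, x ∈ F p n

namespace FilteredComplex

variable {k : Type u} [Field k]

/-- Maps of filtered complexes: chain maps that preserve the filtration. -/
@[ext]
structure Hom (V W : FilteredComplex k) where
  hom : V.cx ⟶ W.cx
  map_mem : ∀ (p n : ℤ) (x : V.cx.X n), x ∈ V.F p n → (hom.f n).hom x ∈ W.F p n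

instance : Category.{u} (FilteredComplex k) where
  Hom := Hom
  id V := { hom := 𝟙 V.cx, map_mem := fun p n x hx => by simpa using hx }
  comp f g :=
    { hom := f.hom ≫ g.hom
      map_mem := fun p n x hx => by
        simpa using g.map_mem p n _ (f.map_mem p n x hx) }

/-- The filtration is complete and Hausdorff: in each degree `n` the map
`V^n ⟶ lim_p V^n / F^p V^n` is bijective. (An element of the limit is a family of classes of
elements `x p` with `x q - x p ∈ F^p V^n` for `p ≤ q`.) -/
def IsComplete (V : FilteredComplex k) : Prop :=
  ∀ (n : ℤ) (x : ℤ → V.cx.X n), (∀ p q : ℤ, p ≤ q → x q - x p ∈ V.F p n) →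
    ∃! y : V.cx.X n, ∀ p : ℤ, y - x p ∈ V.F p n

/-- The subcomplex `F^p V`, as a cochain complex. -/
def subcx (V : FilteredComplex k) (p : ℤ) : CochainComplex (ModuleCat.{u} k) ℤ where
  X n := ModuleCat.of k (V.F p n)
  d i j := ModuleCat.ofHom ((V.cx.d i j).hom.restrict (fun x hx => V.d_mem p i j x hx))
  shape i j h := by
    ext x
    have h' := congrArg (fun f => f.hom x.1) (V.cx.shape i j h)
    exact h'
  d_comp_d' i j l _ _ := by
    ext x
    have h := congrArg (fun f => f.hom x.1) (V.cx.d_comp_d i j l)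
    exact h

/-- The inclusion of `F^{p+1} V` into `F^p V`. -/
def subIncl (V : FilteredComplex k) (p : ℤ) : V.subcx (p + 1) ⟶ V.subcx p where
  f n := ModuleCat.ofHom (Submodule.inclusion (V.anti (by omega) n))
  comm' i j _ := by
    ext x
    rfl

/-- The map `F^p V ⟶ F^p W` induced by a map of filtered complexes. -/
def subMap {V W : FilteredComplex k} (f : V ⟶ W) (p : ℤ) : V.subcx p ⟶ W.subcx p where
  f n := ModuleCat.ofHom ((f.hom.f n).hom.restrict (fun x hx => f.map_mem p n x hx))
  comm' i j _ := by
    ext x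
    have h := congrArg (fun g => g.hom x.1) (f.hom.comm i j)
    exact Subtype.ext h

/-- The associated graded `Gr^p V = F^p V / F^{p+1} V`, a cochain complex. -/
def gr (V : FilteredComplex k) (p : ℤ) : CochainComplex (ModuleCat.{u} k) ℤ :=
  cokernel (V.subIncl p)

/-- The map `Gr^p V ⟶ Gr^p W` induced by a map of filtered complexes. -/
def grMap {V W : FilteredComplex k} (f : V ⟶ W) (p : ℤ) : V.gr p ⟶ W.gr p :=
  cokernel.map (V.subIncl p) (W.subIncl p) (subMap f (p + 1)) (subMap f p) (by
    ext n x
    rfl)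

/-- `f` induces a quasi-isomorphism on the associated graded. -/
def IsGradedQuasiIso {V W : FilteredComplex k} (f : V ⟶ W) : Prop :=
  ∀ p : ℤ, QuasiIso (grMap f p)

/-- `f` induces a surjection `F^p V ⟶ F^p W` in each filtration weight `p` (and each degree). -/
def IsFilteredSurjection {V W : FilteredComplex k} (f : V ⟶ W) : Prop :=
  ∀ (p n : ℤ) (y : W.cx.X n), y ∈ W.F p n → ∃ x ∈ V.F p n, (f.hom.f n).hom x = y

/-! ### Total spaces

Multilinear operations on complexes are written as multilinear maps between the total spaces
`⨁ n, V^n`; such a map of degree zero is the same as a family of multilinear maps between the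
homogeneous parts. -/

/-- The total space `⨁ n, V^n` of a filtered complex. -/
abbrev Tot (V : FilteredComplex k) : Type u := DirectSum ℤ (fun n => (V.cx.X n : Type u))

/-- The homogeneous elements of degree `n` in the total space. -/
def deg (V : FilteredComplex k) (n : ℤ) : Submodule k V.Tot :=
  LinearMap.range (DirectSum.lof k ℤ (fun n => (V.cx.X n : Type u)) n)

/-- `F^p V^n` as a subspace of the total space. -/
def fil (V : FilteredComplex k) (p n : ℤ) : Submodule k V.Tot :=
  (V.F p n).map (DirectSum.lof k ℤ (fun n => (V.cx.X n : Type u)) n)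

/-- The differential of the total space. -/
def dTot (V : FilteredComplex k) : V.Tot →ₗ[k] V.Tot :=
  DirectSum.toModule k ℤ V.Tot
    (fun n => DirectSum.lof k ℤ (fun n => (V.cx.X n : Type u)) (n + 1) ∘ₗ (V.cx.d n (n + 1)).hom)

/-- The map of total spaces induced by a map of filtered complexes. -/
def totMap {V W : FilteredComplex k} (f : V ⟶ W) : V.Tot →ₗ[k] W.Tot :=
  DirectSum.lmap (fun n => (f.hom.f n).hom)

end FilteredComplex

/-! ### Koszul signs and arities -/

/-- The Koszul sign of the rearrangement
`x_1 ⊗ ⋯ ⊗ x_m ↦ x_{σ 1} ⊗ ⋯ ⊗ x_{σ m}`, where `x_j` has degree `d j`. -/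
def koszulSign {m n : ℕ} (σ : Fin m ≃ Fin n) (d : Fin n → ℤ) : ℤˣ :=
  ∏ i, ∏ j, if i < j ∧ σ j < σ i then (d (σ i) * d (σ j)).negOnePow else 1

/-- The Koszul sign of the rearrangement
`q_1 ⊗ ⋯ ⊗ q_m ⊗ r_1 ⊗ ⋯ ⊗ r_m ↦ q_1 ⊗ r_1 ⊗ ⋯ ⊗ q_m ⊗ r_m`, where `q_i` has degree `b i` and
`r_i` has degree `c i`. -/
def shuffleSign {m : ℕ} (b c : Fin m → ℤ) : ℤˣ :=
  ∏ i, ∏ j, if i < j then (c i * b j).negOnePow else 1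

/-- The block index of a position in a concatenation of blocks of lengths `n i`. -/
def blockIndex {m : ℕ} (n : Fin m → ℕ) (t : Fin (∑ i, n i)) : Fin m := (finSigmaFinEquiv.symm t).1

/-- The position inside its block of a position in a concatenation of blocks. -/
def blockPos {m : ℕ} (n : Fin m → ℕ) (t : Fin (∑ i, n i)) : Fin (n (blockIndex n t)) :=
  (finSigmaFinEquiv.symm t).2

theorem sum_blockIndex {m : ℕ} (n : Fin m → ℕ) (l : ∀ i, Fin (n i) → ℕ) :
    ∑ i, ∑ s, l i s = ∑ t, l (blockIndex n t) (blockPos n t) := by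
  rw [← Fintype.sum_sigma' (fun i s => l i s)]
  exact Fintype.sum_equiv finSigmaFinEquiv _ _ (fun x => by
    unfold blockIndex blockPos
    rw [Equiv.symm_apply_apply])

/-- Relabelling within the blocks. -/
def blockRelabel {m : ℕ} {n n' : Fin m → ℕ} (τ : ∀ i, Fin (n i) ≃ Fin (n' i)) :
    Fin (∑ i, n i) ≃ Fin (∑ i, n' i) :=
  finSigmaFinEquiv.symm.trans ((Equiv.sigmaCongrRight τ).trans finSigmaFinEquiv)

/-- The permutation of blocks that moves the `i`-th block to place `σ i`. -/
def blockPerm {m m' : ℕ} (σ : Fin m ≃ Fin m') (n : Fin m' → ℕ) :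
    Fin (∑ i, n (σ i)) ≃ Fin (∑ j, n j) :=
  finSigmaFinEquiv.symm.trans
    ((Equiv.sigmaCongrLeft (β := fun j => Fin (n j)) σ).trans finSigmaFinEquiv)

/-! ### Complete operads and their algebras -/

section

open FilteredComplex

/-- A (unital, symmetric) complete operad: a symmetric sequence of complete complexes, with
composition maps `γ : P(m) ⊗ P(n_1) ⊗ ⋯ ⊗ P(n_m) ⟶ P(n_1 + ⋯ + n_m)` of filtered complexes
(which extend uniquely to the completed tensor products) and a unit `k ⟶ P(1)`, subject to
associativity, unitality and equivariance, with the Koszul sign rule.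

The actions of the symmetric groups are written as an action of the bijections
`Fin m ≃ Fin n` (which exist for `m = n` only): `perm σ` renames the input `i` to `σ i`. -/
structure CompleteOperad (k : Type u) [Field k] where
  /-- the operations of arity `n` -/
  obj : ℕ → FilteredComplex k
  complete : ∀ n, (obj n).IsComplete
  /-- relabelling of inputs -/
  perm : ∀ {m n : ℕ}, (Fin m ≃ Fin n) → (obj m ⟶ obj n)
  perm_refl : ∀ n, perm (Equiv.refl (Fin n)) = 𝟙 (obj n)
  perm_trans : ∀ {l m n : ℕ} (σ : Fin l ≃ Fin m) (τ : Fin m ≃ Fin n),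
    perm (σ.trans τ) = perm σ ≫ perm τ
  /-- the unit operation -/
  one : (obj 1).Tot
  one_mem : one ∈ (obj 1).fil 0 0
  d_one : (obj 1).dTot one = 0
  /-- the composition `γ(p; q_1, …, q_m)` -/
  comp : ∀ {m : ℕ} (n : Fin m → ℕ),
    (obj m).Tot →ₗ[k] MultilinearMap k (fun i => (obj (n i)).Tot) (obj (∑ i, n i)).Tot
  comp_mem : ∀ {m : ℕ} (n : Fin m → ℕ) (v e : ℤ) (w b : Fin m → ℤ)
    (p : (obj m).Tot) (q : ∀ i, (obj (n i)).Tot),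
    p ∈ (obj m).fil v e → (∀ i, q i ∈ (obj (n i)).fil (w i) (b i)) →
      comp n p q ∈ (obj (∑ i, n i)).fil (v + ∑ i, w i) (e + ∑ i, b i)
  d_comp : ∀ {m : ℕ} (n : Fin m → ℕ) (e : ℤ) (b : Fin m → ℤ)
    (p : (obj m).Tot) (q : ∀ i, (obj (n i)).Tot),
    p ∈ (obj m).deg e → (∀ i, q i ∈ (obj (n i)).deg (b i)) →
      (obj (∑ i, n i)).dTot (comp n p q) =
        comp n ((obj m).dTot p) q +
          ∑ i, (e + ∑ j with j < i, b j).negOnePow •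
            comp n p (Function.update q i ((obj (n i)).dTot (q i)))
  one_comp : ∀ (n : ℕ) (q : (obj n).Tot),
    comp (fun _ : Fin 1 => n) one (fun _ => q) = totMap (perm (finCongr (by simp))) q
  comp_one : ∀ (m : ℕ) (p : (obj m).Tot),
    comp (fun _ : Fin m => 1) p (fun _ => one) = totMap (perm (finCongr (by simp))) p
  comp_assoc : ∀ {m : ℕ} (n : Fin m → ℕ) (l : ∀ i, Fin (n i) → ℕ)
    (b : Fin m → ℤ) (c : ∀ i, Fin (n i) → ℤ)
    (p : (obj m).Tot) (q : ∀ i, (obj (n i)).Tot) (r : ∀ i s, (obj (l i s)).Tot),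
    (∀ i, q i ∈ (obj (n i)).deg (b i)) → (∀ i s, r i s ∈ (obj (l i s)).deg (c i s)) →
      comp (fun t => l (blockIndex n t) (blockPos n t)) (comp n p q)
          (fun t => r (blockIndex n t) (blockPos n t)) =
        shuffleSign b (fun i => ∑ s, c i s) •
          totMap (perm (finCongr (sum_blockIndex n l)))
            (comp (fun i => ∑ s, l i s) p (fun i => comp (l i) (q i) (r i)))
  comp_perm_right : ∀ {m : ℕ} (n n' : Fin m → ℕ) (τ : ∀ i, Fin (n i) ≃ Fin (n' i))
    (p : (obj m).Tot) (q : ∀ i, (obj (n i)).Tot),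
    comp n' p (fun i => totMap (perm (τ i)) (q i)) =
      totMap (perm (blockRelabel τ)) (comp n p q)
  comp_perm_left : ∀ {m m' : ℕ} (σ : Fin m ≃ Fin m') (n : Fin m' → ℕ) (b : Fin m' → ℤ)
    (p : (obj m).Tot) (q : ∀ j, (obj (n j)).Tot),
    (∀ j, q j ∈ (obj (n j)).deg (b j)) →
      comp n (totMap (perm σ) p) q =
        koszulSign σ b • totMap (perm (blockPerm σ n)) (comp (fun i => n (σ i)) p (fun i => q (σ i)))

/-- A complete algebra over a complete operad `P`: a complete complex `A` with action maps
`P(n) ⊗ A ⊗ ⋯ ⊗ A ⟶ A` of filtered complexes, associative, unital and equivariant, with the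
Koszul sign rule. -/
structure CompleteAlgebra {k : Type u} [Field k] (P : CompleteOperad k) where
  /-- the underlying complete complex -/
  obj : FilteredComplex k
  complete : obj.IsComplete
  /-- the action `p(a_1, …, a_n)` -/
  act : ∀ n : ℕ, (P.obj n).Tot →ₗ[k] MultilinearMap k (fun _ : Fin n => obj.Tot) obj.Tot
  act_mem : ∀ (n : ℕ) (v e : ℤ) (w b : Fin n → ℤ) (p : (P.obj n).Tot) (a : Fin n → obj.Tot),
    p ∈ (P.obj n).fil v e → (∀ i, a i ∈ obj.fil (w i) (b i)) →
      act n p a ∈ obj.fil (v + ∑ i, w i) (e + ∑ i, b i)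
  d_act : ∀ (n : ℕ) (e : ℤ) (b : Fin n → ℤ) (p : (P.obj n).Tot) (a : Fin n → obj.Tot),
    p ∈ (P.obj n).deg e → (∀ i, a i ∈ obj.deg (b i)) →
      obj.dTot (act n p a) =
        act n ((P.obj n).dTot p) a +
          ∑ i, (e + ∑ j with j < i, b j).negOnePow •
            act n p (Function.update a i (obj.dTot (a i)))
  one_act : ∀ a : obj.Tot, act 1 P.one (fun _ => a) = a
  act_assoc : ∀ {m : ℕ} (n : Fin m → ℕ) (b : Fin m → ℤ) (c : ∀ i, Fin (n i) → ℤ)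
    (p : (P.obj m).Tot) (q : ∀ i, (P.obj (n i)).Tot) (a : ∀ i, Fin (n i) → obj.Tot),
    (∀ i, q i ∈ (P.obj (n i)).deg (b i)) → (∀ i s, a i s ∈ obj.deg (c i s)) →
      act (∑ i, n i) (P.comp n p q) (fun t => a (blockIndex n t) (blockPos n t)) =
        shuffleSign b (fun i => ∑ s, c i s) • act m p (fun i => act (n i) (q i) (a i))
  act_perm : ∀ {m n : ℕ} (σ : Fin m ≃ Fin n) (b : Fin n → ℤ)
    (p : (P.obj m).Tot) (a : Fin n → obj.Tot),
    (∀ j, a j ∈ obj.deg (b j)) →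
      act n (totMap (P.perm σ) p) a = koszulSign σ b • act m p (fun i => a (σ i))

namespace CompleteAlgebra

variable {k : Type u} [Field k] {P : CompleteOperad k}

/-- Maps of complete `P`-algebras: maps of filtered complexes that commute with the action. -/
@[ext]
structure Hom (A B : CompleteAlgebra P) where
  hom : A.obj ⟶ B.obj
  map_act : ∀ (n : ℕ) (p : (P.obj n).Tot) (a : Fin n → A.obj.Tot),
    totMap hom (A.act n p a) = B.act n p (fun i => totMap hom (a i))

theorem totMap_id (V : FilteredComplex k) (x : V.Tot) : totMap (𝟙 V) x = x := by
  have h : totMap (𝟙 V) = LinearMap.id := DirectSum.linearMap_ext _ (fun n => by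
    ext y
    simp only [totMap, LinearMap.comp_apply, DirectSum.lmap_lof]
    rfl)
  rw [h]
  rfl

theorem totMap_comp {U V W : FilteredComplex k} (f : U ⟶ V) (g : V ⟶ W) (x : U.Tot) :
    totMap (f ≫ g) x = totMap g (totMap f x) := by
  have h : totMap (f ≫ g) = totMap g ∘ₗ totMap f := DirectSum.linearMap_ext _ (fun n => by
    ext y
    simp only [totMap, LinearMap.comp_apply, DirectSum.lmap_lof]
    rfl)
  rw [h]
  rfl

instance : Category.{u} (CompleteAlgebra P) where
  Hom := Hom
  id A := { hom := 𝟙 A.obj, map_act := fun n p a => by simp only [totMap_id] }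
  comp f g :=
    { hom := f.hom ≫ g.hom
      map_act := fun n p a => by simp only [totMap_comp, f.map_act, g.map_act] }

/-- The maps of `P`-algebras that induce quasi-isomorphisms on the associated graded. -/
def gradedQuasiIsos (P : CompleteOperad k) : MorphismProperty (CompleteAlgebra P) :=
  fun _ _ f => IsGradedQuasiIso f.hom

/-- The maps of `P`-algebras that are surjective in each filtration weight. -/
def filteredSurjections (P : CompleteOperad k) : MorphismProperty (CompleteAlgebra P) :=
  fun _ _ f => IsFilteredSurjection f.hom

end CompleteAlgebra

end

/-- A model category is cofibrantly generated if there are sets `I` and `J` of maps that permit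
the small object argument, such that the fibrations are the maps with the right lifting property
against `J` and the trivial fibrations are those with the right lifting property against `I`. -/
def IsCofibrantlyGenerated (C : Type*) [Category.{u} C] [ModelCategory C] : Prop :=
  ∃ I J : MorphismProperty C,
    MorphismProperty.IsSmall.{u} I ∧ MorphismProperty.IsSmall.{u} J ∧
    MorphismProperty.HasSmallObjectArgument.{u} I ∧
    MorphismProperty.HasSmallObjectArgument.{u} J ∧
    fibrations C = J.rlp ∧ trivialFibrations C = I.rlp

end

/-!
All constructions are carried out on total spaces `V.Tot = ⨁ n, V.cx.X n`, where an operation is a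
single multilinear map, so that no degree has to be transported along an equation. The algebras
needed are all obtained in the same way: an `InternalAlgebra` is an algebra structure on a family
of submodules `W p n` of an ambient module `E`, which may live in a larger universe and on which the
operations are defined everywhere but satisfy the axioms only on homogeneous elements. As soon as
each degree of it is small, it defines a complete algebra.

Limits are subalgebras of products (`SubProduct`). For colimits, and for the free algebras `disc`
on an element of given weight and degree and `sphere` on a cocycle, one takes the product of *all*
the candidate targets (all cocones, all algebras with a marked element) and its smallest complete
subalgebra containing the tautological families. This subalgebra is small, because each of its
elements is the value of a well-founded term built from operations and limits of sequences, and
there is only a set of these (`Generated.exists_eval`); a map out of it is determined by its values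
on the generators (`generatedSub_hom_ext`), which gives the universal properties.

By definition of `disc` and `sphere`, the fibrations are the maps with the right lifting property
against all `⊥ ⟶ disc P p n`, and the maps with the right lifting property against all
`sphere P p (n + 1) ⟶ disc P p n` are those with `LiftsCochains`. A map which lifts cochains is a
filtered surjection and a graded quasi-isomorphism by a diagram chase; conversely, a trivial
fibration lifts cochains by successive corrections along the filtration, whose limit exists by
completeness (`FilteredComplex.liftsCochains`).

For the small object argument one shows that maps out of a sphere commute with colimits of chains
`F` in which every countable set has an upper bound. In such a chain a convergent sequence of
elements that come from some stage comes from a single stage; hence the union of the images of the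
`F j` in the colimit is a complete subalgebra, and so everything (`exists_map_app_eq`). Vanishing in
the colimit is detected by the reduced product of the `F j`, that is, the quotient of the product by
the families vanishing from some stage on: it is complete for the same reason, and it receives a
cocone under which only the elements vanishing at some stage go to zero (`exists_map_eq_zero`). The
chains indexed by the ordinal `ω₁` have this property, so both generating sets permit the small
object argument with respect to `ℵ₁`.

It remains to see that a map with the left lifting property against the fibrations is a weak
equivalence (`gradedQuasiIsos_of_llp`). All objects being fibrant, it suffices to give every algebra
`B` a path object: then such a map `i : A ⟶ B` has a retraction `r`, and lifting in the square with
right side `pathObject B ⟶ B × B` gives a homotopy from the identity of `B` to `r ≫ i`. The path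
object consists of the differential forms `f + θ g`, `θ = dt`, on the line, whose coefficients are
power series in `t` over `B` with coefficients tending to zero: such series can be evaluated at `0`
and at `1`. That the evaluation at `0` is a weak equivalence is the Poincaré lemma, which uses the
integral of `t ^ m` and hence characteristic zero. The forms are obtained from the power series by
adjoining `θ` by means of the derivation `d/dt` (`Derivation.forms`), and checking the axioms with
their Koszul signs is what the formulas for `koszulSign` and `shuffleSign` under a change of one
degree are for. Finally a trivial cofibration is a retract of a map with the left lifting property
against the fibrations (`llp_filteredSurjections_eq`), and the two factorizations assemble into a
model structure.
-/

universe w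

noncomputable section

/-! ### Total spaces of filtered complexes -/

namespace FilteredComplex

variable {k : Type u} [Field k] {U V W : FilteredComplex k}

/-- The inclusion of the degree `n` part into the total space. -/
def inj (V : FilteredComplex k) (n : ℤ) : (V.cx.X n : Type u) →ₗ[k] V.Tot :=
  DirectSum.lof k ℤ (fun n => (V.cx.X n : Type u)) n

/-- The component of degree `n` of an element of the total space. -/
def coord (V : FilteredComplex k) (n : ℤ) : V.Tot →ₗ[k] (V.cx.X n : Type u) :=
  DirectSum.component k ℤ (fun n => (V.cx.X n : Type u)) n

/-- The projector of the total space onto its elements of degree `n`. -/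
def prTot (V : FilteredComplex k) (n : ℤ) : V.Tot →ₗ[k] V.Tot := V.inj n ∘ₗ V.coord n

@[simp] theorem coord_inj (n : ℤ) (x : V.cx.X n) : V.coord n (V.inj n x) = x :=
  DirectSum.component.lof_self k (M := fun n => (V.cx.X n : Type u)) n x

theorem coord_inj_ne {m n : ℤ} (h : m ≠ n) (x : V.cx.X n) : V.coord m (V.inj n x) = 0 := by
  unfold coord inj
  rw [DirectSum.component.of, dif_neg (fun e => h e.symm)]

theorem inj_injective (n : ℤ) : Function.Injective (V.inj n) :=
  Function.LeftInverse.injective (coord_inj n)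

theorem ext_coord {x y : V.Tot} (h : ∀ n, V.coord n x = V.coord n y) : x = y :=
  DirectSum.ext_component k h

theorem mem_fil {p n : ℤ} {x : V.Tot} : x ∈ V.fil p n ↔ ∃ y ∈ V.F p n, V.inj n y = x :=
  Submodule.mem_map

theorem mem_deg {n : ℤ} {x : V.Tot} : x ∈ V.deg n ↔ ∃ y, V.inj n y = x :=
  LinearMap.mem_range

theorem inj_mem_fil {p n : ℤ} {y : V.cx.X n} : V.inj n y ∈ V.fil p n ↔ y ∈ V.F p n := by
  rw [mem_fil]
  constructor
  · rintro ⟨z, hz, h⟩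
    rwa [← inj_injective n h]
  · exact fun h => ⟨y, h, rfl⟩

theorem inj_mem_deg {n : ℤ} (y : V.cx.X n) : V.inj n y ∈ V.deg n := mem_deg.2 ⟨y, rfl⟩

theorem fil_anti {p q : ℤ} (h : p ≤ q) (n : ℤ) : V.fil q n ≤ V.fil p n :=
  Submodule.map_mono (V.anti h n)

theorem fil_le_deg (p n : ℤ) : V.fil p n ≤ V.deg n := by
  intro x hx
  obtain ⟨y, -, rfl⟩ := mem_fil.1 hx
  exact inj_mem_deg y

theorem exists_mem_fil {n : ℤ} {x : V.Tot} (hx : x ∈ V.deg n) : ∃ p, x ∈ V.fil p n := by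
  obtain ⟨y, rfl⟩ := mem_deg.1 hx
  obtain ⟨p, hp⟩ := V.exhaustive n y
  exact ⟨p, inj_mem_fil.2 hp⟩

theorem prTot_of_mem_deg {n : ℤ} {x : V.Tot} (hx : x ∈ V.deg n) : V.prTot n x = x := by
  obtain ⟨y, rfl⟩ := mem_deg.1 hx
  simp [prTot]

theorem prTot_of_mem_deg_ne {m n : ℤ} (h : m ≠ n) {x : V.Tot} (hx : x ∈ V.deg n) :
    V.prTot m x = 0 := by
  obtain ⟨y, rfl⟩ := mem_deg.1 hx
  simp [prTot, coord_inj_ne h]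

theorem tot_induction {motive : V.Tot → Prop} (x : V.Tot) (zero : motive 0)
    (hom : ∀ n, ∀ y ∈ V.deg n, motive y)
    (add : ∀ y z, motive y → motive z → motive (y + z)) : motive x := by
  induction x using DirectSum.induction_on with
  | zero => exact zero
  | of n y => exact hom n _ (inj_mem_deg y)
  | add y z hy hz => exact add y z hy hz

theorem tot_linearMap_ext {M : Type*} [AddCommGroup M] [Module k M] {f g : V.Tot →ₗ[k] M}
    (h : ∀ n, ∀ x ∈ V.deg n, f x = g x) : f = g := by
  refine LinearMap.ext fun x => ?_
  induction x using tot_induction with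
  | zero => simp
  | hom n y hy => exact h n y hy
  | add y z hy hz => rw [map_add, map_add, hy, hz]

theorem dTot_inj (n : ℤ) (x : V.cx.X n) :
    V.dTot (V.inj n x) = V.inj (n + 1) ((V.cx.d n (n + 1)).hom x) := by
  unfold dTot inj
  rw [DirectSum.toModule_lof]
  rfl

theorem dTot_mem_fil {p n : ℤ} {x : V.Tot} (hx : x ∈ V.fil p n) : V.dTot x ∈ V.fil p (n + 1) := by
  obtain ⟨y, hy, rfl⟩ := mem_fil.1 hx
  rw [dTot_inj, inj_mem_fil]
  exact V.d_mem _ _ _ _ hy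

theorem dTot_mem_deg {n : ℤ} {x : V.Tot} (hx : x ∈ V.deg n) : V.dTot x ∈ V.deg (n + 1) := by
  obtain ⟨y, rfl⟩ := mem_deg.1 hx
  rw [dTot_inj]
  exact inj_mem_deg _

theorem dTot_dTot (x : V.Tot) : V.dTot (V.dTot x) = 0 := by
  induction x using tot_induction with
  | zero => simp
  | hom n y hy =>
    obtain ⟨y, rfl⟩ := mem_deg.1 hy
    rw [dTot_inj, dTot_inj]
    have h := congrArg (fun f => f.hom y) (V.cx.d_comp_d n (n + 1) (n + 1 + 1))
    exact (congrArg (V.inj (n + 1 + 1)) h).trans (map_zero _)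
  | add y z hy hz => rw [map_add, map_add, hy, hz, add_zero]

theorem totMap_inj (f : V ⟶ W) (n : ℤ) (x : V.cx.X n) :
    totMap f (V.inj n x) = W.inj n ((f.hom.f n).hom x) :=
  DirectSum.lmap_lof _ _ _

theorem totMap_mem_fil (f : V ⟶ W) {p n : ℤ} {x : V.Tot} (hx : x ∈ V.fil p n) :
    totMap f x ∈ W.fil p n := by
  obtain ⟨y, hy, rfl⟩ := mem_fil.1 hx
  rw [totMap_inj, inj_mem_fil]
  exact f.map_mem _ _ _ hy

theorem totMap_mem_deg (f : V ⟶ W) {n : ℤ} {x : V.Tot} (hx : x ∈ V.deg n) :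
    totMap f x ∈ W.deg n := by
  obtain ⟨y, rfl⟩ := mem_deg.1 hx
  rw [totMap_inj]
  exact inj_mem_deg _

theorem totMap_dTot (f : V ⟶ W) (x : V.Tot) : totMap f (V.dTot x) = W.dTot (totMap f x) := by
  induction x using tot_induction with
  | zero => simp
  | hom n y hy =>
    obtain ⟨y, rfl⟩ := mem_deg.1 hy
    rw [dTot_inj, totMap_inj, totMap_inj, dTot_inj]
    have h := congrArg (fun g => g.hom y) (f.hom.comm n (n + 1))
    exact (congrArg (W.inj (n + 1)) h).symm
  | add y z hy hz => simp only [map_add, hy, hz]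

theorem hom_ext_tot {f g : V ⟶ W} (h : ∀ p n, ∀ x ∈ V.fil p n, totMap f x = totMap g x) :
    f = g := by
  apply Hom.ext
  ext n x
  obtain ⟨p, hp⟩ := V.exhaustive n x
  have := h p n _ (inj_mem_fil.2 hp)
  rw [totMap_inj, totMap_inj] at this
  exact inj_injective n this

/-- A linear map of total spaces that respects degrees, filtrations and differentials comes from
a map of filtered complexes. -/
def homOfTot (φ : V.Tot →ₗ[k] W.Tot) (hφ : ∀ p n, ∀ x ∈ V.fil p n, φ x ∈ W.fil p n)
    (hd : ∀ n, ∀ x ∈ V.deg n, φ (V.dTot x) = W.dTot (φ x)) : V ⟶ W where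
  hom :=
    { f := fun n => ModuleCat.ofHom (W.coord n ∘ₗ φ ∘ₗ V.inj n)
      comm' := by
        have key : ∀ n (x : V.cx.X n), W.inj n (W.coord n (φ (V.inj n x))) = φ (V.inj n x) := by
          intro n x
          obtain ⟨p, hp⟩ := V.exhaustive n x
          exact prTot_of_mem_deg (fil_le_deg _ _ (hφ p n _ (inj_mem_fil.2 hp)))
        rintro i _ rfl
        ext x
        apply inj_injective (V := W) (i + 1)
        have h := hd i _ (inj_mem_deg x)
        rw [dTot_inj, ← key, ← key i, dTot_inj] at h
        exact h.symm }
  map_mem p n x hx := by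
    rw [← inj_mem_fil]
    have h := hφ p n _ (inj_mem_fil.2 hx)
    have h' := prTot_of_mem_deg (fil_le_deg _ _ h)
    rw [← h'] at h
    exact h

@[simp] theorem totMap_homOfTot (φ : V.Tot →ₗ[k] W.Tot)
    (hφ : ∀ p n, ∀ x ∈ V.fil p n, φ x ∈ W.fil p n)
    (hd : ∀ n, ∀ x ∈ V.deg n, φ (V.dTot x) = W.dTot (φ x)) : totMap (homOfTot φ hφ hd) = φ := by
  apply tot_linearMap_ext
  intro n x hx
  obtain ⟨p, hp⟩ := exists_mem_fil hx
  obtain ⟨y, rfl⟩ := mem_deg.1 hx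
  rw [totMap_inj]
  exact prTot_of_mem_deg (fil_le_deg _ _ (hφ p n _ hp))

theorem IsComplete.eq_zero (hV : V.IsComplete) {n : ℤ} {x : V.Tot} (hx : ∀ p, x ∈ V.fil p n) :
    x = 0 := by
  obtain ⟨y, hy, rfl⟩ := mem_fil.1 (hx 0)
  obtain ⟨z, -, hz⟩ := hV n (fun _ => 0) (fun p q _ => by simp)
  have h1 := hz y (fun p => by simpa using inj_mem_fil.1 (hx p))
  have h2 := hz 0 (fun p => by simp)
  rw [h1, ← h2, map_zero]

theorem IsComplete.exists_limit (hV : V.IsComplete) {n : ℤ} {x : ℤ → V.Tot}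
    (hx : ∀ p, x p ∈ V.deg n) (hc : ∀ p q, p ≤ q → x q - x p ∈ V.fil p n) :
    ∃ y ∈ V.deg n, ∀ p, y - x p ∈ V.fil p n := by
  choose x' hx' using fun p => mem_deg.1 (hx p)
  obtain ⟨y, hy, -⟩ := hV n x' (fun p q h => by
    rw [← inj_mem_fil, map_sub, hx', hx']
    exact hc p q h)
  refine ⟨V.inj n y, inj_mem_deg _, fun p => ?_⟩
  rw [← hx', ← map_sub, inj_mem_fil]
  exact hy p

theorem isComplete_of_tot
    (h1 : ∀ (n : ℤ) (x : ℤ → V.Tot), (∀ p, x p ∈ V.deg n) →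
      (∀ p q, p ≤ q → x q - x p ∈ V.fil p n) → ∃ y ∈ V.deg n, ∀ p, y - x p ∈ V.fil p n)
    (h2 : ∀ (n : ℤ) (x : V.Tot), (∀ p, x ∈ V.fil p n) → x = 0) : V.IsComplete := by
  intro n x hx
  obtain ⟨y, hy, hyx⟩ := h1 n (fun p => V.inj n (x p)) (fun p => inj_mem_deg _) (fun p q h => by
    rw [← map_sub, inj_mem_fil]
    exact hx p q h)
  obtain ⟨y, rfl⟩ := mem_deg.1 hy
  simp only [← map_sub, inj_mem_fil] at hyx
  refine ⟨y, hyx, fun z hz => ?_⟩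
  apply inj_injective n
  rw [← sub_eq_zero, ← map_sub]
  apply h2 n
  intro p
  rw [inj_mem_fil]
  have := sub_mem (hz p) (hyx p)
  simpa using this

/-- A multilinear map on total spaces takes values in a subspace if it does so on homogeneous
elements. -/
theorem multilinear_mem {ι : Type*} [Fintype ι] [DecidableEq ι] {V : ι → FilteredComplex k}
    {M : Type*} [AddCommGroup M] [Module k M] (f : MultilinearMap k (fun i => (V i).Tot) M)
    (S : Submodule k M)
    (h : ∀ (b : ι → ℤ) (x : ∀ i, (V i).Tot), (∀ i, x i ∈ (V i).deg (b i)) → f x ∈ S)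
    (x : ∀ i, (V i).Tot) : f x ∈ S := by
  classical
  have hx : x = fun i => ∑ j ∈ DFinsupp.support (x i), (V i).inj j (x i j) := by
    funext i
    exact (DirectSum.sum_support_of (x i)).symm
  rw [hx, MultilinearMap.map_sum_finset]
  exact Submodule.sum_mem _ (fun r _ => h r _ (fun i => inj_mem_deg _))

theorem multilinear_ext {ι : Type*} [Fintype ι] [DecidableEq ι] {V : ι → FilteredComplex k}
    {M : Type*} [AddCommGroup M] [Module k M] {f g : MultilinearMap k (fun i => (V i).Tot) M}
    (h : ∀ (b : ι → ℤ) (x : ∀ i, (V i).Tot), (∀ i, x i ∈ (V i).deg (b i)) → f x = g x) :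
    f = g := by
  refine MultilinearMap.ext fun x => ?_
  rw [← sub_eq_zero]
  have := multilinear_mem (f - g) ⊥ (fun b x hx => by simp [h b x hx]) x
  simpa using this

end FilteredComplex

namespace CompleteAlgebra

open FilteredComplex

variable {k : Type u} [Field k] {P : CompleteOperad k} {A B C : CompleteAlgebra P}

theorem comp_hom (f : A ⟶ B) (g : B ⟶ C) : (f ≫ g).hom = f.hom ≫ g.hom := rfl

theorem id_hom (A : CompleteAlgebra P) : Hom.hom (𝟙 A) = 𝟙 A.obj := rfl

/-- The map of total spaces induced by a map of algebras. -/
def map (f : A ⟶ B) : A.obj.Tot →ₗ[k] B.obj.Tot := totMap f.hom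

@[simp] theorem map_id (x : A.obj.Tot) : map (𝟙 A) x = x := totMap_id _ _

@[simp] theorem map_comp (f : A ⟶ B) (g : B ⟶ C) (x : A.obj.Tot) :
    map (f ≫ g) x = map g (map f x) := totMap_comp _ _ _

theorem map_mem_fil (f : A ⟶ B) {p n : ℤ} {x : A.obj.Tot} (hx : x ∈ A.obj.fil p n) :
    map f x ∈ B.obj.fil p n := totMap_mem_fil _ hx

theorem map_mem_deg (f : A ⟶ B) {n : ℤ} {x : A.obj.Tot} (hx : x ∈ A.obj.deg n) :
    map f x ∈ B.obj.deg n := totMap_mem_deg _ hx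

theorem map_dTot (f : A ⟶ B) (x : A.obj.Tot) : map f (A.obj.dTot x) = B.obj.dTot (map f x) :=
  totMap_dTot _ _

theorem map_action (f : A ⟶ B) (n : ℕ) (p : (P.obj n).Tot) (a : Fin n → A.obj.Tot) :
    map f (A.act n p a) = B.act n p (fun i => map f (a i)) := f.map_act n p a

theorem hom_ext {f g : A ⟶ B} (h : ∀ p n, ∀ x ∈ A.obj.fil p n, map f x = map g x) : f = g :=
  Hom.ext (hom_ext_tot h)

/-- A linear map of total spaces that respects degrees, filtrations, differentials and the
operations on homogeneous elements comes from a map of algebras. -/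
def homMk (φ : A.obj.Tot →ₗ[k] B.obj.Tot)
    (hφ : ∀ p n, ∀ x ∈ A.obj.fil p n, φ x ∈ B.obj.fil p n)
    (hd : ∀ n, ∀ x ∈ A.obj.deg n, φ (A.obj.dTot x) = B.obj.dTot (φ x))
    (hact : ∀ (n : ℕ) (e : ℤ) (b : Fin n → ℤ) (p : (P.obj n).Tot) (a : Fin n → A.obj.Tot),
      p ∈ (P.obj n).deg e → (∀ i, a i ∈ A.obj.deg (b i)) →
        φ (A.act n p a) = B.act n p (fun i => φ (a i))) : A ⟶ B where
  hom := homOfTot φ hφ hd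
  map_act n p a := by
    rw [totMap_homOfTot]
    induction p using tot_induction with
    | zero => simp
    | hom e p hp =>
      have := multilinear_ext (f := φ.compMultilinearMap (A.act n p))
        (g := (B.act n p).compLinearMap (fun _ => φ)) (fun b x hx => hact n e b p x hp hx)
      exact congrArg (fun f => f a) this
    | add p q hp hq => simp only [map_add, add_apply, hp, hq]

@[simp] theorem map_homMk (φ : A.obj.Tot →ₗ[k] B.obj.Tot) (hφ hd hact) :
    map (homMk φ hφ hd hact) = φ := totMap_homOfTot φ hφ hd

end CompleteAlgebra

/-! ### Complete algebras inside an ambient module -/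

/-- A complete `P`-algebra presented inside a module `E` of any size: `W p n` is the degree `n`
part of filtration weight `p`. The operations and the differential are defined on all of `E`, and
the laws are required for homogeneous elements of `⋃ p, W p n` only. The projectors `pr n` make the
degrees independent. -/
structure InternalAlgebra {k : Type u} [Field k] (P : CompleteOperad k) (E : Type w)
    [AddCommGroup E] [Module k E] where
  W : ℤ → ℤ → Submodule k E
  anti : ∀ {p q : ℤ}, p ≤ q → ∀ n, W q n ≤ W p n
  pr : ℤ → E →ₗ[k] E
  pr_same : ∀ {p n : ℤ} {x : E}, x ∈ W p n → pr n x = x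
  pr_ne : ∀ {p m n : ℤ} {x : E}, m ≠ n → x ∈ W p n → pr m x = 0
  D : E →ₗ[k] E
  D_mem : ∀ {p n : ℤ} {x : E}, x ∈ W p n → D x ∈ W p (n + 1)
  D_D : ∀ {p n : ℤ} {x : E}, x ∈ W p n → D (D x) = 0
  complete : ∀ (n : ℤ) (x : ℤ → E), (∀ p, ∃ q, x p ∈ W q n) →
    (∀ p q, p ≤ q → x q - x p ∈ W p n) → ∃ y, ∀ p, y - x p ∈ W p n
  hausdorff : ∀ (n : ℤ) (x : E), (∀ p, x ∈ W p n) → x = 0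
  act : ∀ n : ℕ, (P.obj n).Tot →ₗ[k] MultilinearMap k (fun _ : Fin n => E) E
  act_mem : ∀ (n : ℕ) (v e : ℤ) (w b : Fin n → ℤ) (p : (P.obj n).Tot) (a : Fin n → E),
    p ∈ (P.obj n).fil v e → (∀ i, a i ∈ W (w i) (b i)) →
      act n p a ∈ W (v + ∑ i, w i) (e + ∑ i, b i)
  D_act : ∀ (n : ℕ) (e : ℤ) (w b : Fin n → ℤ) (p : (P.obj n).Tot) (a : Fin n → E),
    p ∈ (P.obj n).deg e → (∀ i, a i ∈ W (w i) (b i)) →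
      D (act n p a) = act n ((P.obj n).dTot p) a +
        ∑ i, (e + ∑ j with j < i, b j).negOnePow • act n p (Function.update a i (D (a i)))
  one_act : ∀ (p n : ℤ) (a : E), a ∈ W p n → act 1 P.one (fun _ => a) = a
  act_assoc : ∀ {m : ℕ} (n : Fin m → ℕ) (b : Fin m → ℤ) (w c : ∀ i, Fin (n i) → ℤ) (e : ℤ)
    (p : (P.obj m).Tot) (q : ∀ i, (P.obj (n i)).Tot) (a : ∀ i, Fin (n i) → E),
    p ∈ (P.obj m).deg e →
    (∀ i, q i ∈ (P.obj (n i)).deg (b i)) → (∀ i s, a i s ∈ W (w i s) (c i s)) →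
      act (∑ i, n i) (P.comp n p q) (fun t => a (blockIndex n t) (blockPos n t)) =
        shuffleSign b (fun i => ∑ s, c i s) • act m p (fun i => act (n i) (q i) (a i))
  act_perm : ∀ {m n : ℕ} (σ : Fin m ≃ Fin n) (w b : Fin n → ℤ) (e : ℤ)
    (p : (P.obj m).Tot) (a : Fin n → E), p ∈ (P.obj m).deg e →
    (∀ j, a j ∈ W (w j) (b j)) →
      act n (FilteredComplex.totMap (P.perm σ) p) a =
        koszulSign σ b • act m p (fun i => a (σ i))

namespace InternalAlgebra

open FilteredComplex

variable {k : Type u} [Field k] {P : CompleteOperad k} {E : Type w} [AddCommGroup E] [Module k E]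
  (I : InternalAlgebra P E)

/-- The elements of degree `n`. -/
def grade (n : ℤ) : Submodule k E := ⨆ p, I.W p n

theorem mem_grade {n : ℤ} {x : E} : x ∈ I.grade n ↔ ∃ p, x ∈ I.W p n := by
  refine Submodule.mem_iSup_of_directed _ (fun p q => ⟨min p q, ?_, ?_⟩)
  · exact I.anti (min_le_left _ _) n
  · exact I.anti (min_le_right _ _) n

theorem D_mem_grade {n : ℤ} {x : E} (hx : x ∈ I.grade n) : I.D x ∈ I.grade (n + 1) := by
  obtain ⟨p, hp⟩ := I.mem_grade.1 hx
  exact I.mem_grade.2 ⟨p, I.D_mem hp⟩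

variable [∀ n, Small.{u} (I.grade n)]

/-- The degree `n` part, as a module in the universe of the field. -/
def incl (n : ℤ) : Shrink.{u} (I.grade n) →ₗ[k] E :=
  (I.grade n).subtype ∘ₗ (Shrink.linearEquiv k (I.grade n)).toLinearMap

theorem incl_injective (n : ℤ) : Function.Injective (I.incl n) :=
  Subtype.val_injective.comp (Shrink.linearEquiv k (I.grade n)).injective

theorem incl_mem (n : ℤ) (x : Shrink.{u} (I.grade n)) : I.incl n x ∈ I.grade n :=
  (Shrink.linearEquiv k (I.grade n) x).2

theorem exists_incl {n : ℤ} {x : E} (hx : x ∈ I.grade n) : ∃ y, I.incl n y = x :=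
  ⟨(Shrink.linearEquiv k (I.grade n)).symm ⟨x, hx⟩, by simp [incl]⟩

/-- The differential. -/
def diff (i j : ℤ) : Shrink.{u} (I.grade i) →ₗ[k] Shrink.{u} (I.grade j) :=
  if h : i + 1 = j then
    (Shrink.linearEquiv k (I.grade j)).symm.toLinearMap ∘ₗ
      LinearMap.restrict I.D (fun _ hx => h ▸ I.D_mem_grade hx) ∘ₗ
      (Shrink.linearEquiv k (I.grade i)).toLinearMap
  else 0

theorem incl_diff {i j : ℤ} (h : i + 1 = j) (x : Shrink.{u} (I.grade i)) :
    I.incl j (I.diff i j x) = I.D (I.incl i x) := by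
  simp [diff, h, incl]

/-- The filtered complex of an internally presented algebra. -/
def toFilteredComplex : FilteredComplex k where
  cx :=
    { X := fun n => ModuleCat.of k (Shrink.{u} (I.grade n))
      d := fun i j => ModuleCat.ofHom (I.diff i j)
      shape := by
        intro i j h
        have : I.diff i j = 0 := dif_neg h
        rw [this]
        rfl
      d_comp_d' := by
        rintro i _ _ rfl rfl
        refine ModuleCat.hom_ext (LinearMap.ext fun x => I.incl_injective _ ?_)
        obtain ⟨p, hp⟩ := I.mem_grade.1 (I.incl_mem i x)
        exact (I.incl_diff rfl _).trans
          ((congrArg I.D (I.incl_diff rfl x)).trans ((I.D_D hp).trans (map_zero _).symm)) }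
  F p n := (I.W p n).comap (I.incl n)
  anti h n x hx := I.anti h n hx
  d_mem p i j x hx := by
    change I.incl j (I.diff i j x) ∈ I.W p j
    by_cases h : i + 1 = j
    · rw [I.incl_diff h]
      subst h
      exact I.D_mem hx
    · have : I.diff i j = 0 := dif_neg h
      rw [this]
      simp
  exhaustive n x := I.mem_grade.1 (I.incl_mem n x)

/-- The inclusion of the total space into the ambient module. -/
def totEmb : I.toFilteredComplex.Tot →ₗ[k] E :=
  DirectSum.toModule k ℤ E I.incl

/-- The inclusion of the degree `n` part of the filtered complex into the ambient module. -/
def inclX (n : ℤ) : (I.toFilteredComplex.cx.X n : Type u) →ₗ[k] E := I.incl n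

theorem inclX_injective (n : ℤ) : Function.Injective (I.inclX n) := I.incl_injective n

theorem totEmb_inj (n : ℤ) (x : I.toFilteredComplex.cx.X n) :
    I.totEmb (I.toFilteredComplex.inj n x) = I.inclX n x :=
  DirectSum.toModule_lof _ _ _

theorem totEmb_mem {p n : ℤ} {x : I.toFilteredComplex.Tot} (hx : x ∈ I.toFilteredComplex.fil p n) :
    I.totEmb x ∈ I.W p n := by
  obtain ⟨y, hy, rfl⟩ := mem_fil.1 hx
  rw [totEmb_inj]
  exact hy

theorem exists_totEmb {p n : ℤ} {x : E} (hx : x ∈ I.W p n) :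
    ∃ y ∈ I.toFilteredComplex.fil p n, I.totEmb y = x := by
  obtain ⟨y, rfl⟩ := I.exists_incl (I.mem_grade.2 ⟨p, hx⟩)
  exact ⟨_, inj_mem_fil.2 hx, I.totEmb_inj n y⟩

theorem pr_totEmb (n : ℤ) (x : I.toFilteredComplex.Tot) :
    I.pr n (I.totEmb x) = I.inclX n (I.toFilteredComplex.coord n x) := by
  induction x using tot_induction with
  | zero => simp
  | hom m y hy =>
    obtain ⟨p, hp⟩ := exists_mem_fil hy
    have hW := I.totEmb_mem hp
    obtain ⟨y, rfl⟩ := mem_deg.1 hy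
    rcases eq_or_ne n m with rfl | h
    · rw [I.pr_same hW, coord_inj, totEmb_inj]
    · rw [I.pr_ne h hW, coord_inj_ne h, map_zero]
  | add y z hy hz => simp only [map_add, hy, hz]

theorem totEmb_injective : Function.Injective I.totEmb := by
  intro x y h
  apply ext_coord
  intro n
  apply I.inclX_injective
  have h' := congrArg (I.pr n) h
  rwa [pr_totEmb, pr_totEmb] at h'

theorem mem_tot_fil_iff {p n : ℤ} {x : I.toFilteredComplex.Tot} :
    x ∈ I.toFilteredComplex.fil p n ↔ I.totEmb x ∈ I.W p n := by
  refine ⟨I.totEmb_mem, fun h => ?_⟩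
  obtain ⟨y, hy, h'⟩ := I.exists_totEmb h
  rwa [← I.totEmb_injective h']

theorem totEmb_dTot (x : I.toFilteredComplex.Tot) :
    I.totEmb (I.toFilteredComplex.dTot x) = I.D (I.totEmb x) := by
  induction x using tot_induction with
  | zero => simp
  | hom m y hy =>
    obtain ⟨y, rfl⟩ := mem_deg.1 hy
    rw [dTot_inj, totEmb_inj, totEmb_inj]
    exact I.incl_diff rfl y
  | add y z hy hz => simp only [map_add, hy, hz]

theorem isComplete : I.toFilteredComplex.IsComplete := by
  apply isComplete_of_tot
  · intro n x hx hc
    obtain ⟨y, hy⟩ := I.complete n (fun p => I.totEmb (x p))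
      (fun p => (exists_mem_fil (hx p)).imp fun q hq => I.totEmb_mem hq)
      (fun p q h => by
        rw [← map_sub]
        exact I.totEmb_mem (hc p q h))
    choose z hz hz' using fun p => I.exists_totEmb (hy p)
    have h0 : ∀ p, z 0 + x 0 - x p = z p := by
      intro p
      apply I.totEmb_injective
      rw [map_sub, map_add, hz', hz']
      abel
    refine ⟨z 0 + x 0, add_mem (fil_le_deg _ _ (hz 0)) (hx 0), fun p => ?_⟩
    rw [h0]
    exact hz p
  · intro n x hx
    apply I.totEmb_injective
    rw [map_zero]
    exact I.hausdorff n _ (fun p => I.totEmb_mem (hx p))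

/-- A linear left inverse of the inclusion of the total space. -/
def totRetr : E →ₗ[k] I.toFilteredComplex.Tot :=
  (LinearMap.exists_leftInverse_of_injective I.totEmb
    (LinearMap.ker_eq_bot.2 I.totEmb_injective)).choose

theorem totRetr_totEmb (x : I.toFilteredComplex.Tot) : I.totRetr (I.totEmb x) = x :=
  congrArg (fun f => f x) (LinearMap.exists_leftInverse_of_injective I.totEmb
    (LinearMap.ker_eq_bot.2 I.totEmb_injective)).choose_spec

/-- The operations on the total space. -/
def actTot (n : ℕ) : (P.obj n).Tot →ₗ[k]
    MultilinearMap k (fun _ : Fin n => I.toFilteredComplex.Tot) I.toFilteredComplex.Tot where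
  toFun p := I.totRetr.compMultilinearMap ((I.act n p).compLinearMap (fun _ => I.totEmb))
  map_add' p q := by
    ext a
    simp
  map_smul' c p := by
    ext a
    simp

theorem totEmb_actTot (n : ℕ) (p : (P.obj n).Tot) (a : Fin n → I.toFilteredComplex.Tot) :
    I.totEmb (I.actTot n p a) = I.act n p (fun i => I.totEmb (a i)) := by
  have key : I.act n p (fun i => I.totEmb (a i)) ∈ LinearMap.range I.totEmb := by
    induction p using tot_induction with
    | zero => simp
    | hom e p hp =>
      refine multilinear_mem ((I.act n p).compLinearMap (fun _ => I.totEmb)) _ (fun b x hx => ?_) a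
      obtain ⟨v, hv⟩ := exists_mem_fil hp
      choose w hw using fun i => exists_mem_fil (hx i)
      obtain ⟨y, -, hy⟩ := I.exists_totEmb (I.act_mem n v e w b p _ hv (fun i => I.totEmb_mem (hw i)))
      exact ⟨y, hy⟩
    | add p q hp hq =>
      rw [map_add, add_apply]
      exact add_mem hp hq
  obtain ⟨y, hy⟩ := key
  change I.totEmb (I.totRetr (I.act n p (fun i => I.totEmb (a i)))) = _
  rw [← hy, totRetr_totEmb]

theorem exists_tot_weight {ι : Type*} {a : ι → I.toFilteredComplex.Tot} {b : ι → ℤ}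
    (ha : ∀ i, a i ∈ I.toFilteredComplex.deg (b i)) :
    ∃ w : ι → ℤ, ∀ i, I.totEmb (a i) ∈ I.W (w i) (b i) := by
  choose w hw using fun i => exists_mem_fil (ha i)
  exact ⟨w, fun i => I.totEmb_mem (hw i)⟩

/-- The complete algebra given by an internal presentation. -/
def toAlgebra : CompleteAlgebra P where
  obj := I.toFilteredComplex
  complete := I.isComplete
  act := I.actTot
  act_mem n v e w b p a hp ha := by
    rw [mem_tot_fil_iff, totEmb_actTot]
    exact I.act_mem n v e w b p _ hp (fun i => I.totEmb_mem (ha i))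
  d_act n e b p a hp ha := by
    obtain ⟨w, hw⟩ := I.exists_tot_weight ha
    apply I.totEmb_injective
    rw [totEmb_dTot, totEmb_actTot, I.D_act n e w b p _ hp hw, map_add, totEmb_actTot, map_sum]
    congr 1
    refine Finset.sum_congr rfl fun i _ => ?_
    rw [Units.smul_def, Units.smul_def, map_zsmul, totEmb_actTot, ← totEmb_dTot]
    congr 2
    funext j
    rw [Function.apply_update (fun _ => I.totEmb)]
  one_act a := by
    apply I.totEmb_injective
    rw [totEmb_actTot]
    induction a using tot_induction with
    | zero =>
      rw [map_zero]
      exact (I.act 1 P.one).map_zero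
    | hom n y hy =>
      obtain ⟨p, hp⟩ := exists_mem_fil hy
      exact I.one_act p n _ (I.totEmb_mem hp)
    | add y z hy hz =>
      have := (I.act 1 P.one).map_update_add (fun _ => 0) 0 (I.totEmb y) (I.totEmb z)
      have e : ∀ t : E, Function.update (fun _ : Fin 1 => (0 : E)) 0 t = fun _ => t := by
        intro t
        funext i
        rw [Subsingleton.elim i 0, Function.update_self]
      rw [e, e, e] at this
      rw [map_add, this, hy, hz]
  act_assoc {m} n b c p q a hq ha := by
    choose w hw using fun i => I.exists_tot_weight (ha i)
    apply I.totEmb_injective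
    rw [Units.smul_def, map_zsmul, ← Units.smul_def]
    simp only [totEmb_actTot]
    induction p using tot_induction with
    | zero => simp
    | hom e p hp =>
      exact I.act_assoc n b w c e p q (fun i s => I.totEmb (a i s)) hp hq hw
    | add y z hy hz => simp only [map_add, add_apply, hy, hz, smul_add]
  act_perm {m n} σ b p a ha := by
    obtain ⟨w, hw⟩ := I.exists_tot_weight ha
    apply I.totEmb_injective
    rw [Units.smul_def, map_zsmul, ← Units.smul_def]
    simp only [totEmb_actTot]
    induction p using tot_induction with
    | zero => simp
    | hom e p hp => exact I.act_perm σ w b e p _ hp hw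
    | add y z hy hz => simp only [map_add, add_apply, hy, hz, smul_add]

/-- The inclusion of the total space of the algebra into the ambient module. -/
def emb : I.toAlgebra.obj.Tot →ₗ[k] E := I.totEmb

/-- A linear left inverse of the inclusion of the total space. -/
def retr : E →ₗ[k] I.toAlgebra.obj.Tot := I.totRetr

theorem emb_injective : Function.Injective I.emb := I.totEmb_injective

@[simp] theorem retr_emb (x : I.toAlgebra.obj.Tot) : I.retr (I.emb x) = x := I.totRetr_totEmb x

theorem mem_fil_iff {p n : ℤ} {x : I.toAlgebra.obj.Tot} :
    x ∈ I.toAlgebra.obj.fil p n ↔ I.emb x ∈ I.W p n := I.mem_tot_fil_iff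

theorem emb_mem {p n : ℤ} {x : I.toAlgebra.obj.Tot} (hx : x ∈ I.toAlgebra.obj.fil p n) :
    I.emb x ∈ I.W p n := I.totEmb_mem hx

theorem exists_emb {p n : ℤ} {x : E} (hx : x ∈ I.W p n) :
    ∃ y ∈ I.toAlgebra.obj.fil p n, I.emb y = x := I.exists_totEmb hx

theorem emb_dTot (x : I.toAlgebra.obj.Tot) : I.emb (I.toAlgebra.obj.dTot x) = I.D (I.emb x) :=
  I.totEmb_dTot x

theorem emb_act (n : ℕ) (p : (P.obj n).Tot) (a : Fin n → I.toAlgebra.obj.Tot) :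
    I.emb (I.toAlgebra.act n p a) = I.act n p (fun i => I.emb (a i)) := I.totEmb_actTot n p a

theorem exists_weight {ι : Type*} {a : ι → I.toAlgebra.obj.Tot} {b : ι → ℤ}
    (ha : ∀ i, a i ∈ I.toAlgebra.obj.deg (b i)) :
    ∃ w : ι → ℤ, ∀ i, I.emb (a i) ∈ I.W (w i) (b i) := I.exists_tot_weight ha

end InternalAlgebra

namespace InternalAlgebra

open FilteredComplex CompleteAlgebra

variable {k : Type u} [Field k] {P : CompleteOperad k} {E : Type w} [AddCommGroup E] [Module k E]
  (I : InternalAlgebra P E) [∀ n, Small.{u} (I.grade n)] {B : CompleteAlgebra P}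

section lift

variable (ψ : B.obj.Tot →ₗ[k] E) (hψ : ∀ p n, ∀ x ∈ B.obj.fil p n, ψ x ∈ I.W p n)

include hψ in
theorem emb_retr_apply (x : B.obj.Tot) : I.emb (I.retr (ψ x)) = ψ x := by
  induction x using tot_induction with
  | zero => simp
  | hom n y hy =>
    obtain ⟨p, hp⟩ := exists_mem_fil hy
    obtain ⟨z, -, hz⟩ := I.exists_emb (hψ p n y hp)
    rw [← hz, retr_emb]
  | add y z hy hz => simp only [map_add, hy, hz]

include hψ in
/-- A linear map into the ambient module that respects all structure gives a map of algebras. -/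
def lift (hd : ∀ n, ∀ x ∈ B.obj.deg n, ψ (B.obj.dTot x) = I.D (ψ x))
    (hact : ∀ (n : ℕ) (e : ℤ) (b : Fin n → ℤ) (p : (P.obj n).Tot) (a : Fin n → B.obj.Tot),
      p ∈ (P.obj n).deg e → (∀ i, a i ∈ B.obj.deg (b i)) →
        ψ (B.act n p a) = I.act n p (fun i => ψ (a i))) : B ⟶ I.toAlgebra :=
  homMk (A := B) (B := I.toAlgebra) (I.retr ∘ₗ ψ)
    (fun p n x hx => by
      refine I.mem_fil_iff.2 ?_
      rw [LinearMap.comp_apply, I.emb_retr_apply ψ hψ]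
      exact hψ p n x hx)
    (fun n x hx => by
      apply I.emb_injective
      rw [I.emb_dTot, LinearMap.comp_apply, LinearMap.comp_apply, I.emb_retr_apply ψ hψ,
        I.emb_retr_apply ψ hψ, hd n x hx])
    (fun n e b p a hp ha => by
      apply I.emb_injective
      rw [I.emb_act]
      simp only [LinearMap.comp_apply, I.emb_retr_apply ψ hψ]
      exact hact n e b p a hp ha)

@[simp] theorem emb_map_lift (hd hact) (x : B.obj.Tot) :
    I.emb (map (I.lift ψ hψ hd hact) x) = ψ x := by
  unfold lift
  rw [map_homMk, LinearMap.comp_apply, I.emb_retr_apply ψ hψ]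

end lift

/-- A linear map out of the ambient module that respects all structure gives a map of algebras. -/
def desc (χ : E →ₗ[k] B.obj.Tot) (hχ : ∀ p n, ∀ x ∈ I.W p n, χ x ∈ B.obj.fil p n)
    (hd : ∀ p n, ∀ x ∈ I.W p n, χ (I.D x) = B.obj.dTot (χ x))
    (hact : ∀ (n : ℕ) (v e : ℤ) (w b : Fin n → ℤ) (p : (P.obj n).Tot) (a : Fin n → E),
      p ∈ (P.obj n).fil v e → (∀ i, a i ∈ I.W (w i) (b i)) →
        χ (I.act n p a) = B.act n p (fun i => χ (a i))) : I.toAlgebra ⟶ B :=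
  homMk (A := I.toAlgebra) (B := B) (χ ∘ₗ I.emb)
    (fun p n x hx => hχ p n _ (I.emb_mem hx))
    (fun n x hx => by
      obtain ⟨p, hp⟩ := exists_mem_fil hx
      exact (congrArg χ (I.emb_dTot x)).trans (hd p n _ (I.emb_mem hp)))
    (fun n e b p a hp ha => by
      obtain ⟨v, hv⟩ := exists_mem_fil hp
      obtain ⟨w, hw⟩ := I.exists_weight ha
      exact (congrArg χ (I.emb_act n p a)).trans (hact n v e w b p _ hv hw))

@[simp] theorem map_desc (χ : E →ₗ[k] B.obj.Tot) (hχ hd hact) (x : I.toAlgebra.obj.Tot) :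
    map (I.desc χ hχ hd hact) x = χ (I.emb x) := by
  unfold desc
  rw [map_homMk]
  rfl

end InternalAlgebra

/-! ### Subalgebras of products -/

open FilteredComplex CompleteAlgebra

variable {k : Type u} [Field k] {P : CompleteOperad k}

/-- A complete subalgebra of the product of a family of complete algebras, with a filtration that
may be finer than the induced one. The family may be large: only the subalgebra has to be small. -/
structure SubProduct {K : Type w} (A : K → CompleteAlgebra P) where
  W : ℤ → ℤ → Submodule k (∀ c, (A c).obj.Tot)
  mem_fil : ∀ {p n : ℤ} {y : ∀ c, (A c).obj.Tot}, y ∈ W p n → ∀ c, y c ∈ (A c).obj.fil p n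
  anti : ∀ {p q : ℤ}, p ≤ q → ∀ n, W q n ≤ W p n
  D_mem : ∀ {p n : ℤ} {y : ∀ c, (A c).obj.Tot}, y ∈ W p n →
    (fun c => (A c).obj.dTot (y c)) ∈ W p (n + 1)
  act_mem : ∀ (n : ℕ) (v e : ℤ) (w b : Fin n → ℤ) (p : (P.obj n).Tot)
    (a : Fin n → ∀ c, (A c).obj.Tot), p ∈ (P.obj n).fil v e → (∀ i, a i ∈ W (w i) (b i)) →
      (fun c => (A c).act n p (fun i => a i c)) ∈ W (v + ∑ i, w i) (e + ∑ i, b i)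
  complete : ∀ (n : ℤ) (x : ℤ → ∀ c, (A c).obj.Tot), (∀ p, ∃ q, x p ∈ W q n) →
    (∀ p q, p ≤ q → x q - x p ∈ W p n) → ∃ y, ∀ p, y - x p ∈ W p n

namespace SubProduct

variable {K : Type w} {A : K → CompleteAlgebra P} (S : SubProduct A)

/-- A subalgebra of a product, as an internally presented algebra. -/
def toInternal : InternalAlgebra P (∀ c, (A c).obj.Tot) where
  W := S.W
  anti := S.anti
  pr n := LinearMap.pi (fun c => (A c).obj.prTot n ∘ₗ LinearMap.proj c)
  pr_same hx := funext fun c => prTot_of_mem_deg (fil_le_deg _ _ (S.mem_fil hx c))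
  pr_ne h hx := funext fun c => prTot_of_mem_deg_ne h (fil_le_deg _ _ (S.mem_fil hx c))
  D := LinearMap.pi (fun c => (A c).obj.dTot ∘ₗ LinearMap.proj c)
  D_mem hx := S.D_mem hx
  D_D _ := funext fun c => dTot_dTot _
  complete := S.complete
  hausdorff n x hx := funext fun c => (A c).complete.eq_zero (fun p => S.mem_fil (hx p) c)
  act n :=
    { toFun := fun p => MultilinearMap.pi (fun c =>
        ((A c).act n p).compLinearMap (fun _ => LinearMap.proj c))
      map_add' := fun p q => by
        ext a
        simp
      map_smul' := fun r p => by
        ext a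
        simp }
  act_mem := S.act_mem
  D_act n e w b p a hp ha := by
    funext c
    have h := (A c).d_act n e b p (fun i => a i c) hp
      (fun i => fil_le_deg _ _ (S.mem_fil (ha i) c))
    refine h.trans ?_
    rw [Pi.add_apply, Finset.sum_apply]
    congr 1
    refine Finset.sum_congr rfl fun i _ => ?_
    rw [Pi.smul_apply]
    refine congrArg (fun t => _ • (A c).act n p t) (funext fun j => ?_)
    exact (Function.apply_update (fun _ (f : ∀ c, (A c).obj.Tot) => f c) a i
      (fun c => (A c).obj.dTot (a i c)) j).symm
  one_act p n a _ := funext fun c => (A c).one_act (a c)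
  act_assoc n b w c e p q a _ hq ha := funext fun t =>
    (A t).act_assoc n b c p q (fun i s => a i s t) hq
      (fun i s => fil_le_deg _ _ (S.mem_fil (ha i s) t))
  act_perm σ w b e p a _ ha := funext fun c =>
    (A c).act_perm σ b p (fun i => a i c) (fun i => fil_le_deg _ _ (S.mem_fil (ha i) c))

variable [∀ n, Small.{u} (S.toInternal.grade n)]

/-- The algebra given by a subalgebra of a product. -/
abbrev alg : CompleteAlgebra P := S.toInternal.toAlgebra

/-- The inclusion into the product. -/
def emb : S.alg.obj.Tot →ₗ[k] (∀ c, (A c).obj.Tot) := S.toInternal.emb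

theorem emb_injective : Function.Injective S.emb := S.toInternal.emb_injective

theorem mem_fil_iff {p n : ℤ} {x : S.alg.obj.Tot} : x ∈ S.alg.obj.fil p n ↔ S.emb x ∈ S.W p n :=
  S.toInternal.mem_fil_iff

theorem exists_emb {p n : ℤ} {x : ∀ c, (A c).obj.Tot} (hx : x ∈ S.W p n) :
    ∃ y ∈ S.alg.obj.fil p n, S.emb y = x := S.toInternal.exists_emb hx

/-- The projections of a subalgebra of a product. -/
def proj (c : K) : S.alg ⟶ A c :=
  S.toInternal.desc (LinearMap.proj c) (fun _ _ _ hx => S.mem_fil hx c) (fun _ _ _ _ => rfl)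
    (fun _ _ _ _ _ _ _ _ _ => rfl)

@[simp] theorem map_proj (c : K) (x : S.alg.obj.Tot) : map (S.proj c) x = S.emb x c :=
  S.toInternal.map_desc _ _ _ _ _

/-- The map to a subalgebra of a product with given components. -/
def lift {B : CompleteAlgebra P} (h : ∀ c, B ⟶ A c)
    (hW : ∀ p n, ∀ x ∈ B.obj.fil p n, (fun c => map (h c) x) ∈ S.W p n) : B ⟶ S.alg :=
  S.toInternal.lift (LinearMap.pi (fun c => map (h c))) hW
    (fun _ _ _ => funext fun c => map_dTot (h c) _)
    (fun n _ _ p a _ _ => funext fun c => map_action (h c) n p a)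

@[simp] theorem emb_lift {B : CompleteAlgebra P} (h : ∀ c, B ⟶ A c) (hW) (x : B.obj.Tot) (c : K) :
    S.emb (map (S.lift h hW) x) c = map (h c) x :=
  congrFun (S.toInternal.emb_map_lift (LinearMap.pi (fun c => map (h c))) hW _ _ x) c

@[simp] theorem lift_proj {B : CompleteAlgebra P} (h : ∀ c, B ⟶ A c) (hW) (c : K) :
    S.lift h hW ≫ S.proj c = h c :=
  CompleteAlgebra.hom_ext (fun p n x _ => by simp)

theorem hom_ext {B : CompleteAlgebra P} {f g : B ⟶ S.alg}
    (h : ∀ c, f ≫ S.proj c = g ≫ S.proj c) : f = g :=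
  CompleteAlgebra.hom_ext (fun p n x _ => S.emb_injective (funext fun c => by
    have := congrArg (fun t => map t x) (h c)
    simpa using this))

/-- The full product of a family of algebras: in each weight and degree it consists of all
families. -/
def full (A : K → CompleteAlgebra P) : SubProduct A where
  W p n := Submodule.pi Set.univ (fun c => (A c).obj.fil p n)
  mem_fil hy c := hy c (Set.mem_univ c)
  anti h n y hy c _ := fil_anti h n (hy c (Set.mem_univ c))
  D_mem hy c _ := dTot_mem_fil (hy c (Set.mem_univ c))
  act_mem n v e w b p a hp ha c _ :=
    (A c).act_mem n v e w b p _ hp (fun i => ha i c (Set.mem_univ c))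
  complete n x hx hc := by
    have h : ∀ c, ∃ y, ∀ p, y - x p c ∈ (A c).obj.fil p n := fun c => by
      obtain ⟨y, -, hy⟩ := (A c).complete.exists_limit (x := fun p => x p c)
        (fun p => by
          obtain ⟨q, hq⟩ := hx p
          exact fil_le_deg _ _ (hq c (Set.mem_univ c)))
        (fun p q h => hc p q h c (Set.mem_univ c))
      exact ⟨y, hy⟩
    choose y hy using h
    exact ⟨y, fun p c _ => hy c p⟩

theorem mem_full {A : K → CompleteAlgebra P} {p n : ℤ} {y : ∀ c, (A c).obj.Tot} :
    y ∈ (full A).W p n ↔ ∀ c, y c ∈ (A c).obj.fil p n :=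
  ⟨fun h c => h c (Set.mem_univ c), fun h c _ => h c⟩

end SubProduct

/-! ### Limits -/

namespace CompleteAlgebra

variable {J : Type u} [Category.{u} J] (F : J ⥤ CompleteAlgebra P)

/-- The compatible families of elements of a diagram of algebras. -/
def limitSub : SubProduct F.obj where
  W p n :=
    { carrier := {y | (∀ j, y j ∈ (F.obj j).obj.fil p n) ∧
        ∀ i j (f : i ⟶ j), map (F.map f) (y i) = y j}
      add_mem' := fun hx hy => ⟨fun j => add_mem (hx.1 j) (hy.1 j), fun i j f => by
        rw [Pi.add_apply, Pi.add_apply, map_add, hx.2, hy.2]⟩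
      zero_mem' := ⟨fun j => zero_mem _, fun i j f => map_zero _⟩
      smul_mem' := fun c x hx => ⟨fun j => Submodule.smul_mem _ c (hx.1 j), fun i j f => by
        rw [Pi.smul_apply, Pi.smul_apply, map_smul, hx.2]⟩ }
  mem_fil hy := hy.1
  anti h n y hy := ⟨fun j => fil_anti h n (hy.1 j), hy.2⟩
  D_mem hy := ⟨fun j => dTot_mem_fil (hy.1 j), fun i j f => by rw [map_dTot, hy.2]⟩
  act_mem n v e w b p a hp ha := by
    refine ⟨fun j => (F.obj j).act_mem n v e w b p _ hp (fun i => (ha i).1 j), fun i j f => ?_⟩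
    rw [map_action]
    simp only [(ha _).2]
  complete n x hx hc := by
    obtain ⟨y, hy⟩ := (SubProduct.full F.obj).complete n x
      (fun p => (hx p).imp fun q hq => SubProduct.mem_full.2 hq.1)
      (fun p q h => SubProduct.mem_full.2 (hc p q h).1)
    refine ⟨y, fun p => ⟨SubProduct.mem_full.1 (hy p), fun i j f => ?_⟩⟩
    have hc : ∀ p, map (F.map f) (x p i) = x p j := fun p => by
      obtain ⟨q, hq⟩ := hx p
      exact hq.2 i j f
    have h0 : map (F.map f) (y i) = y j := by
      rw [← sub_eq_zero]
      apply (F.obj j).complete.eq_zero (n := n)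
      intro p
      have h1 := map_mem_fil (F.map f) (SubProduct.mem_full.1 (hy p) i)
      have h2 := SubProduct.mem_full.1 (hy p) j
      simpa [map_sub, hc] using sub_mem h1 h2
    rw [Pi.sub_apply, Pi.sub_apply, map_sub, h0, hc]

/-- The limit cone of a diagram of algebras. -/
def limitCone : Cone F where
  pt := (limitSub F).alg
  π :=
    { app := fun j => (limitSub F).proj j
      naturality := fun i j f => hom_ext fun p n x hx => by
        have := ((limitSub F).mem_fil_iff.1 hx).2 i j f
        simpa using this.symm }

/-- The limit cone is a limit. -/
def limitConeIsLimit : IsLimit (limitCone F) where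
  lift s := (limitSub F).lift s.π.app (fun p n x hx =>
    ⟨fun j => map_mem_fil _ hx, fun i j f => by rw [← map_comp, s.w]⟩)
  fac s j := (limitSub F).lift_proj _ _ j
  uniq s m hm := (limitSub F).hom_ext fun c => (hm c).trans ((limitSub F).lift_proj _ _ c).symm

theorem hasLimitsOfSize : HasLimitsOfSize.{u, u} (CompleteAlgebra P) where
  has_limits_of_shape _ _ := { has_limit := fun F => ⟨⟨_, limitConeIsLimit F⟩⟩ }

end CompleteAlgebra

/-! ### The subalgebra of a product generated by a set of elements -/

open FilteredComplex CompleteAlgebra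

variable {k : Type u} [Field k] {P : CompleteOperad k}

/-- The formal expressions in generators from `G`, built with the structure of a complete
`P`-algebra, including limits of sequences. They form a small type, which bounds the size of a
generated subalgebra. -/
inductive AlgebraTerm (P : CompleteOperad k) (G : Type u) : Type u
  | gen (g : G) : AlgebraTerm P G
  | zero : AlgebraTerm P G
  | add (s t : AlgebraTerm P G) : AlgebraTerm P G
  | smul (r : k) (t : AlgebraTerm P G) : AlgebraTerm P G
  | diff (t : AlgebraTerm P G) : AlgebraTerm P G
  | act (m : ℕ) (p : (P.obj m).Tot) (t : Fin m → AlgebraTerm P G) : AlgebraTerm P G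
  | lim (n : ℤ) (t : ℤ → AlgebraTerm P G) : AlgebraTerm P G

section

variable {K : Type w} (A : K → CompleteAlgebra P) {G : Type u} (gn : G → ℤ)
  (x : G → ∀ c, (A c).obj.Tot)

/-- The families of degree `n` obtained from the families `x g` of degree `gn g` with the structure
of a complete `P`-algebra, including uniform limits of sequences. -/
inductive Generated : ℤ → (∀ c, (A c).obj.Tot) → Prop
  | gen (g : G) : Generated (gn g) (x g)
  | zero (n : ℤ) : Generated n 0
  | add {n : ℤ} {y z : ∀ c, (A c).obj.Tot} :
      Generated n y → Generated n z → Generated n (y + z)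
  | smul {n : ℤ} (r : k) {y : ∀ c, (A c).obj.Tot} : Generated n y → Generated n (r • y)
  | diff {n : ℤ} {y : ∀ c, (A c).obj.Tot} :
      Generated n y → Generated (n + 1) (fun c => (A c).obj.dTot (y c))
  | act {m : ℕ} {e : ℤ} {p : (P.obj m).Tot} (hp : p ∈ (P.obj m).deg e) {b : Fin m → ℤ}
      {y : Fin m → ∀ c, (A c).obj.Tot} :
      (∀ i, Generated (b i) (y i)) →
        Generated (e + ∑ i, b i) (fun c => (A c).act m p (fun i => y i c))
  | lim {n : ℤ} {y : ℤ → ∀ c, (A c).obj.Tot} {z : ∀ c, (A c).obj.Tot}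
      (hz : ∀ p c, z c - y p c ∈ (A c).obj.fil p n) :
      (∀ p, Generated n (y p)) → Generated n z

open Classical in
/-- The value of a formal expression in a family of algebras with marked elements. The value of a
formal limit is `0` if the sequence does not converge uniformly. -/
def AlgebraTerm.eval : AlgebraTerm P G → ∀ c, (A c).obj.Tot
  | gen g => x g
  | zero => 0
  | add s t => s.eval + t.eval
  | smul r t => r • t.eval
  | diff t => fun c => (A c).obj.dTot (t.eval c)
  | act m p t => fun c => (A c).act m p (fun i => (t i).eval c)
  | lim n t =>
    if h : ∃ z : ∀ c, (A c).obj.Tot, ∀ p c, z c - (t p).eval c ∈ (A c).obj.fil p n then h.choose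
    else 0

theorem Generated.exists_eval {n : ℤ} {y : ∀ c, (A c).obj.Tot} (h : Generated A gn x n y) :
    ∃ t : AlgebraTerm P G, t.eval A x = y := by
  induction h with
  | gen g => exact ⟨.gen g, rfl⟩
  | zero n => exact ⟨.zero, rfl⟩
  | add _ _ hy hz =>
    obtain ⟨s, rfl⟩ := hy
    obtain ⟨t, rfl⟩ := hz
    exact ⟨.add s t, rfl⟩
  | smul r _ hy =>
    obtain ⟨t, rfl⟩ := hy
    exact ⟨.smul r t, rfl⟩
  | diff _ hy =>
    obtain ⟨t, rfl⟩ := hy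
    exact ⟨.diff t, rfl⟩
  | @act m e p hp b y _ hy =>
    choose t ht using hy
    refine ⟨.act m p t, funext fun c => ?_⟩
    simp only [AlgebraTerm.eval, ht]
  | @lim n y z hz _ hy =>
    choose t ht using hy
    have h : ∃ z : ∀ c, (A c).obj.Tot, ∀ p c, z c - (t p).eval A x c ∈ (A c).obj.fil p n :=
      ⟨z, fun p c => by rw [ht]; exact hz p c⟩
    refine ⟨.lim n t, ?_⟩
    rw [AlgebraTerm.eval, dif_pos h]
    funext c
    rw [← sub_eq_zero]
    apply (A c).complete.eq_zero (n := n)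
    intro p
    have h1 := h.choose_spec p c
    rw [ht] at h1
    simpa using sub_mem h1 (hz p c)

variable {A gn x} {gp : G → ℤ} (hx : ∀ g c, x g c ∈ (A c).obj.fil (gp g) (gn g))

include hx in
theorem Generated.exists_weight {n : ℤ} {y : ∀ c, (A c).obj.Tot} (h : Generated A gn x n y) :
    ∃ p, ∀ c, y c ∈ (A c).obj.fil p n := by
  induction h with
  | gen g => exact ⟨gp g, hx g⟩
  | zero n => exact ⟨0, fun c => zero_mem _⟩
  | add _ _ hy hz =>
    obtain ⟨p, hp⟩ := hy
    obtain ⟨q, hq⟩ := hz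
    exact ⟨min p q, fun c => add_mem (fil_anti (min_le_left _ _) _ (hp c))
      (fil_anti (min_le_right _ _) _ (hq c))⟩
  | smul r _ hy =>
    obtain ⟨p, hp⟩ := hy
    exact ⟨p, fun c => Submodule.smul_mem _ r (hp c)⟩
  | diff _ hy =>
    obtain ⟨p, hp⟩ := hy
    exact ⟨p, fun c => dTot_mem_fil (hp c)⟩
  | @act m e p hp b y _ hy =>
    choose w hw using hy
    obtain ⟨v, hv⟩ := exists_mem_fil hp
    exact ⟨_, fun c => (A c).act_mem m v e w b p _ hv (fun i => hw i c)⟩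
  | @lim n y z hz _ hy =>
    obtain ⟨q, hq⟩ := hy 0
    refine ⟨min 0 q, fun c => ?_⟩
    rw [← sub_add_cancel (z c) (y 0 c)]
    exact add_mem (fil_anti (min_le_left _ _) _ (hz 0 c))
      (fil_anti (min_le_right _ _) _ (hq c))

variable (A gn x) in
/-- The complete subalgebra of a product generated by the families `x g`. -/
def generatedSub : SubProduct A where
  W p n :=
    { carrier := {y | Generated A gn x n y ∧ ∀ c, y c ∈ (A c).obj.fil p n}
      add_mem' := fun hy hz => ⟨hy.1.add hz.1, fun c => add_mem (hy.2 c) (hz.2 c)⟩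
      zero_mem' := ⟨.zero n, fun c => zero_mem _⟩
      smul_mem' := fun r y hy => ⟨hy.1.smul r, fun c => Submodule.smul_mem _ r (hy.2 c)⟩ }
  mem_fil hy := hy.2
  anti h n y hy := ⟨hy.1, fun c => fil_anti h n (hy.2 c)⟩
  D_mem hy := ⟨hy.1.diff, fun c => dTot_mem_fil (hy.2 c)⟩
  act_mem n v e w b p a hp ha := ⟨.act (fil_le_deg _ _ hp) (fun i => (ha i).1),
    fun c => (A c).act_mem n v e w b p _ hp (fun i => (ha i).2 c)⟩
  complete n x hx hc := by
    obtain ⟨y, hy⟩ := (SubProduct.full A).complete n x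
      (fun p => (hx p).imp fun q hq => SubProduct.mem_full.2 hq.2)
      (fun p q h => SubProduct.mem_full.2 (hc p q h).2)
    have hg : ∀ p, Generated A gn _ n (x p) := fun p => (hx p).elim fun _ h => h.1
    refine ⟨y, fun p => ⟨?_, SubProduct.mem_full.1 (hy p)⟩⟩
    have hy' : Generated A gn _ n y := .lim (fun p => SubProduct.mem_full.1 (hy p)) hg
    have := hy'.add ((hg p).smul (-1))
    rwa [neg_one_smul, ← sub_eq_add_neg] at this

instance (n : ℤ) : Small.{u} ((generatedSub A gn x).toInternal.grade n) := by
  have : Small.{u} (Set.range (AlgebraTerm.eval (P := P) (G := G) A x)) := inferInstance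
  refine small_subset (s := Set.range (AlgebraTerm.eval (P := P) (G := G) A x))
    (t := ((generatedSub A gn x).toInternal.grade n : Set _)) ?_
  intro y hy
  obtain ⟨p, hp⟩ := (generatedSub A gn x).toInternal.mem_grade.1 hy
  exact hp.1.exists_eval

include hx in
theorem generatedSub_gen (g : G) : x g ∈ (generatedSub A gn x).W (gp g) (gn g) := ⟨.gen g, hx g⟩

include hx in
/-- Maps out of a generated algebra are determined by their values on the generators. -/
theorem generatedSub_hom_ext {B : CompleteAlgebra P} {f f' : (generatedSub A gn x).alg ⟶ B}
    (h : ∀ g z, (generatedSub A gn x).emb z = x g → map f z = map f' z) : f = f' := by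
  set S := generatedSub A gn x with hS
  have lift : ∀ {n : ℤ} {y : ∀ c, (A c).obj.Tot}, Generated A gn x n y →
      ∃ z p, z ∈ S.alg.obj.fil p n ∧ S.emb z = y := by
    intro n y hy
    obtain ⟨p, hp⟩ := hy.exists_weight hx
    have hy' : y ∈ S.W p n := ⟨hy, hp⟩
    obtain ⟨z, hz, hz'⟩ := S.exists_emb hy'
    exact ⟨z, p, hz, hz'⟩
  have key : ∀ {n : ℤ} {y : ∀ c, (A c).obj.Tot}, Generated A gn x n y →
      ∀ z, S.emb z = y → map f z = map f' z := by
    intro n y hy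
    induction hy with
    | gen g => exact h g
    | zero n =>
      intro z hz
      rw [S.emb_injective (hz.trans (map_zero S.emb).symm), map_zero, map_zero]
    | add hy₁ hy₂ h₁ h₂ =>
      intro z hz
      obtain ⟨z₁, -, -, hz₁⟩ := lift hy₁
      obtain ⟨z₂, -, -, hz₂⟩ := lift hy₂
      have : z = z₁ + z₂ := S.emb_injective (by rw [hz, map_add, hz₁, hz₂])
      rw [this, map_add, map_add, h₁ _ hz₁, h₂ _ hz₂]
    | smul r hy₁ h₁ =>
      intro z hz
      obtain ⟨z₁, -, -, hz₁⟩ := lift hy₁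
      have : z = r • z₁ := S.emb_injective (by rw [hz, map_smul, hz₁])
      rw [this, map_smul, map_smul, h₁ _ hz₁]
    | diff hy₁ h₁ =>
      intro z hz
      obtain ⟨z₁, -, -, hz₁⟩ := lift hy₁
      have : z = S.alg.obj.dTot z₁ := S.emb_injective (by
        refine Eq.trans ?_ (S.toInternal.emb_dTot z₁).symm
        rw [hz]
        exact congrArg S.toInternal.D hz₁.symm)
      rw [this, map_dTot, map_dTot, h₁ _ hz₁]
    | @act m e p hp b y hy₁ h₁ =>
      intro z hz
      choose z₁ _ _ hz₁ using fun i => lift (hy₁ i)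
      have : z = S.alg.act m p z₁ := S.emb_injective (by
        refine Eq.trans ?_ (S.toInternal.emb_act m p z₁).symm
        rw [hz]
        refine congrArg (S.toInternal.act m p) (funext fun i => ?_)
        exact (hz₁ i).symm)
      rw [this, map_action, map_action]
      simp only [h₁ _ _ (hz₁ _)]
    | @lim n y z hz' hy₁ h₁ =>
      intro z₀ hz
      choose z₁ _ _ hz₁ using fun i => lift (hy₁ i)
      rw [← sub_eq_zero]
      apply B.complete.eq_zero (n := n)
      intro p
      have hgen : Generated A gn x n z := .lim hz' hy₁
      have hmem : z₀ - z₁ p ∈ S.alg.obj.fil p n := by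
        rw [S.mem_fil_iff, map_sub, hz, hz₁]
        refine ⟨?_, hz' p⟩
        have := hgen.add ((hy₁ p).smul (-1))
        rwa [neg_one_smul, ← sub_eq_add_neg] at this
      have h2 := sub_mem (map_mem_fil f hmem) (map_mem_fil f' hmem)
      rw [map_sub, map_sub, h₁ p _ (hz₁ p)] at h2
      simpa using h2
  exact CompleteAlgebra.hom_ext fun p n z hz => key (S.mem_fil_iff.1 hz).1 z rfl

end

namespace CompleteAlgebra

/-! ### Colimits -/

section

variable {J : Type u} [Category.{u} J] (F : J ⥤ CompleteAlgebra P)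

/-- The homogeneous elements of the algebras of a diagram, with a filtration weight and a degree. -/
structure DiagramElement where
  idx : J
  weight : ℤ
  degree : ℤ
  elt : (F.obj idx).obj.Tot
  mem : elt ∈ (F.obj idx).obj.fil weight degree

/-- The family of the images of an element of a diagram in all cocones. -/
def DiagramElement.family (g : DiagramElement F) (c : Cocone F) : c.pt.obj.Tot :=
  map (c.ι.app g.idx) g.elt

theorem DiagramElement.family_mem (g : DiagramElement F) (c : Cocone F) :
    g.family F c ∈ c.pt.obj.fil g.weight g.degree := map_mem_fil _ g.mem

/-- The algebra generated by the elements of a diagram in the product of all its cocones. -/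
abbrev colimitSub : SubProduct (fun c : Cocone F => c.pt) :=
  generatedSub (fun c : Cocone F => c.pt) DiagramElement.degree (DiagramElement.family F)

/-- The maps of a diagram to its colimit. -/
def colimitIncl (j : J) : F.obj j ⟶ (colimitSub F).alg :=
  (colimitSub F).lift (fun c => c.ι.app j) (fun p n x hx =>
    generatedSub_gen (DiagramElement.family_mem F) ⟨j, p, n, x, hx⟩)

theorem colimitIncl_proj (j : J) (c : Cocone F) :
    colimitIncl F j ≫ (colimitSub F).proj c = c.ι.app j := (colimitSub F).lift_proj _ _ c

theorem colimitSub_hom_ext {B : CompleteAlgebra P} {f f' : (colimitSub F).alg ⟶ B}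
    (h : ∀ j, colimitIncl F j ≫ f = colimitIncl F j ≫ f') : f = f' := by
  refine generatedSub_hom_ext (DiagramElement.family_mem F) (fun g z hz => ?_)
  have h1 : z = map (colimitIncl F g.idx) g.elt := by
    apply (colimitSub F).emb_injective
    rw [hz]
    funext c
    refine Eq.symm (((colimitSub F).map_proj c _).symm.trans ?_)
    rw [← map_comp, colimitIncl_proj]
    rfl
  rw [h1, ← map_comp, h, map_comp]

/-- The colimit cocone of a diagram of algebras. -/
def colimitCocone : Cocone F where
  pt := (colimitSub F).alg
  ι :=
    { app := colimitIncl F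
      naturality := fun i j f => (colimitSub F).hom_ext fun c => by
        simp only [Category.assoc, colimitIncl_proj, Functor.const_obj_map]
        erw [Category.id_comp, colimitIncl_proj]
        exact c.w f }

/-- The colimit cocone is a colimit. -/
def colimitCoconeIsColimit : IsColimit (colimitCocone F) where
  desc c := (colimitSub F).proj c
  fac c j := colimitIncl_proj F j c
  uniq c _ hm := colimitSub_hom_ext F fun j => (hm j).trans (colimitIncl_proj F j c).symm

theorem hasColimitsOfSize : HasColimitsOfSize.{u, u} (CompleteAlgebra P) where
  has_colimits_of_shape _ _ := { has_colimit := fun F => ⟨⟨_, colimitCoconeIsColimit F⟩⟩ }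

end

/-! ### Free algebras on a disc and on a sphere -/

section

/-- The algebras with a marked element of weight `p` and degree `n` that satisfies `Q`. -/
structure Marked (P : CompleteOperad k) (p n : ℤ)
    (Q : ∀ A : CompleteAlgebra P, A.obj.Tot → Prop) where
  alg : CompleteAlgebra P
  elt : alg.obj.Tot
  mem : elt ∈ alg.obj.fil p n
  prop : Q alg elt

/-- The algebra freely generated by an element of weight `p` and degree `n` satisfying a closed
condition `Q`. -/
theorem exists_free (P : CompleteOperad k) (p n : ℤ)
    (Q : ∀ A : CompleteAlgebra P, A.obj.Tot → Prop)
    (hQ : ∀ {K : Type (u + 1)} {A : K → CompleteAlgebra P} (S : SubProduct A)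
      [∀ n, Small.{u} (S.toInternal.grade n)] (x : S.alg.obj.Tot),
      (∀ c, Q (A c) (S.emb x c)) → Q S.alg x) :
    ∃ (F : CompleteAlgebra P) (x : F.obj.Tot), x ∈ F.obj.fil p n ∧ Q F x ∧
      ∀ (A : CompleteAlgebra P) (a : A.obj.Tot), a ∈ A.obj.fil p n → Q A a →
        ∃! f : F ⟶ A, map f x = a := by
  let S := generatedSub (fun c : Marked P p n Q => c.alg) (fun _ : PUnit.{u + 1} => n)
    (fun _ c => c.elt)
  have hx : ∀ (_ : PUnit.{u + 1}) (c : Marked P p n Q), c.elt ∈ c.alg.obj.fil p n :=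
    fun _ c => c.mem
  obtain ⟨x, hxm, hx'⟩ := S.exists_emb (generatedSub_gen (gp := fun _ => p) hx PUnit.unit)
  refine ⟨S.alg, x, hxm, hQ S x (fun c => by rw [hx']; exact c.prop), fun A a ha hQa => ?_⟩
  refine ⟨S.proj ⟨A, a, ha, hQa⟩, ?_, fun f hf => ?_⟩
  · change map _ _ = _
    rw [SubProduct.map_proj, hx']
  · refine generatedSub_hom_ext (gp := fun _ => p) hx (fun _ z hz => ?_)
    have : z = x := S.emb_injective (hz.trans hx'.symm)
    rw [this, hf]
    refine Eq.symm ((SubProduct.map_proj S _ _).trans ?_)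
    rw [hx']

/-- The free algebra on an element of weight `p` and degree `n`. -/
theorem exists_disc (P : CompleteOperad k) (p n : ℤ) :
    ∃ (F : CompleteAlgebra P) (x : F.obj.Tot), x ∈ F.obj.fil p n ∧
      ∀ (A : CompleteAlgebra P) (a : A.obj.Tot), a ∈ A.obj.fil p n → ∃! f : F ⟶ A, map f x = a := by
  obtain ⟨F, x, hx, -, h⟩ := exists_free P p n (fun _ _ => True) (fun _ _ _ _ => trivial)
  exact ⟨F, x, hx, fun A a ha => h A a ha trivial⟩

/-- The free algebra on a cocycle of weight `p` and degree `n`. -/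
theorem exists_sphere (P : CompleteOperad k) (p n : ℤ) :
    ∃ (F : CompleteAlgebra P) (x : F.obj.Tot), x ∈ F.obj.fil p n ∧ F.obj.dTot x = 0 ∧
      ∀ (A : CompleteAlgebra P) (a : A.obj.Tot), a ∈ A.obj.fil p n → A.obj.dTot a = 0 →
        ∃! f : F ⟶ A, map f x = a :=
  exists_free P p n (fun A a => A.obj.dTot a = 0) (fun S _ x h => S.emb_injective (by
    refine (S.toInternal.emb_dTot x).trans (Eq.trans ?_ (map_zero S.emb).symm)
    exact funext h))

/-- The free algebra on an element of weight `p` and degree `n`. -/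
def disc (P : CompleteOperad k) (p n : ℤ) : CompleteAlgebra P := (exists_disc P p n).choose

/-- The generator of a disc. -/
def discGen (P : CompleteOperad k) (p n : ℤ) : (disc P p n).obj.Tot :=
  (exists_disc P p n).choose_spec.choose

theorem discGen_mem (p n : ℤ) : discGen P p n ∈ (disc P p n).obj.fil p n :=
  (exists_disc P p n).choose_spec.choose_spec.1

theorem disc_existsUnique {p n : ℤ} {A : CompleteAlgebra P} {a : A.obj.Tot}
    (ha : a ∈ A.obj.fil p n) : ∃! f : disc P p n ⟶ A, map f (discGen P p n) = a :=
  (exists_disc P p n).choose_spec.choose_spec.2 A a ha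

/-- The free algebra on a cocycle of weight `p` and degree `n`. -/
def sphere (P : CompleteOperad k) (p n : ℤ) : CompleteAlgebra P := (exists_sphere P p n).choose

/-- The generator of a sphere. -/
def sphereGen (P : CompleteOperad k) (p n : ℤ) : (sphere P p n).obj.Tot :=
  (exists_sphere P p n).choose_spec.choose

theorem sphereGen_mem (p n : ℤ) : sphereGen P p n ∈ (sphere P p n).obj.fil p n :=
  (exists_sphere P p n).choose_spec.choose_spec.1

theorem dTot_sphereGen (p n : ℤ) : (sphere P p n).obj.dTot (sphereGen P p n) = 0 :=
  (exists_sphere P p n).choose_spec.choose_spec.2.1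

theorem sphere_existsUnique {p n : ℤ} {A : CompleteAlgebra P} {a : A.obj.Tot}
    (ha : a ∈ A.obj.fil p n) (hd : A.obj.dTot a = 0) :
    ∃! f : sphere P p n ⟶ A, map f (sphereGen P p n) = a :=
  (exists_sphere P p n).choose_spec.choose_spec.2.2 A a ha hd

end

end CompleteAlgebra

/-! ### Quotients and reduced products -/

open FilteredComplex CompleteAlgebra

/-- In a decreasing filtration, a sequence whose successive differences lie in the `i`-th steps is
a Cauchy sequence. -/
theorem sub_mem_of_succ_sub_mem {k M : Type*} [Ring k] [AddCommGroup M] [Module k M]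
    (W : ℤ → Submodule k M) (hW : ∀ {p q : ℤ}, p ≤ q → W q ≤ W p) (z : ℕ → M)
    (hz : ∀ i : ℕ, z (i + 1) - z i ∈ W i) {p q : ℤ} (h : p ≤ q) :
    z q.toNat - z p.toNat ∈ W p := by
  have key : ∀ (i j : ℕ), z (i + j) - z i ∈ W i := by
    intro i j
    induction j with
    | zero => simp
    | succ j ih =>
      have h1 := hW (p := (i : ℤ)) (q := ((i + j : ℕ) : ℤ)) (by omega) (hz (i + j))
      have := add_mem h1 ih
      rwa [sub_add_sub_cancel] at this
  have h2 := key p.toNat (q.toNat - p.toNat)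
  rw [Nat.add_sub_cancel' (Int.toNat_le_toNat h)] at h2
  exact hW (Int.self_le_toNat p) h2

variable {k : Type u} [Field k] {P : CompleteOperad k}

/-- A sequence whose successive differences lie in the `i`-th steps of the filtration converges. -/
theorem FilteredComplex.IsComplete.exists_limit_of_succ {V : FilteredComplex k}
    (hV : V.IsComplete) {n : ℤ} {z : ℕ → V.Tot} (h0 : z 0 ∈ V.deg n) {r : ℤ}
    (hz : ∀ i : ℕ, z (i + 1) - z i ∈ V.fil (r + i) n) :
    ∃ y ∈ V.deg n, ∀ i : ℕ, y - z i ∈ V.fil (r + i) n := by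
  have hdeg : ∀ i, z i ∈ V.deg n := by
    intro i
    induction i with
    | zero => exact h0
    | succ i ih =>
      have := add_mem (fil_le_deg _ _ (hz i)) ih
      rwa [sub_add_cancel] at this
  have hW : ∀ {p q : ℤ}, p ≤ q → V.fil (r + q) n ≤ V.fil (r + p) n :=
    fun h => fil_anti (by omega) n
  obtain ⟨y, hy, hyz⟩ := hV.exists_limit (x := fun p : ℤ => z (p - r).toNat) (fun p => hdeg _)
    (fun p q h => by
      have := sub_mem_of_succ_sub_mem (fun p => V.fil (r + p) n) hW z hz
        (p := p - r) (q := q - r) (by omega)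
      simpa using this)
  refine ⟨y, hy, fun i => ?_⟩
  have := hyz (r + i)
  simpa using this

namespace InternalAlgebra

variable {E : Type w} [AddCommGroup E] [Module k E] (I : InternalAlgebra P E) (N : Submodule k E)

/-- The operations on the quotient by an ideal, written with a linear section of the projection. -/
def quotientAct (n : ℕ) :
    (P.obj n).Tot →ₗ[k] MultilinearMap k (fun _ : Fin n => E ⧸ N) (E ⧸ N) :=
  let s : (E ⧸ N) →ₗ[k] E := (N.mkQ.exists_rightInverse_of_surjective N.range_mkQ).choose
  { toFun := fun p => N.mkQ.compMultilinearMap ((I.act n p).compLinearMap (fun _ => s))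
    map_add' := fun p q => by
      ext a
      simp
    map_smul' := fun c p => by
      ext a
      simp }

theorem quotientAct_mk
    (hact : ∀ (n : ℕ) (p : (P.obj n).Tot) (a a' : Fin n → E), (∀ i, a i - a' i ∈ N) →
      I.act n p a - I.act n p a' ∈ N) (n : ℕ) (p : (P.obj n).Tot) (a : Fin n → E) :
    I.quotientAct N n p (fun i => N.mkQ (a i)) = N.mkQ (I.act n p a) := by
  let s : (E ⧸ N) →ₗ[k] E := (N.mkQ.exists_rightInverse_of_surjective N.range_mkQ).choose
  have hs : ∀ x, N.mkQ (s x) = x := fun x => congrArg (fun f => f x)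
    (N.mkQ.exists_rightInverse_of_surjective N.range_mkQ).choose_spec
  change N.mkQ (I.act n p (fun i => s (N.mkQ (a i)))) = _
  rw [← sub_eq_zero, ← map_sub, Submodule.mkQ_apply, Submodule.Quotient.mk_eq_zero]
  apply hact
  intro i
  rw [← Submodule.Quotient.mk_eq_zero, ← Submodule.mkQ_apply, map_sub, hs, sub_self]

/-- The quotient of an internally presented algebra by a closed ideal. -/
def quotient (hpr : ∀ n, ∀ x ∈ N, I.pr n x ∈ N) (hD : ∀ x ∈ N, I.D x ∈ N)
    (hact : ∀ (n : ℕ) (p : (P.obj n).Tot) (a a' : Fin n → E), (∀ i, a i - a' i ∈ N) →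
      I.act n p a - I.act n p a' ∈ N)
    (hclosed : ∀ (n : ℤ) (x : E), (∀ p, ∃ y ∈ I.W p n, x - y ∈ N) → x ∈ N) :
    InternalAlgebra P (E ⧸ N) :=
  have hmk := I.quotientAct_mk N hact
  have hupd : ∀ (n : ℕ) (a : Fin n → E) (i : Fin n) (z : E),
      Function.update (fun i => N.mkQ (a i)) i (N.mkQ z) =
        fun j => N.mkQ (Function.update a i z j) := fun n a i z =>
    funext fun j => (Function.apply_update (fun _ => N.mkQ) a i z j).symm
  { W := fun p n => (I.W p n).map N.mkQ
    anti := fun h n => Submodule.map_mono (I.anti h n)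
    pr := fun n => N.mapQ N (I.pr n) (hpr n)
    pr_same := by
      rintro p n _ ⟨y, hy, rfl⟩
      exact congrArg N.mkQ (I.pr_same hy)
    pr_ne := by
      rintro p m n _ h ⟨y, hy, rfl⟩
      exact congrArg N.mkQ (I.pr_ne h hy)
    D := N.mapQ N I.D hD
    D_mem := by
      rintro p n _ ⟨y, hy, rfl⟩
      exact ⟨_, I.D_mem hy, rfl⟩
    D_D := by
      rintro p n _ ⟨y, hy, rfl⟩
      exact congrArg N.mkQ (I.D_D hy)
    complete := by
      intro n x hx hc
      obtain ⟨q₀, y₀, hy₀, hxy⟩ := hx 0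
      choose u hu hu' using fun i : ℕ => hc i (i + 1) (by omega)
      let z : ℕ → E := fun i => y₀ + ∑ j ∈ Finset.range i, u j
      have hz : ∀ i : ℕ, N.mkQ (z i) = x i := by
        intro i
        induction i with
        | zero => simpa [z] using hxy
        | succ i ih =>
          have : z (i + 1) = z i + u i := by
            simp only [z, Finset.sum_range_succ, add_assoc]
          rw [this, map_add, ih, hu']
          push_cast
          abel
      have hcz := fun {p q : ℤ} => sub_mem_of_succ_sub_mem (fun p => I.W p n)
        (fun h => I.anti h n) z (fun i => by
          have : z (i + 1) - z i = u i := by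
            simp only [z, Finset.sum_range_succ]
            abel
          rw [this]
          exact hu i) (p := p) (q := q)
      obtain ⟨y, hy⟩ := I.complete n (fun p => z p.toNat) (fun p => by
        refine ⟨min 0 q₀, ?_⟩
        have h1 := hcz (p := 0) (q := (p.toNat : ℤ)) (by omega)
        rw [Int.toNat_natCast, Int.toNat_zero] at h1
        have h2 := add_mem (I.anti (min_le_left 0 q₀) n h1) (I.anti (min_le_right 0 q₀) n hy₀)
        have h3 : z 0 = y₀ := by simp [z]
        rwa [h3, sub_add_cancel] at h2) (fun p q h => hcz h)
      refine ⟨N.mkQ y, fun p => ?_⟩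
      rcases le_total 0 p with h | h
      · refine ⟨_, hy p, ?_⟩
        rw [map_sub, hz, Int.toNat_of_nonneg h]
      · have h1 : N.mkQ y - x 0 ∈ (I.W p n).map N.mkQ := by
          refine ⟨_, I.anti h n (hy 0), ?_⟩
          rw [map_sub, hz]
          rfl
        have h2 := add_mem h1 (hc p 0 h)
        rwa [sub_add_sub_cancel] at h2
    hausdorff := by
      intro n x hx
      obtain ⟨y, rfl⟩ := N.mkQ_surjective x
      rw [Submodule.mkQ_apply, Submodule.Quotient.mk_eq_zero]
      refine hclosed n y (fun p => ?_)
      obtain ⟨z, hz, hzy⟩ := hx p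
      refine ⟨z, hz, ?_⟩
      rw [← Submodule.Quotient.mk_eq_zero, ← Submodule.mkQ_apply, map_sub, hzy, sub_self]
    act := I.quotientAct N
    act_mem := by
      intro n v e w b p a hp ha
      choose y hy hya using ha
      obtain rfl : (fun i => N.mkQ (y i)) = a := funext hya
      rw [hmk]
      exact ⟨_, I.act_mem n v e w b p y hp hy, rfl⟩
    D_act := by
      intro n e w b p a hp ha
      choose y hy hya using ha
      obtain rfl : (fun i => N.mkQ (y i)) = a := funext hya
      rw [hmk]
      refine (congrArg N.mkQ (I.D_act n e w b p y hp hy)).trans ?_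
      rw [map_add, map_sum, hmk]
      congr 1
      refine Finset.sum_congr rfl fun i _ => ?_
      rw [Units.smul_def, Units.smul_def, map_zsmul, ← hmk, ← hupd]
      rfl
    one_act := by
      rintro p n _ ⟨y, hy, rfl⟩
      rw [hmk, I.one_act p n y hy]
    act_assoc := by
      intro m n b w c e p q a hp hq ha
      choose y hy hya using ha
      obtain rfl : (fun i s => N.mkQ (y i s)) = a := funext fun i => funext fun s => hya i s
      simp only [hmk]
      rw [I.act_assoc n b w c e p q y hp hq hy, Units.smul_def, Units.smul_def, map_zsmul]
    act_perm := by
      intro m n σ w b e p a hp ha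
      choose y hy hya using ha
      obtain rfl : (fun i => N.mkQ (y i)) = a := funext hya
      simp only [hmk]
      rw [I.act_perm σ w b e p y hp hy, Units.smul_def, Units.smul_def, map_zsmul] }

theorem quotient_act (hpr hD hact hclosed) (n : ℕ) (p : (P.obj n).Tot) (a : Fin n → E) :
    (I.quotient N hpr hD hact hclosed).act n p (fun i => N.mkQ (a i)) = N.mkQ (I.act n p a) :=
  I.quotientAct_mk N hact n p a

end InternalAlgebra

namespace CompleteAlgebra

section reducedProduct

variable {J : Type u} (l : Filter J) [CountableInterFilter l] (A : J → CompleteAlgebra P)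

/-- The families that vanish eventually. -/
def nullFamilies : Submodule k (∀ j, (A j).obj.Tot) where
  carrier := {y | ∀ᶠ j in l, y j = 0}
  add_mem' hx hy := by
    filter_upwards [hx, hy] with j h1 h2
    rw [Pi.add_apply, h1, h2, add_zero]
  zero_mem' := Filter.Eventually.of_forall fun _ => rfl
  smul_mem' c x hx := by
    filter_upwards [hx] with j h
    rw [Pi.smul_apply, h, smul_zero]

omit [CountableInterFilter l] in
variable {l A} in
theorem mem_nullFamilies {y : ∀ j, (A j).obj.Tot} :
    y ∈ nullFamilies l A ↔ ∀ᶠ j in l, y j = 0 := Iff.rfl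

/-- The reduced product of a family of complete algebras along a filter that is closed under
countable intersections. It is complete because a germ that lies in every step of the filtration
vanishes on a set of the filter. -/
def reducedProduct : InternalAlgebra P ((∀ j, (A j).obj.Tot) ⧸ nullFamilies l A) :=
  (SubProduct.full A).toInternal.quotient (nullFamilies l A)
    (fun n x hx => by
      filter_upwards [mem_nullFamilies.1 hx] with j h
      change (A j).obj.prTot n (x j) = 0
      rw [h, map_zero])
    (fun x hx => by
      filter_upwards [mem_nullFamilies.1 hx] with j h
      change (A j).obj.dTot (x j) = 0
      rw [h, map_zero])
    (fun n p a a' h => by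
      have h' : ∀ᶠ j in l, ∀ i, a i j - a' i j = 0 :=
        Filter.eventually_all.2 fun i => mem_nullFamilies.1 (h i)
      filter_upwards [h'] with j hj
      change (A j).act n p (fun i => a i j) - (A j).act n p (fun i => a' i j) = 0
      simp only [sub_eq_zero] at hj ⊢
      simp only [hj])
    (fun n x hx => by
      choose y hy hxy using hx
      filter_upwards [eventually_countable_forall.2 fun p => mem_nullFamilies.1 (hxy p)] with j hj
      refine (A j).complete.eq_zero (n := n) (fun p => ?_)
      have h := hj p
      rw [Pi.sub_apply, sub_eq_zero] at h
      rw [h]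
      exact SubProduct.mem_full.1 (hy p) j)

end reducedProduct

end CompleteAlgebra

/-! ### Countably directed colimits -/

open FilteredComplex CompleteAlgebra

variable {k : Type u} [Field k] {P : CompleteOperad k}

namespace CompleteAlgebra

attribute [local instance] hasColimitsOfSize

section

variable {J : Type u} [LinearOrder J] (F : J ⥤ CompleteAlgebra P)

/-- The germ at infinity of the images of an element in the later stages of a diagram. -/
def eventualImage (i : J) : (F.obj i).obj.Tot →ₗ[k] (∀ j, (F.obj j).obj.Tot) :=
  LinearMap.pi fun j => if h : i ≤ j then map (F.map (homOfLE h)) else 0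

theorem eventualImage_apply {i j : J} (h : i ≤ j) (x : (F.obj i).obj.Tot) :
    eventualImage F i x j = map (F.map (homOfLE h)) x := by
  simp [eventualImage, h]

variable [CountableInterFilter (Filter.atTop : Filter J)]

/-- The maps of a countably directed diagram to the reduced product of its objects. -/
def toReducedProduct (i : J) :
    F.obj i ⟶ (reducedProduct Filter.atTop F.obj).toAlgebra :=
  (reducedProduct Filter.atTop F.obj).lift
    ((nullFamilies Filter.atTop F.obj).mkQ ∘ₗ eventualImage F i)
    (fun p n x hx => by
      refine ⟨_, SubProduct.mem_full.2 (fun j => ?_), rfl⟩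
      by_cases h : i ≤ j
      · rw [eventualImage_apply F h]
        exact map_mem_fil _ hx
      · simp [eventualImage, h])
    (fun n x hx => by
      refine congrArg (nullFamilies Filter.atTop F.obj).mkQ (funext fun j => ?_)
      change _ = (F.obj j).obj.dTot (eventualImage F i x j)
      by_cases h : i ≤ j
      · rw [eventualImage_apply F h, eventualImage_apply F h, map_dTot]
      · simp [eventualImage, h])
    (fun n e b p a hp ha => by
      refine Eq.trans ?_ (InternalAlgebra.quotient_act _ _ _ _ _ _ n p
        (fun t => eventualImage F i (a t))).symm
      rw [← sub_eq_zero, LinearMap.comp_apply, ← map_sub, Submodule.mkQ_apply,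
        Submodule.Quotient.mk_eq_zero, mem_nullFamilies]
      filter_upwards [Filter.eventually_ge_atTop i] with j h
      change eventualImage F i ((F.obj i).act n p a) j -
        (F.obj j).act n p (fun t => eventualImage F i (a t) j) = 0
      simp only [eventualImage_apply F h]
      rw [map_action, sub_self])

theorem emb_toReducedProduct (i : J) (x : (F.obj i).obj.Tot) :
    (reducedProduct Filter.atTop F.obj).emb (map (toReducedProduct F i) x) =
      (nullFamilies Filter.atTop F.obj).mkQ (eventualImage F i x) :=
  InternalAlgebra.emb_map_lift _ _ _ _ _ _

/-- The cocone of a countably directed diagram with vertex the reduced product. -/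
def reducedProductCocone : Cocone F where
  pt := (reducedProduct Filter.atTop F.obj).toAlgebra
  ι :=
    { app := toReducedProduct F
      naturality := fun i i' f => hom_ext fun p n x _ => by
        apply (reducedProduct Filter.atTop F.obj).emb_injective
        erw [map_comp, Category.comp_id]
        rw [emb_toReducedProduct, emb_toReducedProduct, ← sub_eq_zero, ← map_sub,
          Submodule.mkQ_apply, Submodule.Quotient.mk_eq_zero, mem_nullFamilies]
        filter_upwards [Filter.eventually_ge_atTop i'] with j h
        have h' : i ≤ j := (leOfHom f).trans h
        rw [Pi.sub_apply, eventualImage_apply F h, eventualImage_apply F h', ← map_comp,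
          ← F.map_comp, sub_eq_zero]
        rfl }

/-- An element that vanishes in a countably directed colimit vanishes at some stage. -/
theorem exists_map_eq_zero {c : Cocone F} (hc : IsColimit c) {i : J} (x : (F.obj i).obj.Tot)
    (hx : map (c.ι.app i) x = 0) : ∃ (j : J) (h : i ≤ j), map (F.map (homOfLE h)) x = 0 := by
  have h1 : map (toReducedProduct F i) x = 0 := by
    have := hc.fac (reducedProductCocone F) i
    refine (congrArg (fun t => map t x) this).symm.trans ?_
    rw [map_comp, hx]
    exact map_zero _
  have h2 := emb_toReducedProduct F i x
  rw [h1, map_zero, eq_comm, Submodule.mkQ_apply, Submodule.Quotient.mk_eq_zero,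
    mem_nullFamilies] at h2
  have : Nonempty J := ⟨i⟩
  obtain ⟨j, hj, h⟩ := (h2.and (Filter.eventually_ge_atTop i)).exists
  rw [eventualImage_apply F h] at hj
  exact ⟨j, h, hj⟩

end

section

variable {J : Type u} [LinearOrder J] {F : J ⥤ CompleteAlgebra P} (c : Cocone F)

theorem map_app_homOfLE {i j : J} (h : i ≤ j) (x : (F.obj i).obj.Tot) :
    map (c.ι.app j) (map (F.map (homOfLE h)) x) = map (c.ι.app i) x := by
  rw [← map_comp, c.w]

variable [Nonempty J]

/-- The union of the images of the filtrations of a directed diagram in the vertex of a cocone. -/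
def imageFil (p n : ℤ) : Submodule k (PUnit.{u + 1} → c.pt.obj.Tot) where
  carrier := {y | ∃ j, ∃ x ∈ (F.obj j).obj.fil p n, map (c.ι.app j) x = y PUnit.unit}
  add_mem' := by
    rintro _ _ ⟨i, x, hx, hxa⟩ ⟨j, y, hy, hyb⟩
    refine ⟨max i j, _, add_mem (map_mem_fil (F.map (homOfLE (le_max_left i j))) hx)
      (map_mem_fil (F.map (homOfLE (le_max_right i j))) hy), ?_⟩
    rw [map_add, map_app_homOfLE, map_app_homOfLE, hxa, hyb]
    rfl
  zero_mem' := ⟨Classical.arbitrary J, 0, zero_mem _, map_zero _⟩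
  smul_mem' := by
    rintro r _ ⟨i, x, hx, hxa⟩
    exact ⟨i, r • x, Submodule.smul_mem _ r hx, by rw [map_smul, hxa]; rfl⟩

/-- The union of the images of a countably directed diagram in the vertex of a cocone, filtered by
the images of the filtrations. It is complete because a Cauchy sequence lifts to a single stage. -/
def imageSub (hJ : ∀ s : ℕ → J, ∃ j, ∀ n, s n ≤ j) : SubProduct (fun _ : PUnit.{u + 1} => c.pt) where
  W := imageFil c
  mem_fil := by
    rintro p n y ⟨j, x, hx, hxy⟩ ⟨⟩
    rw [← hxy]
    exact map_mem_fil _ hx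
  anti := by
    rintro p q h n y ⟨j, x, hx, hxy⟩
    exact ⟨j, x, fil_anti h n hx, hxy⟩
  D_mem := by
    rintro p n y ⟨j, x, hx, hxy⟩
    exact ⟨j, _, dTot_mem_fil hx, by rw [map_dTot, hxy]; rfl⟩
  act_mem := by
    intro n v e w b p a hp ha
    choose j x hx hxa using ha
    obtain ⟨j', hj'⟩ : ∃ j', ∀ i, j i ≤ j' := Finite.exists_le j
    refine ⟨j', (F.obj j').act n p (fun i => map (F.map (homOfLE (hj' i))) (x i)),
      (F.obj j').act_mem n v e w b p _ hp (fun i => map_mem_fil _ (hx i)), ?_⟩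
    rw [map_action]
    simp only [map_app_homOfLE, hxa]
    rfl
  complete := by
    intro n x hx hc
    obtain ⟨q₀, j₀, y₀, hy₀, hxy⟩ := hx 0
    choose j u hu hu' using fun i : ℕ => hc i (i + 1) (by omega)
    obtain ⟨j', hj'⟩ := hJ (fun i => Nat.casesOn i j₀ j)
    have h0 : j₀ ≤ j' := hj' 0
    have h1 : ∀ i, j i ≤ j' := fun i => hj' (i + 1)
    -- all the terms of the telescoping series live at the stage `j'`
    let z : ℕ → (F.obj j').obj.Tot := fun i => map (F.map (homOfLE h0)) y₀ +
      ∑ t ∈ Finset.range i, map (F.map (homOfLE (h1 t))) (u t)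
    have hsucc : ∀ i, z (i + 1) - z i = map (F.map (homOfLE (h1 i))) (u i) := by
      intro i
      simp only [z, Finset.sum_range_succ]
      abel
    have hz : ∀ i : ℕ, map (c.ι.app j') (z i) = x i PUnit.unit := by
      intro i
      induction i with
      | zero => simpa [z, map_app_homOfLE] using hxy
      | succ i ih =>
        rw [← sub_add_cancel (z (i + 1)) (z i), hsucc, map_add, ih, map_app_homOfLE, hu']
        rw [Pi.sub_apply, sub_add_cancel]
        push_cast
        rfl
    obtain ⟨y, -, hy⟩ := (F.obj j').complete.exists_limit_of_succ (n := n) (z := z) (r := 0)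
      (by simpa [z] using map_mem_deg _ (fil_le_deg _ _ hy₀))
      (fun i => by
        rw [hsucc, zero_add]
        exact map_mem_fil _ (hu i))
    simp only [zero_add] at hy
    have hmem : ∀ i : ℕ, (fun _ => map (c.ι.app j') y) - x i ∈ imageFil c i n := fun i =>
      ⟨j', _, hy i, by rw [map_sub, hz]; rfl⟩
    refine ⟨fun _ => map (c.ι.app j') y, fun p => ?_⟩
    rcases le_total 0 p with h | h
    · have := hmem p.toNat
      rwa [Int.toNat_of_nonneg h] at this
    · obtain ⟨j, t, ht, hty⟩ := hmem 0
      have h1 : (fun _ => map (c.ι.app j') y) - x 0 ∈ imageFil c p n :=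
        ⟨j, t, fil_anti h n ht, hty⟩
      have h2 := add_mem h1 (hc p 0 h)
      rwa [sub_add_sub_cancel] at h2

instance (hJ : ∀ s : ℕ → J, ∃ j, ∀ n, s n ≤ j) (n : ℤ) :
    Small.{u} ((imageSub c hJ).toInternal.grade n) :=
  small_of_injective (β := c.pt.obj.Tot) (f := fun y => y.1 PUnit.unit) (fun _ _ h =>
    Subtype.ext (funext fun _ => h))

/-- The maps of a countably directed diagram to the union of its images. -/
def toImage (hJ : ∀ s : ℕ → J, ∃ j, ∀ n, s n ≤ j) (j : J) : F.obj j ⟶ (imageSub c hJ).alg :=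
  (imageSub c hJ).lift (fun _ => c.ι.app j) (fun _ _ y hy => ⟨j, y, hy, rfl⟩)

/-- The inclusion of the union of the images. -/
def imageIncl (hJ : ∀ s : ℕ → J, ∃ j, ∀ n, s n ≤ j) : (imageSub c hJ).alg ⟶ c.pt :=
  (imageSub c hJ).proj PUnit.unit

theorem toImage_imageIncl (hJ : ∀ s : ℕ → J, ∃ j, ∀ n, s n ≤ j) (j : J) :
    toImage c hJ j ≫ imageIncl c hJ = c.ι.app j :=
  (imageSub c hJ).lift_proj (fun _ => c.ι.app j) _ PUnit.unit

/-- The cocone whose vertex is the union of the images. -/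
def imageCocone (hJ : ∀ s : ℕ → J, ∃ j, ∀ n, s n ≤ j) : Cocone F where
  pt := (imageSub c hJ).alg
  ι :=
    { app := toImage c hJ
      naturality := fun i j f => (imageSub c hJ).hom_ext fun t => by
        have h : (F.map f ≫ toImage c hJ j) ≫ imageIncl c hJ = toImage c hJ i ≫ imageIncl c hJ := by
          rw [Category.assoc, toImage_imageIncl, toImage_imageIncl, c.w]
        exact h.trans (congrArg (· ≫ imageIncl c hJ) (Category.comp_id (toImage c hJ i)).symm) }

/-- An element of a countably directed colimit comes from an element of the same weight at some
stage. -/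
theorem exists_map_app_eq (hJ : ∀ s : ℕ → J, ∃ j, ∀ n, s n ≤ j) {c : Cocone F} (hc : IsColimit c)
    {p n : ℤ} {x : c.pt.obj.Tot} (hx : x ∈ c.pt.obj.fil p n) :
    ∃ j, ∃ y ∈ (F.obj j).obj.fil p n, map (c.ι.app j) y = x := by
  have key : ∀ s : c.pt ⟶ (imageSub c hJ).alg, s ≫ imageIncl c hJ = 𝟙 c.pt →
      ∃ j, ∃ y ∈ (F.obj j).obj.fil p n, map (c.ι.app j) y = x := by
    intro s hs
    obtain ⟨j, y, hy, hyx⟩ := (imageSub c hJ).mem_fil_iff.1 (map_mem_fil s hx)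
    refine ⟨j, y, hy, hyx.trans ?_⟩
    refine ((imageSub c hJ).map_proj PUnit.unit _).symm.trans ?_
    refine (map_comp s (imageIncl c hJ) x).symm.trans ?_
    rw [hs, map_id]
  refine key (hc.desc (imageCocone c hJ)) (hc.hom_ext fun j => ?_)
  rw [Category.comp_id]
  refine (Category.assoc _ _ _).symm.trans ?_
  exact (congrArg (· ≫ imageIncl c hJ) (hc.fac (imageCocone c hJ) j)).trans
    (toImage_imageIncl c hJ j)

end

section

variable {J : Type u} [LinearOrder J] [Nonempty J] {F : J ⥤ CompleteAlgebra P}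

/-- A criterion for maps out of an object to commute with a directed colimit. -/
theorem preservesColimit_coyoneda {X : CompleteAlgebra P}
    (hsurj : ∀ (c : Cocone F), IsColimit c → ∀ f : X ⟶ c.pt, ∃ j, ∃ g : X ⟶ F.obj j,
      g ≫ c.ι.app j = f)
    (hinj : ∀ (c : Cocone F), IsColimit c → ∀ i, ∀ f g : X ⟶ F.obj i,
      f ≫ c.ι.app i = g ≫ c.ι.app i →
        ∃ (j : J) (h : i ≤ j), f ≫ F.map (homOfLE h) = g ≫ F.map (homOfLE h)) :
    PreservesColimit F (coyoneda.obj (Opposite.op X)) where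
  preserves {c} hc := ⟨Types.FilteredColimit.isColimitOf' _ _
    (fun f => by
      obtain ⟨j, g, hg⟩ := hsurj c hc f
      exact ⟨j, g, hg.symm⟩)
    (fun i f g h => by
      obtain ⟨j, hij, h'⟩ := hinj c hc i f g h
      exact ⟨j, homOfLE hij, h'⟩)⟩

theorem preservesColimit_coyoneda_initial :
    PreservesColimit F (coyoneda.obj (Opposite.op (⊥_ (CompleteAlgebra P)))) :=
  preservesColimit_coyoneda
    (fun _ _ _ => ⟨Classical.arbitrary J, initial.to _, Subsingleton.elim _ _⟩)
    (fun _ _ i _ _ _ => ⟨i, le_rfl, Subsingleton.elim _ _⟩)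

theorem preservesColimit_coyoneda_sphere (hJ : ∀ s : ℕ → J, ∃ j, ∀ n, s n ≤ j) (p n : ℤ) :
    PreservesColimit F (coyoneda.obj (Opposite.op (sphere P p n))) := by
  have hJ' : CountableInterFilter (Filter.atTop : Filter J) := by
    refine ⟨fun S hS h => ?_⟩
    rcases S.eq_empty_or_nonempty with rfl | hne
    · simp
    · obtain ⟨s, rfl⟩ := hS.exists_eq_range hne
      choose j hj using fun i => Filter.mem_atTop_sets.1 (h (s i) ⟨i, rfl⟩)
      obtain ⟨j', hj'⟩ := hJ j
      refine Filter.mem_atTop_sets.2 ⟨j', fun t ht => ?_⟩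
      rintro _ ⟨i, rfl⟩
      exact hj i t ((hj' i).trans ht)
  refine preservesColimit_coyoneda (fun c hc f => ?_) (fun c hc i f g h => ?_)
  · obtain ⟨i, x, hx, hxf⟩ := exists_map_app_eq hJ hc (map_mem_fil f (sphereGen_mem p n))
    obtain ⟨j, hij, hj⟩ := exists_map_eq_zero F hc ((F.obj i).obj.dTot x) (by
      rw [map_dTot, hxf]
      refine (map_dTot f _).symm.trans ?_
      rw [dTot_sphereGen, map_zero])
    obtain ⟨g, hg, -⟩ := sphere_existsUnique (map_mem_fil (F.map (homOfLE hij)) hx)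
      ((map_dTot _ _).symm.trans hj)
    refine ⟨j, g, ?_⟩
    refine (sphere_existsUnique (map_mem_fil f (sphereGen_mem p n)) ?_).unique ?_ rfl
    · rw [← map_dTot, dTot_sphereGen, map_zero]
    · refine (map_comp _ _ _).trans ?_
      rw [hg, map_app_homOfLE, hxf]
  · have h1 : map (c.ι.app i) (map f (sphereGen P p n) - map g (sphereGen P p n)) = 0 := by
      rw [map_sub, ← map_comp, ← map_comp, h, sub_self]
    obtain ⟨j, hij, hj⟩ := exists_map_eq_zero F hc _ h1
    refine ⟨j, hij, ?_⟩
    refine (sphere_existsUnique (map_mem_fil _ (sphereGen_mem p n)) ?_).unique ?_ rfl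
    · rw [← map_dTot, dTot_sphereGen, map_zero]
    · rw [map_sub, sub_eq_zero] at hj
      rw [map_comp, map_comp, hj]

end

end CompleteAlgebra

/-! ### Graded quasi-isomorphisms in terms of elements -/

section

variable {k : Type u} [Field k]

/-- A map of short complexes of modules is a quasi-isomorphism if and only if it is injective and
surjective on homology classes. -/
theorem ShortComplex.moduleCat_quasiIso_iff {S T : ShortComplex (ModuleCat.{u} k)} (φ : S ⟶ T) :
    ShortComplex.QuasiIso φ ↔
      (∀ x : S.X₂, S.g.hom x = 0 → ∀ y : T.X₁, φ.τ₂.hom x = T.f.hom y → ∃ z, S.f.hom z = x) ∧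
      (∀ y : T.X₂, T.g.hom y = 0 →
        ∃ x : S.X₂, S.g.hom x = 0 ∧ ∃ z, φ.τ₂.hom x = y + T.f.hom z) := by
  let γ := ShortComplex.leftHomologyMapData φ S.moduleCatLeftHomologyData
    T.moduleCatLeftHomologyData
  rw [γ.quasiIso_iff, ConcreteCategory.isIso_iff_bijective]
  have hK : ∀ x : LinearMap.ker S.g.hom, (γ.φK.hom x : LinearMap.ker T.g.hom).1 = φ.τ₂.hom x.1 :=
    fun x => congrArg (fun f => f.hom x) γ.commi
  have hH : ∀ x : LinearMap.ker S.g.hom,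
      γ.φH.hom ((LinearMap.range S.moduleCatToCycles).mkQ x) =
        (LinearMap.range T.moduleCatToCycles).mkQ (γ.φK.hom x) :=
    fun x => congrArg (fun f => f.hom x) γ.commπ
  have hS : ∀ x : LinearMap.ker S.g.hom,
      (LinearMap.range S.moduleCatToCycles).mkQ x = 0 ↔ ∃ z, S.f.hom z = x.1 := by
    intro x
    rw [Submodule.mkQ_apply, Submodule.Quotient.mk_eq_zero]
    exact exists_congr fun z => Subtype.ext_iff
  have hT : ∀ x : LinearMap.ker T.g.hom,
      (LinearMap.range T.moduleCatToCycles).mkQ x = 0 ↔ ∃ z, T.f.hom z = x.1 := by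
    intro x
    rw [Submodule.mkQ_apply, Submodule.Quotient.mk_eq_zero]
    exact exists_congr fun z => Subtype.ext_iff
  have hT' : ∀ x y : LinearMap.ker T.g.hom, (LinearMap.range T.moduleCatToCycles).mkQ x =
      (LinearMap.range T.moduleCatToCycles).mkQ y ↔ ∃ z, T.f.hom z = x.1 - y.1 := by
    intro x y
    rw [← sub_eq_zero, ← map_sub, hT]
    rfl
  refine and_congr ⟨fun h x hx y hxy => ?_, fun h => ?_⟩ ⟨fun h y hy => ?_, fun h => ?_⟩
  · refine (hS ⟨x, hx⟩).1 (h ?_)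
    refine (hH ⟨x, hx⟩).trans (((hT _).2 ⟨y, ?_⟩).trans (map_zero γ.φH.hom).symm)
    exact hxy.symm.trans (hK ⟨x, hx⟩).symm
  · refine (injective_iff_map_eq_zero γ.φH.hom).2 fun x hx => ?_
    obtain ⟨x, rfl⟩ := (LinearMap.range S.moduleCatToCycles).mkQ_surjective x
    obtain ⟨y, hy⟩ := (hT _).1 ((hH x).symm.trans hx)
    exact (hS x).2 (h x.1 x.2 y ((hK x).symm.trans hy.symm))
  · obtain ⟨x, hx⟩ := h ((LinearMap.range T.moduleCatToCycles).mkQ ⟨y, hy⟩)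
    obtain ⟨x, rfl⟩ := (LinearMap.range S.moduleCatToCycles).mkQ_surjective x
    obtain ⟨z, hz⟩ := (hT' _ _).1 ((hH x).symm.trans hx)
    refine ⟨x.1, x.2, z, ?_⟩
    rw [hz, ← hK x]
    exact (add_sub_cancel y _).symm
  · intro y
    obtain ⟨y, rfl⟩ := (LinearMap.range T.moduleCatToCycles).mkQ_surjective y
    obtain ⟨x, hx, z, hz⟩ := h y.1 y.2
    refine ⟨(LinearMap.range S.moduleCatToCycles).mkQ ⟨x, hx⟩, (hH _).trans ((hT' _ _).2 ⟨z, ?_⟩)⟩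
    refine Eq.trans ?_ (congrArg (· - y.1) (hK ⟨x, hx⟩).symm)
    simp [hz]

end

namespace FilteredComplex

variable {k : Type u} [Field k] {V W : FilteredComplex k}

/-- The class of an element of `F^p V` in the associated graded. -/
def grProj (V : FilteredComplex k) (p n : ℤ) : V.F p n →ₗ[k] (V.gr p).X n :=
  ((cokernel.π (V.subIncl p)).f n).hom

theorem grProj_surjective (p n : ℤ) : Function.Surjective (V.grProj p n) :=
  (ModuleCat.epi_iff_surjective ((cokernel.π (V.subIncl p)).f n)).1 inferInstance

theorem grProj_eq_zero_iff {p n : ℤ} (x : V.F p n) :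
    V.grProj p n x = 0 ↔ x.1 ∈ V.F (p + 1) n := by
  have h := (ShortComplex.exact_cokernel (V.subIncl p)).map
    (HomologicalComplex.eval (ModuleCat.{u} k) (ComplexShape.up ℤ) n)
  rw [ShortComplex.moduleCat_exact_iff] at h
  constructor
  · intro hx
    obtain ⟨y, hy⟩ := h x hx
    have : x.1 = y.1 := congrArg Subtype.val hy.symm
    rw [this]
    exact y.2
  · intro hx
    have := congrArg (fun f => (f.f n).hom ⟨x.1, hx⟩) (cokernel.condition (V.subIncl p))
    exact this

theorem gr_d_grProj (p i j : ℤ) (x : V.F p i) :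
    ((V.gr p).d i j).hom (V.grProj p i x) =
      V.grProj p j ⟨(V.cx.d i j).hom x.1, V.d_mem p i j x.1 x.2⟩ :=
  congrArg (fun f => f.hom x) ((cokernel.π (V.subIncl p)).comm i j)

theorem grMap_grProj (f : V ⟶ W) (p n : ℤ) (x : V.F p n) :
    ((grMap f p).f n).hom (V.grProj p n x) =
      W.grProj p n ⟨(f.hom.f n).hom x.1, f.map_mem p n x.1 x.2⟩ := by
  have h : cokernel.π (V.subIncl p) ≫ grMap f p = subMap f p ≫ cokernel.π (W.subIncl p) :=
    cokernel.π_desc _ _ _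
  exact congrArg (fun g => (g.f n).hom x) h

theorem exists_inj {p n : ℤ} {x : V.Tot} (hx : x ∈ V.fil p n) :
    ∃ y : V.F p n, V.inj n y.1 = x := by
  obtain ⟨y, hy, rfl⟩ := mem_fil.1 hx
  exact ⟨⟨y, hy⟩, rfl⟩

/-- A map is a graded quasi-isomorphism if and only if it is injective and surjective on the
homology classes of all `F^p / F^{p+1}`. -/
theorem isGradedQuasiIso_iff (f : V ⟶ W) :
    IsGradedQuasiIso f ↔ ∀ p n : ℤ,
      (∀ a ∈ V.fil p (n + 1), V.dTot a ∈ V.fil (p + 1) (n + 1 + 1) →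
        ∀ β ∈ W.fil p n, totMap f a - W.dTot β ∈ W.fil (p + 1) (n + 1) →
          ∃ α ∈ V.fil p n, a - V.dTot α ∈ V.fil (p + 1) (n + 1)) ∧
      (∀ b ∈ W.fil p (n + 1), W.dTot b ∈ W.fil (p + 1) (n + 1 + 1) →
        ∃ a ∈ V.fil p (n + 1), V.dTot a ∈ V.fil (p + 1) (n + 1 + 1) ∧
          ∃ β ∈ W.fil p n, totMap f a - (b + W.dTot β) ∈ W.fil (p + 1) (n + 1)) := by
  have step : ∀ p : ℤ, QuasiIso (grMap f p) ↔ ∀ n : ℤ, QuasiIsoAt (grMap f p) (n + 1) := by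
    intro p
    rw [quasiIso_iff]
    refine ⟨fun h n => h _, fun h n => ?_⟩
    have := h (n - 1)
    rwa [sub_add_cancel] at this
  unfold IsGradedQuasiIso
  refine forall_congr' fun p => (step p).trans (forall_congr' fun n => ?_)
  rw [quasiIsoAt_iff' (grMap f p) n (n + 1) (n + 1 + 1) (by simp) (by simp),
    ShortComplex.moduleCat_quasiIso_iff]
  have eqV : ∀ {m : ℤ} (x y : V.F p m), V.grProj p m x = V.grProj p m y ↔
      V.inj m x.1 - V.inj m y.1 ∈ V.fil (p + 1) m := by
    intro m x y
    rw [← sub_eq_zero, ← map_sub, grProj_eq_zero_iff, ← map_sub, inj_mem_fil]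
    rfl
  have eqW : ∀ {m : ℤ} (x y : W.F p m), W.grProj p m x = W.grProj p m y ↔
      W.inj m x.1 - W.inj m y.1 ∈ W.fil (p + 1) m := by
    intro m x y
    rw [← sub_eq_zero, ← map_sub, grProj_eq_zero_iff, ← map_sub, inj_mem_fil]
    rfl
  have dV : ∀ x : V.F p (n + 1), ((V.gr p).d (n + 1) (n + 1 + 1)).hom (V.grProj p (n + 1) x) = 0 ↔
      V.dTot (V.inj (n + 1) x.1) ∈ V.fil (p + 1) (n + 1 + 1) := by
    intro x
    rw [gr_d_grProj, grProj_eq_zero_iff, dTot_inj, inj_mem_fil]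
  have dW : ∀ x : W.F p (n + 1), ((W.gr p).d (n + 1) (n + 1 + 1)).hom (W.grProj p (n + 1) x) = 0 ↔
      W.dTot (W.inj (n + 1) x.1) ∈ W.fil (p + 1) (n + 1 + 1) := by
    intro x
    rw [gr_d_grProj, grProj_eq_zero_iff, dTot_inj, inj_mem_fil]
  refine and_congr ⟨fun h a ha hda β hβ hab => ?_, fun h x hx y hxy => ?_⟩
    ⟨fun h b hb hdb => ?_, fun h y hy => ?_⟩
  · obtain ⟨a, rfl⟩ := exists_inj ha
    obtain ⟨β, rfl⟩ := exists_inj hβ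
    rw [totMap_inj, dTot_inj] at hab
    obtain ⟨z, hz⟩ := h (V.grProj p (n + 1) a) ((dV a).2 hda) (W.grProj p n β)
      ((grMap_grProj f p (n + 1) a).trans (((eqW _ _).2 hab).trans (gr_d_grProj p n (n + 1) β).symm))
    obtain ⟨z, rfl⟩ := grProj_surjective p n z
    refine ⟨_, inj_mem_fil.2 z.2, ?_⟩
    rw [dTot_inj]
    exact (eqV _ ⟨_, V.d_mem p n (n + 1) z.1 z.2⟩).1
      (hz.symm.trans (gr_d_grProj p n (n + 1) z))
  · obtain ⟨x, rfl⟩ := grProj_surjective p (n + 1) x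
    obtain ⟨y, rfl⟩ := grProj_surjective p n y
    have h1 := (grMap_grProj f p (n + 1) x).symm.trans (hxy.trans (gr_d_grProj p n (n + 1) y))
    have h2 := (eqW _ _).1 h1
    obtain ⟨α, hα, hα'⟩ := h _ (inj_mem_fil.2 x.2) ((dV x).1 hx) _ (inj_mem_fil.2 y.2) (by
      rw [totMap_inj, dTot_inj]
      exact h2)
    obtain ⟨α, rfl⟩ := exists_inj hα
    rw [dTot_inj] at hα'
    exact ⟨V.grProj p n α, (gr_d_grProj p n (n + 1) α).trans
      ((eqV x ⟨_, V.d_mem p n (n + 1) α.1 α.2⟩).2 hα').symm⟩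
  · obtain ⟨b, rfl⟩ := exists_inj hb
    obtain ⟨x, hx, z, hz⟩ := h (W.grProj p (n + 1) b) ((dW b).2 hdb)
    obtain ⟨x, rfl⟩ := grProj_surjective p (n + 1) x
    obtain ⟨z, rfl⟩ := grProj_surjective p n z
    refine ⟨_, inj_mem_fil.2 x.2, (dV x).1 hx, _, inj_mem_fil.2 z.2, ?_⟩
    have h1 := (grMap_grProj f p (n + 1) x).symm.trans
      (hz.trans (congrArg (W.grProj p (n + 1) b + ·) (gr_d_grProj p n (n + 1) z)))
    rw [← map_add] at h1
    have h2 := (eqW _ _).1 h1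
    rw [totMap_inj, dTot_inj, ← map_add]
    exact h2
  · obtain ⟨y, rfl⟩ := grProj_surjective p (n + 1) y
    obtain ⟨a, ha, hda, β, hβ, hab⟩ := h _ (inj_mem_fil.2 y.2) ((dW y).1 hy)
    obtain ⟨a, rfl⟩ := exists_inj ha
    obtain ⟨β, rfl⟩ := exists_inj hβ
    refine ⟨V.grProj p (n + 1) a, (dV a).2 hda, W.grProj p n β, ?_⟩
    rw [totMap_inj, dTot_inj] at hab
    refine (grMap_grProj f p (n + 1) a).trans ?_
    refine Eq.trans ?_ (congrArg (W.grProj p (n + 1) y + ·) (gr_d_grProj p n (n + 1) β).symm)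
    rw [← map_add]
    refine (eqW _ (y + ⟨_, W.d_mem p n (n + 1) β.1 β.2⟩)).2 ?_
    refine Eq.mp (congrArg (fun t => _ - t ∈ W.fil (p + 1) (n + 1)) ?_) hab
    exact (map_add (W.inj (n + 1)) y.1 ((W.cx.d n (n + 1)).hom β.1)).symm

theorem isFilteredSurjection_iff (f : V ⟶ W) :
    IsFilteredSurjection f ↔
      ∀ p n : ℤ, ∀ y ∈ W.fil p n, ∃ x ∈ V.fil p n, totMap f x = y := by
  refine forall_congr' fun p => forall_congr' fun n => ⟨fun h y hy => ?_, fun h y hy => ?_⟩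
  · obtain ⟨y, hy', rfl⟩ := mem_fil.1 hy
    obtain ⟨x, hx, rfl⟩ := h y hy'
    exact ⟨_, inj_mem_fil.2 hx, totMap_inj _ _ _⟩
  · obtain ⟨x, hx, hxy⟩ := h _ (inj_mem_fil.2 hy)
    obtain ⟨x, hx', rfl⟩ := mem_fil.1 hx
    rw [totMap_inj] at hxy
    exact ⟨x, hx', inj_injective n hxy⟩

/-- Cochains can be lifted against `f` with prescribed coboundary. -/
def LiftsCochains (f : V ⟶ W) : Prop :=
  ∀ p n : ℤ, ∀ z ∈ V.fil p (n + 1), V.dTot z = 0 → ∀ y ∈ W.fil p n, W.dTot y = totMap f z →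
    ∃ x ∈ V.fil p n, V.dTot x = z ∧ totMap f x = y

theorem LiftsCochains.exists_cocycle {f : V ⟶ W} (h : LiftsCochains f) {p n : ℤ} {y : W.Tot}
    (hy : y ∈ W.fil p n) (hd : W.dTot y = 0) : ∃ x ∈ V.fil p n, V.dTot x = 0 ∧ totMap f x = y :=
  h p n 0 (zero_mem _) (map_zero _) y hy (hd.trans (map_zero _).symm)

theorem LiftsCochains.isFilteredSurjection {f : V ⟶ W} (h : LiftsCochains f) :
    IsFilteredSurjection f := by
  rw [isFilteredSurjection_iff]
  intro p n y hy
  obtain ⟨z, hz, hdz, hzy⟩ := h.exists_cocycle (dTot_mem_fil hy) (dTot_dTot y)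
  obtain ⟨x, hx, -, hxy⟩ := h p n z hz hdz y hy hzy.symm
  exact ⟨x, hx, hxy⟩

theorem LiftsCochains.isGradedQuasiIso {f : V ⟶ W} (h : LiftsCochains f) :
    IsGradedQuasiIso f := by
  rw [isGradedQuasiIso_iff]
  refine fun p n => ⟨fun a ha hda β hβ hab => ?_, fun b hb hdb => ?_⟩
  · have hε : W.dTot (totMap f a - W.dTot β) = totMap f (V.dTot a) := by
      rw [map_sub, dTot_dTot, sub_zero, totMap_dTot]
    obtain ⟨x, hx, hdx, hfx⟩ := h (p + 1) (n + 1) _ hda (dTot_dTot a) _ hab hε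
    obtain ⟨α, hα, hdα, -⟩ := h p n (a - x) (sub_mem ha (fil_anti (by omega) _ hx))
      (by rw [map_sub, hdx, sub_self]) β hβ (by rw [map_sub, hfx]; abel)
    refine ⟨α, hα, ?_⟩
    rw [hdα, sub_sub_cancel]
    exact hx
  · obtain ⟨z, hz, hdz, hzb⟩ := h.exists_cocycle hdb (dTot_dTot b)
    obtain ⟨x, hx, hdx, hxb⟩ := h p (n + 1) z (fil_anti (by omega) _ hz) hdz b hb hzb.symm
    refine ⟨x, hx, by rwa [hdx], 0, zero_mem _, ?_⟩
    rw [map_zero, add_zero, hxb, sub_self]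
    exact zero_mem _

/-- For a filtered surjection that is a graded quasi-isomorphism, a cocycle of the kernel is a
coboundary of the kernel up to the next step of the filtration. -/
theorem exists_sub_dTot_mem {f : V ⟶ W} (hs : IsFilteredSurjection f) (hq : IsGradedQuasiIso f)
    {p n : ℤ} {z : V.Tot} (hz : z ∈ V.fil p (n + 1)) (hd : V.dTot z = 0) (hf : totMap f z = 0) :
    ∃ w ∈ V.fil p n, totMap f w = 0 ∧ z - V.dTot w ∈ V.fil (p + 1) (n + 1) := by
  rw [isFilteredSurjection_iff] at hs
  rw [isGradedQuasiIso_iff] at hq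
  obtain ⟨α, hα, hzα⟩ := (hq p n).1 z hz (by rw [hd]; exact zero_mem _) 0 (zero_mem _)
    (by rw [hf, map_zero, sub_zero]; exact zero_mem _)
  obtain ⟨m, rfl⟩ : ∃ m, n = m + 1 := ⟨n - 1, by omega⟩
  have hdα : W.dTot (totMap f α) ∈ W.fil (p + 1) (m + 1 + 1) := by
    have := totMap_mem_fil f hzα
    rw [map_sub, hf, zero_sub, neg_mem_iff, totMap_dTot] at this
    exact this
  obtain ⟨α', hα', hdα', β, hβ, hε⟩ := (hq p m).2 (totMap f α) (totMap_mem_fil f hα) hdα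
  obtain ⟨β', hβ', rfl⟩ := hs p m β hβ
  obtain ⟨ε, hε', hεε⟩ := hs (p + 1) (m + 1) _ hε
  refine ⟨α - α' + V.dTot β' + ε, ?_, ?_, ?_⟩
  · exact add_mem (add_mem (sub_mem hα hα') (dTot_mem_fil hβ')) (fil_anti (by omega) _ hε')
  · simp only [map_add, map_sub, hεε, totMap_dTot]
    abel
  · have h1 : z - V.dTot (α - α' + V.dTot β' + ε) =
        (z - V.dTot α) + V.dTot α' - V.dTot ε := by
      simp only [map_add, map_sub, dTot_dTot]
      abel
    rw [h1]
    exact sub_mem (add_mem hzα hdα') (dTot_mem_fil hε')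

/-- A filtered surjection of complete complexes that is a graded quasi-isomorphism lifts cochains:
the coboundary is corrected step by step along the filtration, and the corrections converge. -/
theorem liftsCochains {f : V ⟶ W} (hV : V.IsComplete) (hW : W.IsComplete)
    (hs : IsFilteredSurjection f) (hq : IsGradedQuasiIso f) : LiftsCochains f := by
  intro p n z hz hdz y hy hyz
  obtain ⟨x₀, hx₀, hfx₀⟩ := (isFilteredSurjection_iff f).1 hs p n y hy
  -- the error terms at each step are cocycles of the kernel
  have step : ∀ i : ℕ, ∀ x : {x : V.Tot // totMap f x = y ∧ z - V.dTot x ∈ V.fil (p + i) (n + 1)},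
      ∃ x' : {x : V.Tot // totMap f x = y ∧ z - V.dTot x ∈ V.fil (p + (i + 1 : ℕ)) (n + 1)},
        x'.1 - x.1 ∈ V.fil (p + i) n := by
    rintro i ⟨x, hfx, hx⟩
    obtain ⟨w, hw, hfw, hzw⟩ := exists_sub_dTot_mem hs hq hx
      (by rw [map_sub, hdz, dTot_dTot, sub_zero])
      (by rw [map_sub, totMap_dTot, hfx, hyz, sub_self])
    refine ⟨⟨x + w, by rw [map_add, hfx, hfw, add_zero], ?_⟩, ?_⟩
    · rw [map_add, ← sub_sub]
      have : p + ((i + 1 : ℕ) : ℤ) = p + i + 1 := by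
        push_cast
        ring
      rwa [this]
    · simpa using hw
  choose next hnext using step
  let s : ∀ i : ℕ, {x : V.Tot // totMap f x = y ∧ z - V.dTot x ∈ V.fil (p + i) (n + 1)} :=
    fun i => Nat.rec ⟨x₀, hfx₀, by
      rw [Nat.cast_zero, add_zero]
      exact sub_mem hz (dTot_mem_fil hx₀)⟩ next i
  have hsucc : ∀ i : ℕ, (s (i + 1)).1 - (s i).1 ∈ V.fil (p + i) n := fun i => hnext i (s i)
  obtain ⟨x, hx, hxs⟩ := hV.exists_limit_of_succ (r := p) (z := fun i => (s i).1)
    (fil_le_deg _ _ hx₀) hsucc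
  have hbig : ∀ q : ℤ, ∃ i : ℕ, q ≤ p + i := fun q => ⟨(q - p).toNat, by omega⟩
  refine ⟨x, ?_, ?_, ?_⟩
  · have h0 := hxs 0
    have h1 := add_mem (fil_anti (p := p) (by simp) n h0) hx₀
    exact sub_add_cancel x x₀ ▸ h1
  · rw [← sub_eq_zero]
    refine hV.eq_zero (n := n + 1) fun q => ?_
    obtain ⟨i, hi⟩ := hbig q
    have h1 := sub_mem (dTot_mem_fil (hxs i)) (s i).2.2
    have h2 : V.dTot x - z = V.dTot (x - (s i).1) - (z - V.dTot (s i).1) := by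
      rw [map_sub]
      abel
    rw [h2]
    exact fil_anti hi _ h1
  · rw [← sub_eq_zero]
    refine hW.eq_zero (n := n) fun q => ?_
    obtain ⟨i, hi⟩ := hbig q
    have h1 := totMap_mem_fil f (hxs i)
    rw [map_sub, (s i).2.1] at h1
    exact fil_anti hi _ h1

end FilteredComplex

/-! ### Koszul signs -/

theorem Int.negOnePow_sum {ι : Type*} (s : Finset ι) (f : ι → ℤ) :
    (∑ i ∈ s, f i).negOnePow = ∏ i ∈ s, (f i).negOnePow := by
  classical
  induction s using Finset.induction_on with
  | empty => simp
  | insert i s hi ih => rw [Finset.sum_insert hi, Finset.prod_insert hi, Int.negOnePow_add, ih]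

theorem koszulSign_eq {m n : ℕ} (σ : Fin m ≃ Fin n) (d : Fin n → ℤ) :
    koszulSign σ d =
      (∑ i, ∑ j, if i < j ∧ σ j < σ i then d (σ i) * d (σ j) else 0).negOnePow := by
  unfold koszulSign
  rw [Int.negOnePow_sum]
  refine Finset.prod_congr rfl fun i _ => ?_
  rw [Int.negOnePow_sum]
  refine Finset.prod_congr rfl fun j _ => ?_
  split_ifs <;> simp

theorem shuffleSign_eq {m : ℕ} (b c : Fin m → ℤ) :
    shuffleSign b c = (∑ i, ∑ j, if i < j then c i * b j else 0).negOnePow := by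
  unfold shuffleSign
  rw [Int.negOnePow_sum]
  refine Finset.prod_congr rfl fun i _ => ?_
  rw [Int.negOnePow_sum]
  refine Finset.prod_congr rfl fun j _ => ?_
  split_ifs <;> simp

/-- The Koszul sign after lowering the degree of one element by one: the sign changes by the number
of elements of odd degree that are moved past this element. -/
theorem koszulSign_update {m n : ℕ} (σ : Fin m ≃ Fin n) (d : Fin n → ℤ) (i₀ : Fin m) :
    koszulSign σ (Function.update d (σ i₀) (d (σ i₀) - 1)) *
        (∑ j with j < σ i₀, d j).negOnePow =
      koszulSign σ d * (∑ i with i < i₀, d (σ i)).negOnePow := by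
  rw [koszulSign_eq, koszulSign_eq, ← Int.negOnePow_add, ← Int.negOnePow_add,
    Int.negOnePow_eq_iff]
  have hu : ∀ i, Function.update d (σ i₀) (d (σ i₀) - 1) (σ i) =
      d (σ i) - if i = i₀ then 1 else 0 := by
    intro i
    by_cases h : i = i₀
    · subst h
      simp
    · rw [Function.update_of_ne (fun h' => h (σ.injective h')), if_neg h, sub_zero]
  have hK : (∑ i, ∑ j, if i < j ∧ σ j < σ i then
      Function.update d (σ i₀) (d (σ i₀) - 1) (σ i) *
        Function.update d (σ i₀) (d (σ i₀) - 1) (σ j) else 0) =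
      (∑ i, ∑ j, if i < j ∧ σ j < σ i then d (σ i) * d (σ j) else 0) -
        ∑ i, ((if i₀ < i ∧ σ i < σ i₀ then d (σ i) else 0) +
          if i < i₀ ∧ σ i₀ < σ i then d (σ i) else 0) := by
    have h1 : ∀ i j, (if i < j ∧ σ j < σ i then
        Function.update d (σ i₀) (d (σ i₀) - 1) (σ i) *
          Function.update d (σ i₀) (d (σ i₀) - 1) (σ j) else 0) =
        (if i < j ∧ σ j < σ i then d (σ i) * d (σ j) else 0) -
          ((if i = i₀ then (if i₀ < j ∧ σ j < σ i₀ then d (σ j) else 0) else 0) +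
            if j = i₀ then (if i < i₀ ∧ σ i₀ < σ i then d (σ i) else 0) else 0) := by
      intro i j
      rw [hu, hu]
      by_cases hi : i = i₀
      · subst hi
        by_cases hj : j = i
        · subst hj
          simp
        · by_cases hc : i < j ∧ σ j < σ i
          · simp only [if_pos hc, hj, if_true, if_false]
            ring
          · simp [hc, hj]
      · by_cases hj : j = i₀
        · subst hj
          by_cases hc : i < j ∧ σ j < σ i
          · simp only [if_pos hc, hi, if_true, if_false]
            ring
          · simp [hc, hi]
        · simp [hi, hj]
    simp only [h1, Finset.sum_sub_distrib, Finset.sum_add_distrib]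
    congr 2
    · rw [Finset.sum_comm]
      simp
    · simp
  have hσ : (∑ j with j < σ i₀, d j) = ∑ i, if σ i < σ i₀ then d (σ i) else 0 := by
    rw [Finset.sum_filter]
    exact (Equiv.sum_comp σ (fun j => if j < σ i₀ then d j else 0)).symm
  rw [hK, hσ, Finset.sum_filter]
  have h2 : ∀ K a b c : ℤ, K - a + b - (K + c) = -a + b - c := fun K a b c => by ring
  rw [h2, ← Finset.sum_neg_distrib, ← Finset.sum_add_distrib, ← Finset.sum_sub_distrib]
  refine Finset.even_sum _ fun i _ => ?_
  rcases lt_trichotomy i i₀ with h | h | h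
  · rcases lt_or_gt_of_ne (fun e : σ i = σ i₀ => h.ne (σ.injective e)) with h' | h'
    · simp [h, h', h.not_gt, h'.not_gt]
    · refine ⟨- d (σ i), ?_⟩
      simp [h, h', h.not_gt, h'.not_gt]
      ring
  · subst h
    simp
  · rcases lt_or_gt_of_ne (fun e : σ i = σ i₀ => h.ne (σ.injective e).symm) with h' | h'
    · simp [h, h', h.not_gt, h'.not_gt]
    · simp [h, h', h.not_gt, h'.not_gt]

/-- Lowering one of the degrees `c i₀` by one changes the shuffle sign by the parity of the degrees
`b j` with `i₀ < j`, which are moved past it. -/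
theorem shuffleSign_update {m : ℕ} (b c : Fin m → ℤ) (i₀ : Fin m) :
    shuffleSign b (Function.update c i₀ (c i₀ - 1)) =
      shuffleSign b c * (∑ j with i₀ < j, b j).negOnePow := by
  rw [shuffleSign_eq, shuffleSign_eq, ← Int.negOnePow_add, Int.negOnePow_eq_iff]
  have h1 : ∀ i j, (if i < j then Function.update c i₀ (c i₀ - 1) i * b j else 0) =
      (if i < j then c i * b j else 0) -
        if i = i₀ then (if i₀ < j then b j else 0) else 0 := by
    intro i j
    by_cases hi : i = i₀
    · subst hi
      by_cases hj : i < j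
      · simp [hj]
        ring
      · simp [hj]
    · simp [hi]
  simp only [h1, Finset.sum_sub_distrib]
  rw [Finset.sum_comm (f := fun i j => if i = i₀ then (if i₀ < j then b j else 0) else 0)]
  simp only [Finset.sum_ite_eq', Finset.mem_univ, if_true, Finset.sum_filter]
  exact ⟨-∑ j, if i₀ < j then b j else 0, by ring⟩

/-! ### Concatenation of blocks -/

theorem finSigmaFinEquiv_block {m : ℕ} (n : Fin m → ℕ) (t : Fin (∑ i, n i)) :
    finSigmaFinEquiv ⟨blockIndex n t, blockPos n t⟩ = t :=
  finSigmaFinEquiv.apply_symm_apply t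

/-- A family indexed by blocks and positions, at a given position of a block. -/
theorem block_apply {m : ℕ} (n : Fin m → ℕ) {M : Type*} (a : ∀ i, Fin (n i) → M) (i : Fin m)
    (s : Fin (n i)) :
    a (blockIndex n (finSigmaFinEquiv ⟨i, s⟩)) (blockPos n (finSigmaFinEquiv ⟨i, s⟩)) = a i s :=
  congrArg (fun x : (i : Fin m) × Fin (n i) => a x.1 x.2) (finSigmaFinEquiv.symm_apply_apply ⟨i, s⟩)

theorem sum_block {M : Type*} [AddCommMonoid M] {m : ℕ} (n : Fin m → ℕ)
    (f : Fin (∑ i, n i) → M) : ∑ t, f t = ∑ i, ∑ s, f (finSigmaFinEquiv ⟨i, s⟩) := by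
  rw [← Equiv.sum_comp finSigmaFinEquiv f, Fintype.sum_sigma]

theorem finSigmaFinEquiv_val {m : ℕ} (n : Fin m → ℕ) (i : Fin m) (s : Fin (n i)) :
    (finSigmaFinEquiv ⟨i, s⟩ : Fin (∑ i, n i)).val = (∑ j with j < i, n j) + s.val := by
  rw [finSigmaFinEquiv_apply]
  congr 1
  refine Finset.sum_bij (fun j _ => Fin.castLE i.2.le j) ?_ ?_ ?_ ?_
  · intro j _
    simp only [Finset.mem_filter, Finset.mem_univ, true_and]
    exact j.2
  · intro j _ j' _ h
    exact Fin.castLE_injective _ h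
  · intro j hj
    simp only [Finset.mem_filter, Finset.mem_univ, true_and] at hj
    exact ⟨⟨j.val, hj⟩, Finset.mem_univ _, rfl⟩
  · intro j _
    rfl

/-- The order of a concatenation of blocks is lexicographic. -/
theorem finSigmaFinEquiv_lt_of_lt {m : ℕ} (n : Fin m → ℕ) {i j : Fin m} (h : i < j)
    (s : Fin (n i)) (t : Fin (n j)) :
    (finSigmaFinEquiv ⟨i, s⟩ : Fin (∑ i, n i)) < finSigmaFinEquiv ⟨j, t⟩ := by
  rw [Fin.lt_def, finSigmaFinEquiv_val, finSigmaFinEquiv_val]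
  have h1 : (∑ l with l < i, n l) + n i ≤ ∑ l with l < j, n l := by
    rw [add_comm, ← Finset.sum_insert (by simp)]
    refine Finset.sum_le_sum_of_subset fun l hl => ?_
    simp only [Finset.mem_insert, Finset.mem_filter, Finset.mem_univ, true_and] at hl ⊢
    rcases hl with rfl | hl
    · exact h
    · exact hl.trans h
  have := s.2
  omega

theorem finSigmaFinEquiv_lt_iff {m : ℕ} (n : Fin m → ℕ) {i : Fin m} (s t : Fin (n i)) :
    (finSigmaFinEquiv ⟨i, s⟩ : Fin (∑ i, n i)) < finSigmaFinEquiv ⟨i, t⟩ ↔ s < t := by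
  rw [Fin.lt_def, finSigmaFinEquiv_val, finSigmaFinEquiv_val]
  simp

theorem sum_lt_block {m : ℕ} (n : Fin m → ℕ) (c : ∀ i, Fin (n i) → ℤ) (i : Fin m)
    (s : Fin (n i)) :
    ∑ t with t < finSigmaFinEquiv ⟨i, s⟩, c (blockIndex n t) (blockPos n t) =
      ∑ j with j < i, ∑ r, c j r + ∑ r with r < s, c i r := by
  rw [Finset.sum_filter, sum_block]
  simp only [block_apply]
  have h1 : ∀ j, (∑ r, if (finSigmaFinEquiv ⟨j, r⟩ : Fin (∑ i, n i)) < finSigmaFinEquiv ⟨i, s⟩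
      then c j r else 0) = (if j < i then ∑ r, c j r else 0) +
        if j = i then ∑ r with r < s, c i r else 0 := by
    intro j
    rcases lt_trichotomy j i with h | h | h
    · simp [finSigmaFinEquiv_lt_of_lt n h, h, h.ne]
    · subst h
      simp [finSigmaFinEquiv_lt_iff, Finset.sum_filter]
    · simp [(finSigmaFinEquiv_lt_of_lt n h _ _).not_gt, h.not_gt, h.ne']
  rw [Finset.sum_congr rfl fun j _ => h1 j, Finset.sum_add_distrib, Finset.sum_ite_eq',
    if_pos (Finset.mem_univ i), ← Finset.sum_filter]

/-! ### Convergent power series over a complete algebra -/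

namespace CompleteAlgebra

open FilteredComplex

variable {k : Type u} [Field k] {P : CompleteOperad k} (A : CompleteAlgebra P)

/-- An operation has large filtration weight if one of its arguments does. -/
theorem act_mem_of_mem {n : ℕ} {v e q : ℤ} {w b : Fin n → ℤ} {p : (P.obj n).Tot}
    {a : Fin n → A.obj.Tot} (hp : p ∈ (P.obj n).fil v e) (ha : ∀ i, a i ∈ A.obj.fil (w i) (b i))
    (i : Fin n) (hi : a i ∈ A.obj.fil (q - v - ∑ j ∈ Finset.univ.erase i, w j) (b i)) :
    A.act n p a ∈ A.obj.fil q (e + ∑ i, b i) := by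
  have h := A.act_mem n v e (Function.update w i (q - v - ∑ j ∈ Finset.univ.erase i, w j)) b p a hp
    (fun j => by
      rcases eq_or_ne j i with rfl | h
      · rwa [Function.update_self]
      · rw [Function.update_of_ne h]
        exact ha j)
  rw [Finset.sum_update_of_mem (Finset.mem_univ i), ← Finset.erase_eq] at h
  convert h using 2
  ring

/-- Perturbing the arguments by elements of high filtration weight perturbs the value of an
operation by an element of high filtration weight. -/
theorem act_add_sub_mem {n : ℕ} {v e q : ℤ} {w b : Fin n → ℤ} {p : (P.obj n).Tot}
    {a z : Fin n → A.obj.Tot} (hp : p ∈ (P.obj n).fil v e)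
    (ha : ∀ i, a i ∈ A.obj.fil (w i) (b i)) (hz : ∀ i, z i ∈ A.obj.fil (w i) (b i))
    (hz' : ∀ i, z i ∈ A.obj.fil (q - v - ∑ j ∈ Finset.univ.erase i, w j) (b i)) :
    A.act n p (a + z) - A.act n p a ∈ A.obj.fil q (e + ∑ i, b i) := by
  rw [MultilinearMap.map_add_univ, ← Finset.add_sum_erase _ _ (Finset.mem_univ Finset.univ),
    Finset.piecewise_univ, add_sub_cancel_left]
  refine Submodule.sum_mem _ fun s hs => ?_
  obtain ⟨i, hi⟩ : ∃ i, i ∉ s := by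
    by_contra! h
    exact (Finset.mem_erase.1 hs).1 (Finset.eq_univ_of_forall h)
  refine A.act_mem_of_mem (w := w) hp (fun j => ?_) i ?_
  · by_cases hj : j ∈ s
    · rw [Finset.piecewise_eq_of_mem _ _ _ hj]
      exact ha j
    · rw [Finset.piecewise_eq_of_notMem _ _ _ hj]
      exact hz j
  · rw [Finset.piecewise_eq_of_notMem _ _ _ hi]
    exact hz' i

/-- The power series `∑ m, f m * t ^ m` of degree `n` and filtration weight `p` whose coefficients
tend to zero. -/
def tateW (p n : ℤ) : Submodule k (ℕ → A.obj.Tot) where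
  carrier := {f | (∀ m, f m ∈ A.obj.fil p n) ∧ ∀ q, ∃ N, ∀ m, N ≤ m → f m ∈ A.obj.fil q n}
  add_mem' := by
    rintro f g ⟨hf, hf'⟩ ⟨hg, hg'⟩
    refine ⟨fun m => add_mem (hf m) (hg m), fun q => ?_⟩
    obtain ⟨N, hN⟩ := hf' q
    obtain ⟨N', hN'⟩ := hg' q
    exact ⟨max N N', fun m hm => add_mem (hN m (le_of_max_le_left hm))
      (hN' m (le_of_max_le_right hm))⟩
  zero_mem' := ⟨fun _ => zero_mem _, fun _ => ⟨0, fun _ _ => zero_mem _⟩⟩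
  smul_mem' := by
    rintro c f ⟨hf, hf'⟩
    exact ⟨fun m => Submodule.smul_mem _ c (hf m), fun q =>
      (hf' q).imp fun N hN m hm => Submodule.smul_mem _ c (hN m hm)⟩

variable {A} in
theorem mem_tateW {p n : ℤ} {f : ℕ → A.obj.Tot} : f ∈ A.tateW p n ↔
    (∀ m, f m ∈ A.obj.fil p n) ∧ ∀ q, ∃ N, ∀ m, N ≤ m → f m ∈ A.obj.fil q n := Iff.rfl

/-- The coefficients of finitely many series in `tateW` tend to zero uniformly. -/
theorem exists_tate_bound {ι : Type*} [Finite ι] {f : ι → ℕ → A.obj.Tot} {w b : ι → ℤ}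
    (hf : ∀ i, f i ∈ A.tateW (w i) (b i)) (q : ι → ℤ) :
    ∃ N, ∀ i m, N ≤ m → f i m ∈ A.obj.fil (q i) (b i) := by
  have := Fintype.ofFinite ι
  choose N hN using fun i => (mem_tateW.1 (hf i)).2 (q i)
  exact ⟨Finset.univ.sup N, fun i m hm => hN i m ((Finset.le_sup (Finset.mem_univ i)).trans hm)⟩

/-- The operations on power series. -/
def tateAct (n : ℕ) : (P.obj n).Tot →ₗ[k]
    MultilinearMap k (fun _ : Fin n => ℕ → A.obj.Tot) (ℕ → A.obj.Tot) where
  toFun p := MultilinearMap.pi fun m => ∑ ι ∈ Finset.piAntidiag Finset.univ m,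
    (A.act n p).compLinearMap (fun i => LinearMap.proj (ι i))
  map_add' p q := by
    ext a m
    simp [Finset.sum_add_distrib]
  map_smul' c p := by
    ext a m
    simp [Finset.smul_sum]

theorem tateAct_apply (n : ℕ) (p : (P.obj n).Tot) (f : Fin n → ℕ → A.obj.Tot) (m : ℕ) :
    A.tateAct n p f m =
      ∑ ι ∈ Finset.piAntidiag Finset.univ m, A.act n p (fun i => f i (ι i)) := by
  simp [tateAct]

variable {A} in
theorem tateAct_mem_fil {n : ℕ} {v e q : ℤ} {w b : Fin n → ℤ} {p : (P.obj n).Tot}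
    {f : Fin n → ℕ → A.obj.Tot} (hp : p ∈ (P.obj n).fil v e)
    (hf : ∀ i, f i ∈ A.tateW (w i) (b i)) {N : ℕ}
    (hN : ∀ i m, N ≤ m → f i m ∈ A.obj.fil (q - v - ∑ j ∈ Finset.univ.erase i, w j) (b i)) (m : ℕ)
    (hm : n * N + 1 ≤ m) : A.tateAct n p f m ∈ A.obj.fil q (e + ∑ i, b i) := by
  rw [tateAct_apply]
  refine Submodule.sum_mem _ fun ι hι => ?_
  obtain ⟨i, hi⟩ : ∃ i, N ≤ ι i := by
    by_contra! h
    have h1 := Finset.sum_le_card_nsmul Finset.univ ι N fun i _ => (h i).le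
    rw [(Finset.mem_piAntidiag.1 hι).1, Finset.card_univ, Fintype.card_fin, smul_eq_mul] at h1
    omega
  exact A.act_mem_of_mem (w := w) hp (fun j => (hf j).1 _) i (hN i _ hi)

theorem tateAct_mem (n : ℕ) (v e : ℤ) (w b : Fin n → ℤ) (p : (P.obj n).Tot)
    (f : Fin n → ℕ → A.obj.Tot) (hp : p ∈ (P.obj n).fil v e)
    (hf : ∀ i, f i ∈ A.tateW (w i) (b i)) :
    A.tateAct n p f ∈ A.tateW (v + ∑ i, w i) (e + ∑ i, b i) := by
  refine ⟨fun m => ?_, fun q => ?_⟩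
  · rw [tateAct_apply]
    exact Submodule.sum_mem _ fun ι _ => A.act_mem n v e w b p _ hp fun i => (hf i).1 _
  · obtain ⟨N, hN⟩ := A.exists_tate_bound hf fun i => q - v - ∑ j ∈ Finset.univ.erase i, w j
    exact ⟨n * N + 1, tateAct_mem_fil hp hf hN⟩

theorem tate_update {n : ℕ} (f : Fin n → ℕ → A.obj.Tot) (ι : Fin n → ℕ) (i : Fin n)
    (g : ℕ → A.obj.Tot) : (fun j => Function.update f i g j (ι j)) =
      Function.update (fun j => f j (ι j)) i (g (ι i)) := by
  funext j
  rcases eq_or_ne j i with rfl | h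
  · simp
  · simp [h]

/-- The algebra of power series over `A` whose coefficients tend to zero, that is, the completed
tensor product of `A` with `k[t]`. -/
def tate : InternalAlgebra P (ℕ → A.obj.Tot) where
  W := A.tateW
  anti h n f hf := ⟨fun m => fil_anti h n (hf.1 m), hf.2⟩
  pr n := (A.obj.prTot n).compLeft ℕ
  pr_same {p n f} hf := by
    funext m
    exact prTot_of_mem_deg (fil_le_deg _ _ (hf.1 m))
  pr_ne {p m n f} h hf := by
    funext l
    exact prTot_of_mem_deg_ne h (fil_le_deg _ _ (hf.1 l))
  D := A.obj.dTot.compLeft ℕ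
  D_mem {p n f} hf := ⟨fun m => dTot_mem_fil (hf.1 m), fun q =>
    (hf.2 q).imp fun N hN m hm => dTot_mem_fil (hN m hm)⟩
  D_D {p n f} _ := by
    funext m
    exact dTot_dTot _
  complete n x hx hc := by
    choose y hy hyx using fun m => A.complete.exists_limit (n := n) (x := fun p => x p m)
      (fun p => (hx p).elim fun q hq => fil_le_deg _ _ (hq.1 m))
      (fun p q h => (hc p q h).1 m)
    refine ⟨y, fun p => ⟨fun m => hyx m p, fun q => ?_⟩⟩
    obtain ⟨N, hN⟩ := (hc p (max p q) (le_max_left _ _)).2 q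
    refine ⟨N, fun m hm => ?_⟩
    have := add_mem (fil_anti (le_max_right p q) n (hyx m (max p q))) (hN m hm)
    rwa [Pi.sub_apply, sub_add_sub_cancel] at this
  hausdorff n f hf := by
    funext m
    exact A.complete.eq_zero fun p => (hf p).1 m
  act := A.tateAct
  act_mem := A.tateAct_mem
  D_act n e w b p f hp hf := by
    funext m
    simp only [LinearMap.compLeft_apply, Function.comp_apply, tateAct_apply, Pi.add_apply,
      Finset.sum_apply, Pi.smul_apply, map_sum]
    have h : ∀ ι : Fin n → ℕ, A.obj.dTot (A.act n p fun i => f i (ι i)) = _ := fun ι =>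
      A.d_act n e b p (fun i => f i (ι i)) hp fun i => fil_le_deg _ _ ((hf i).1 _)
    simp only [h, Finset.sum_add_distrib]
    congr 1
    rw [Finset.sum_comm]
    refine Finset.sum_congr rfl fun i _ => ?_
    rw [Finset.smul_sum]
    refine Finset.sum_congr rfl fun ι _ => ?_
    rw [tate_update]
    rfl
  one_act p n f _ := by
    funext m
    rw [tateAct_apply]
    have : Finset.piAntidiag (Finset.univ : Finset (Fin 1)) m = {fun _ => m} := by
      ext ι
      rw [Finset.mem_piAntidiag, Finset.mem_singleton]
      constructor
      · rintro ⟨h, -⟩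
        funext i
        rw [Subsingleton.elim i 0]
        simpa using h
      · rintro rfl
        simp
    rw [this, Finset.sum_singleton]
    exact A.one_act _
  act_assoc {m} n b w c e p q f _ hq hf := by
    funext M
    rw [Pi.smul_apply, tateAct_apply, tateAct_apply]
    have h : ∀ μ : Fin m → ℕ, (A.act m p fun i => A.tateAct (n i) (q i) (f i) (μ i)) =
        ∑ l ∈ Fintype.piFinset fun i => Finset.piAntidiag Finset.univ (μ i),
          A.act m p fun i => A.act (n i) (q i) fun s => f i s (l i s) := by
      intro μ
      simp only [tateAct_apply]
      exact MultilinearMap.map_sum_finset _ _ _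
    simp only [h]
    rw [Finset.sum_sigma', Finset.smul_sum]
    symm
    refine Finset.sum_bij (fun x _ t => x.2 (blockIndex n t) (blockPos n t)) ?_ ?_ ?_ ?_
    · rintro ⟨μ, l⟩ hl
      simp only [Finset.mem_sigma, Finset.mem_piAntidiag, Fintype.mem_piFinset] at hl ⊢
      refine ⟨?_, by simp⟩
      rw [← sum_blockIndex n l, ← hl.1.1]
      exact Finset.sum_congr rfl fun i _ => (hl.2 i).1
    · rintro ⟨μ, l⟩ hl ⟨μ', l'⟩ hl' h
      simp only [Finset.mem_sigma, Finset.mem_piAntidiag, Fintype.mem_piFinset] at hl hl'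
      obtain rfl : l = l' := by
        funext i s
        have := congrFun h (finSigmaFinEquiv ⟨i, s⟩)
        exact (block_apply n l i s).symm.trans (this.trans (block_apply n l' i s))
      obtain rfl : μ = μ' := by
        funext i
        rw [← (hl.2 i).1, ← (hl'.2 i).1]
      rfl
    · intro κ hκ
      refine ⟨⟨fun i => ∑ s, κ (finSigmaFinEquiv ⟨i, s⟩), fun i s => κ (finSigmaFinEquiv ⟨i, s⟩)⟩,
        ?_, ?_⟩
      · simp only [Finset.mem_sigma, Finset.mem_piAntidiag, Fintype.mem_piFinset] at hκ ⊢
        refine ⟨⟨?_, by simp⟩, fun i => by simp⟩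
        rw [← sum_block n κ]
        exact hκ.1
      · funext t
        exact congrArg κ (finSigmaFinEquiv_block n t)
    · rintro ⟨μ, l⟩ _
      exact (A.act_assoc n b c p q (fun i s => f i s (l i s)) hq
        fun i s => fil_le_deg _ _ ((hf i s).1 _)).symm
  act_perm {m n} σ w b e p f _ hf := by
    funext M
    rw [Pi.smul_apply, tateAct_apply, tateAct_apply, Finset.smul_sum]
    refine Finset.sum_bij (fun ι _ i => ι (σ i)) ?_ ?_ ?_ ?_
    · intro ι hι
      simp only [Finset.mem_piAntidiag] at hι ⊢
      refine ⟨?_, by simp⟩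
      rw [← hι.1]
      exact Equiv.sum_comp σ ι
    · intro ι _ ι' _ h
      funext j
      have := congrFun h (σ.symm j)
      simpa using this
    · intro κ hκ
      simp only [Finset.mem_piAntidiag] at hκ
      refine ⟨fun j => κ (σ.symm j), ?_, ?_⟩
      · simp only [Finset.mem_piAntidiag]
        refine ⟨?_, by simp⟩
        rw [← hκ.1]
        exact Equiv.sum_comp σ.symm κ
      · funext i
        simp
    · intro ι _
      exact A.act_perm σ b p (fun j => f j (ι j)) fun j => fil_le_deg _ _ ((hf j).1 _)

end CompleteAlgebra

/-! ### Adjoining a differential form of degree one -/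

theorem LinearMap.map_intUnits_smul {k M N : Type*} [Ring k] [AddCommGroup M] [Module k M]
    [AddCommGroup N] [Module k N] (f : M →ₗ[k] N) (c : ℤˣ) (x : M) : f (c • x) = c • f x := by
  rw [Units.smul_def, Units.smul_def, map_zsmul]

theorem MultilinearMap.map_update_intUnits_smul {k ι M N : Type*} [Ring k] [AddCommGroup M]
    [Module k M] [AddCommGroup N] [Module k N] [DecidableEq ι]
    (f : MultilinearMap k (fun _ : ι => M) N) (a : ι → M) (i : ι) (c : ℤˣ) (x : M) :
    f (Function.update a i (c • x)) = c • f (Function.update a i x) := by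
  rcases Int.units_eq_one_or c with rfl | rfl
  · simp
  · simp

theorem Int.negOnePow_eq_of_even_sub {a b : ℤ} (h : Even (a - b)) : a.negOnePow = b.negOnePow :=
  (Int.negOnePow_eq_iff a b).2 h

namespace FilteredComplex

variable {k : Type u} [Field k] (V : FilteredComplex k)

/-- Multiplication by `(-1) ^ n` in degree `n`. -/
def parity : V.Tot →ₗ[k] V.Tot := DirectSum.lmap fun n => (((n.negOnePow : ℤ) : k) • LinearMap.id)

variable {V} in
theorem parity_apply {n : ℤ} {x : V.Tot} (hx : x ∈ V.deg n) : V.parity x = n.negOnePow • x := by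
  obtain ⟨y, rfl⟩ := mem_deg.1 hx
  rw [Units.smul_def, ← Int.cast_smul_eq_zsmul k, ← map_smul]
  exact DirectSum.lmap_lof _ _ _

end FilteredComplex

namespace InternalAlgebra

open FilteredComplex

variable {k : Type u} [Field k] {P : CompleteOperad k} {E : Type w} [AddCommGroup E] [Module k E]

/-- A derivation of degree and weight zero of an internally presented algebra, which commutes with
the differential, together with an extension `parity` to the ambient module of the operator
`(-1) ^ n` in degree `n`. -/
structure Derivation (I : InternalAlgebra P E) where
  der : E →ₗ[k] E
  der_mem : ∀ {p n : ℤ} {x : E}, x ∈ I.W p n → der x ∈ I.W p n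
  der_D : ∀ {p n : ℤ} {x : E}, x ∈ I.W p n → der (I.D x) = I.D (der x)
  der_act : ∀ (n : ℕ) (e : ℤ) (w b : Fin n → ℤ) (p : (P.obj n).Tot) (a : Fin n → E),
    p ∈ (P.obj n).deg e → (∀ i, a i ∈ I.W (w i) (b i)) →
      der (I.act n p a) = ∑ i, I.act n p (Function.update a i (der (a i)))
  parity : E →ₗ[k] E
  parity_apply : ∀ {p n : ℤ} {x : E}, x ∈ I.W p n → parity x = n.negOnePow • x

variable {I : InternalAlgebra P E} (δ : I.Derivation)

namespace Derivation

/-- The operations on `I ⊕ θ I`. Moving `θ` to the left through the operation and the arguments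
before it gives the parity operators. -/
def formAct (n : ℕ) : (P.obj n).Tot →ₗ[k]
    MultilinearMap k (fun _ : Fin n => E × E) (E × E) where
  toFun p := ((I.act n p).compLinearMap fun _ => LinearMap.fst k E E).prod
    (∑ i, (I.act n ((P.obj n).parity p)).compLinearMap fun j =>
      if j < i then δ.parity ∘ₗ LinearMap.fst k E E
      else if j = i then LinearMap.snd k E E else LinearMap.fst k E E)
  map_add' p q := by
    ext a
    · simp
    · simp [Finset.sum_add_distrib]
  map_smul' c p := by
    ext a
    · simp
    · simp [Finset.smul_sum]

theorem formAct_fst (n : ℕ) (p : (P.obj n).Tot) (x : Fin n → E × E) :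
    (δ.formAct n p x).1 = I.act n p fun i => (x i).1 := rfl

/-- The coefficient of `θ` on homogeneous arguments: each argument contributes its own `θ`, which is
moved to the left through the operation and the preceding arguments. -/
theorem formAct_snd {n : ℕ} {e : ℤ} {w b : Fin n → ℤ} {p : (P.obj n).Tot} (x : Fin n → E × E)
    (hp : p ∈ (P.obj n).deg e) (hx : ∀ i, (x i).1 ∈ I.W (w i) (b i)) :
    (δ.formAct n p x).2 = ∑ i, (e + ∑ j with j < i, b j).negOnePow •
      I.act n p (Function.update (fun i => (x i).1) i (x i).2) := by
  have h : (δ.formAct n p x).2 = ∑ i, I.act n ((P.obj n).parity p) fun j =>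
      (if j < i then δ.parity ∘ₗ LinearMap.fst k E E
      else if j = i then LinearMap.snd k E E else LinearMap.fst k E E) (x j) := by
    simp [formAct]
  rw [h]
  refine Finset.sum_congr rfl fun i _ => ?_
  have h1 : (fun j => (if j < i then δ.parity ∘ₗ LinearMap.fst k E E
      else if j = i then LinearMap.snd k E E else LinearMap.fst k E E) (x j)) =
      fun j => (if j < i then (((b j).negOnePow : ℤ) : k) else 1) •
        Function.update (fun i => (x i).1) i (x i).2 j := by
    funext j
    rcases lt_trichotomy j i with h | rfl | h
    · rw [if_pos h, if_pos h, Function.update_of_ne h.ne, Int.cast_smul_eq_zsmul,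
        ← Units.smul_def]
      exact δ.parity_apply (hx j)
    · rw [if_neg (lt_irrefl _), if_pos rfl, if_neg (lt_irrefl _), Function.update_self, one_smul]
      rfl
    · rw [if_neg h.not_gt, if_neg h.ne', if_neg h.not_gt, Function.update_of_ne h.ne', one_smul]
      rfl
  rw [h1, MultilinearMap.map_smul_univ, FilteredComplex.parity_apply hp, LinearMap.map_intUnits_smul,
    Int.negOnePow_add, Int.negOnePow_sum, Finset.prod_filter, mul_comm, mul_smul]
  have h2 : (∏ j, if j < i then (((b j).negOnePow : ℤ) : k) else 1) =
      (((∏ j, if j < i then (b j).negOnePow else 1 : ℤˣ) : ℤ) : k) := by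
    rw [Units.coe_prod, Int.cast_prod]
    refine Finset.prod_congr rfl fun j _ => ?_
    split_ifs <;> simp
  rw [h2, Int.cast_smul_eq_zsmul, ← Units.smul_def]
  rfl

/-- Elements of degree `n` of `I ⊕ θ I`, where `θ` has degree one and weight zero. -/
def formW (_ : I.Derivation) (p n : ℤ) : Submodule k (E × E) := (I.W p n).prod (I.W p (n - 1))

theorem update_mem {n : ℕ} {w b : Fin n → ℤ} {x : Fin n → E × E}
    (hx : ∀ i, x i ∈ δ.formW (w i) (b i)) (i j : Fin n) :
    Function.update (fun i => (x i).1) i (x i).2 j ∈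
      I.W (w j) (Function.update b i (b i - 1) j) := by
  rcases eq_or_ne j i with rfl | h
  · simp only [Function.update_self]
    exact (hx j).2
  · simp only [Function.update_of_ne h]
    exact (hx j).1

theorem sum_update_sub_one {n : ℕ} (b : Fin n → ℤ) (i : Fin n) :
    ∑ j, Function.update b i (b i - 1) j = ∑ j, b j - 1 := by
  rw [Finset.sum_update_of_mem (Finset.mem_univ i), ← Finset.erase_eq,
    ← Finset.add_sum_erase _ b (Finset.mem_univ i)]
  ring

theorem sum_lt_update {n : ℕ} (b : Fin n → ℤ) (i j : Fin n) (c : ℤ) :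
    ∑ l with l < j, Function.update b i (b i + c) l =
      ∑ l with l < j, b l + if i < j then c else 0 := by
  have h : ∀ l, Function.update b i (b i + c) l = b l + if l = i then c else 0 := by
    intro l
    rcases eq_or_ne l i with rfl | h
    · simp
    · simp [h]
  simp only [h, Finset.sum_add_distrib, Finset.sum_ite_eq', Finset.mem_filter, Finset.mem_univ,
    true_and]

theorem formAct_mem (n : ℕ) (v e : ℤ) (w b : Fin n → ℤ) (p : (P.obj n).Tot) (x : Fin n → E × E)
    (hp : p ∈ (P.obj n).fil v e) (hx : ∀ i, x i ∈ δ.formW (w i) (b i)) :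
    δ.formAct n p x ∈ δ.formW (v + ∑ i, w i) (e + ∑ i, b i) := by
  refine ⟨I.act_mem n v e w b p _ hp fun i => (hx i).1, ?_⟩
  rw [δ.formAct_snd x (fil_le_deg _ _ hp) fun i => (hx i).1]
  refine Submodule.sum_mem _ fun i _ => ?_
  have := I.act_mem n v e w _ p _ hp (δ.update_mem hx i)
  rw [sum_update_sub_one, ← add_sub_assoc] at this
  rw [Units.smul_def]
  exact zsmul_mem this _

/-- The differential of `I ⊕ θ I`, with `d a = D a + θ δ a` and `d (θ b) = - θ D b`. -/
def formD : E × E →ₗ[k] E × E :=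
  (I.D ∘ₗ LinearMap.fst k E E).prod
    (δ.der ∘ₗ LinearMap.fst k E E - I.D ∘ₗ LinearMap.snd k E E)

theorem formD_apply (x : E × E) : δ.formD x = (I.D x.1, δ.der x.1 - I.D x.2) := rfl

theorem formD_mem {p n : ℤ} {x : E × E} (hx : x ∈ δ.formW p n) : δ.formD x ∈ δ.formW p (n + 1) := by
  refine ⟨I.D_mem hx.1, ?_⟩
  have h := I.D_mem hx.2
  rw [sub_add_cancel] at h
  rw [formD_apply, add_sub_cancel_right]
  exact sub_mem (δ.der_mem hx.1) h

/-- The Leibniz rule for forms. In the coefficient of `θ`, the terms in which the differential acts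
on one argument and `θ` comes from another are double sums over the same pairs on both sides; their
signs agree because `D` and `θ` are both odd, as is reflected in the minus sign in `formD`. -/
theorem formD_act (n : ℕ) (e : ℤ) (w b : Fin n → ℤ) (p : (P.obj n).Tot) (x : Fin n → E × E)
    (hp : p ∈ (P.obj n).deg e) (hx : ∀ i, x i ∈ δ.formW (w i) (b i)) :
    δ.formD (δ.formAct n p x) = δ.formAct n ((P.obj n).dTot p) x +
      ∑ i, (e + ∑ j with j < i, b j).negOnePow •
        δ.formAct n p (Function.update x i (δ.formD (x i))) := by
  have hx₁ := fun i => (hx i).1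
  set s : Fin n → ℤˣ := fun i => (e + ∑ j with j < i, b j).negOnePow with hs
  set α : Fin n → E := fun i => (x i).1 with hα
  set β : Fin n → E := fun i => (x i).2 with hβ
  have hfst : ∀ (i : Fin n) (y : E × E), (fun j => (Function.update x i y j).1) =
      Function.update α i y.1 := by
    intro i y
    funext j
    rw [Function.apply_update (fun _ => Prod.fst)]
  refine Prod.ext ?_ ?_
  · rw [formD_apply, Prod.fst_add, Prod.fst_sum, formAct_fst, formAct_fst,
      I.D_act n e w b p _ hp hx₁]
    refine congrArg (_ + ·) (Finset.sum_congr rfl fun i _ => ?_)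
    refine Eq.trans ?_ (congrArg (fun z : E => (e + ∑ j with j < i, b j).negOnePow • z)
      (congrArg (I.act n p) (hfst i _).symm))
    rfl
  have hL : ∀ i, I.D (I.act n p (Function.update α i (β i))) =
      I.act n ((P.obj n).dTot p) (Function.update α i (β i)) +
        (s i • I.act n p (Function.update α i (I.D (β i))) +
          ∑ j ∈ Finset.univ.erase i, (s j * (if i < j then -1 else 1 : ℤˣ)) •
            I.act n p (Function.update (Function.update α i (β i)) j (I.D (α j)))) := by
    intro i
    rw [I.D_act n e w _ p _ hp (δ.update_mem hx i), ← Finset.add_sum_erase _ _ (Finset.mem_univ i)]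
    have hsg : ∀ j, (e + ∑ l with l < j, Function.update b i (b i - 1) l).negOnePow =
        s j * (if i < j then -1 else 1 : ℤˣ) := by
      intro j
      rw [sub_eq_add_neg, sum_lt_update, ← add_assoc, Int.negOnePow_add]
      congr 1
      split_ifs <;> simp
    congr 2
    · rw [hsg, if_neg (lt_irrefl _), mul_one, Function.update_self, Function.update_idem]
    · refine Finset.sum_congr rfl fun j hj => ?_
      rw [hsg, Function.update_of_ne (Finset.ne_of_mem_erase hj)]
  have hR : ∀ i, (δ.formAct n p (Function.update x i (δ.formD (x i)))).2 =
      s i • I.act n p (Function.update α i (δ.der (α i) - I.D (β i))) +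
        ∑ j ∈ Finset.univ.erase i, (s j * (if i < j then -1 else 1 : ℤˣ)) •
            I.act n p (Function.update (Function.update α i (I.D (α i))) j (β j)) := by
    intro i
    rw [δ.formAct_snd (w := w) (b := Function.update b i (b i + 1)) _ hp (fun j => by
      rcases eq_or_ne j i with rfl | h
      · simp only [Function.update_self]
        exact I.D_mem (hx₁ j)
      · simp only [Function.update_of_ne h]
        exact hx₁ j), ← Finset.add_sum_erase _ _ (Finset.mem_univ i)]
    have hsg : ∀ j, (e + ∑ l with l < j, Function.update b i (b i + 1) l).negOnePow =
        s j * (if i < j then -1 else 1 : ℤˣ) := by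
      intro j
      rw [sum_lt_update, ← add_assoc, Int.negOnePow_add]
      congr 1
      split_ifs <;> simp
    rw [hfst]
    congr 1
    · rw [hsg, if_neg (lt_irrefl _), mul_one, Function.update_self, Function.update_idem]
      rfl
    · refine Finset.sum_congr rfl fun j hj => ?_
      rw [hsg, Function.update_of_ne (Finset.ne_of_mem_erase hj)]
      rfl
  have hLHS : (δ.formD (δ.formAct n p x)).2 =
      ∑ i, I.act n p (Function.update α i (δ.der (α i))) -
        ∑ i, s i • I.D (I.act n p (Function.update α i (β i))) := by
    rw [formD_apply, formAct_fst, δ.formAct_snd x hp hx₁, δ.der_act n e w b p _ hp hx₁, map_sum]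
    simp only [LinearMap.map_intUnits_smul]
    rfl
  have hRHS : (δ.formAct n ((P.obj n).dTot p) x + ∑ i, (e + ∑ j with j < i, b j).negOnePow •
        δ.formAct n p (Function.update x i (δ.formD (x i)))).2 =
      ∑ i, (e + 1 + ∑ j with j < i, b j).negOnePow •
        I.act n ((P.obj n).dTot p) (Function.update α i (β i)) +
        ∑ i, s i • (δ.formAct n p (Function.update x i (δ.formD (x i)))).2 := by
    rw [Prod.snd_add, Prod.snd_sum, δ.formAct_snd x (dTot_mem_deg hp) hx₁]
    rfl
  rw [hLHS, hRHS]
  simp only [hR, hL]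
  have hss : ∀ i, s i * s i = 1 := fun i => Int.units_mul_self _
  simp only [MultilinearMap.map_update_sub, smul_add, smul_sub, smul_smul, hss, one_smul,
    Finset.sum_add_distrib, Finset.sum_sub_distrib, Finset.smul_sum]
  have h1 : ∑ i, (e + 1 + ∑ j with j < i, b j).negOnePow •
      I.act n ((P.obj n).dTot p) (Function.update α i (β i)) =
      - ∑ i, s i • I.act n ((P.obj n).dTot p) (Function.update α i (β i)) := by
    rw [← Finset.sum_neg_distrib]
    refine Finset.sum_congr rfl fun i _ => ?_
    rw [add_right_comm, Int.negOnePow_succ, Units.neg_smul]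
  have h2 : ∑ i, ∑ j ∈ Finset.univ.erase i, (s i * (s j * (if i < j then -1 else 1 : ℤˣ))) •
      I.act n p (Function.update (Function.update α i (I.D (α i))) j (β j)) =
      - ∑ i, ∑ j ∈ Finset.univ.erase i, (s i * (s j * (if i < j then -1 else 1 : ℤˣ))) •
        I.act n p (Function.update (Function.update α i (β i)) j (I.D (α j))) := by
    rw [← Finset.sum_neg_distrib]
    rw [Finset.sum_comm' (t' := Finset.univ) (s' := fun i => Finset.univ.erase i)
      (by simp [eq_comm])]
    refine Finset.sum_congr rfl fun i _ => ?_
    rw [← Finset.sum_neg_distrib]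
    refine Finset.sum_congr rfl fun j hj => ?_
    have hji := Finset.ne_of_mem_erase hj
    rw [Function.update_comm hji, ← Units.neg_smul]
    congr 1
    rcases lt_or_gt_of_ne hji with h | h
    · simp [h, h.not_gt, mul_comm]
    · simp [h, h.not_gt, mul_comm]
  rw [h1, h2]
  abel

/-- Equivariance for forms: in the coefficient of `θ`, equivariance in `I` with one degree lowered
by one. -/
theorem formAct_perm {m n : ℕ} (σ : Fin m ≃ Fin n) (w b : Fin n → ℤ) (e : ℤ)
    (p : (P.obj m).Tot) (x : Fin n → E × E) (hp : p ∈ (P.obj m).deg e)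
    (hx : ∀ j, x j ∈ δ.formW (w j) (b j)) :
    δ.formAct n (totMap (P.perm σ) p) x = koszulSign σ b • δ.formAct m p (fun i => x (σ i)) := by
  have hx₁ := fun i => (hx i).1
  refine Prod.ext (I.act_perm σ w b e p _ hp hx₁) ?_
  rw [Prod.smul_snd, δ.formAct_snd _ (totMap_mem_deg _ hp) hx₁,
    δ.formAct_snd _ hp fun i => hx₁ (σ i), Finset.smul_sum]
  symm
  refine Fintype.sum_equiv σ _ _ fun i => ?_
  rw [I.act_perm σ w _ e p _ hp (δ.update_mem hx (σ i)), smul_smul, smul_smul, Int.negOnePow_add,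
    Int.negOnePow_add, mul_assoc, mul_comm _ (koszulSign σ (Function.update _ _ _)),
    koszulSign_update, mul_left_comm]
  congr 2
  funext j
  rcases eq_or_ne j i with rfl | h
  · simp
  · rw [Function.update_of_ne h, Function.update_of_ne (σ.injective.ne h)]

/-- Associativity for forms. In the coefficient of `θ` both sides are sums over the arguments
`x i s`, and each summand is associativity in `I` with the degree of `x i s` lowered by one. -/
theorem formAct_assoc {m : ℕ} (n : Fin m → ℕ) (b : Fin m → ℤ) (w c : ∀ i, Fin (n i) → ℤ) (e : ℤ)
    (p : (P.obj m).Tot) (q : ∀ i, (P.obj (n i)).Tot) (x : ∀ i, Fin (n i) → E × E)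
    (hp : p ∈ (P.obj m).deg e) (hq : ∀ i, q i ∈ (P.obj (n i)).deg (b i))
    (hx : ∀ i s, x i s ∈ δ.formW (w i s) (c i s)) :
    δ.formAct (∑ i, n i) (P.comp n p q) (fun t => x (blockIndex n t) (blockPos n t)) =
      shuffleSign b (fun i => ∑ s, c i s) • δ.formAct m p (fun i => δ.formAct (n i) (q i) (x i)) := by
  have hx₁ := fun i s => (hx i s).1
  refine Prod.ext (I.act_assoc n b w c e p q _ hp hq hx₁) ?_
  obtain ⟨v, hv⟩ := exists_mem_fil hp
  choose u hu using fun i => exists_mem_fil (hq i)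
  have hpq : P.comp n p q ∈ (P.obj (∑ i, n i)).deg (e + ∑ i, b i) :=
    fil_le_deg _ _ (P.comp_mem n v e u b p q hv hu)
  rw [Prod.smul_snd, δ.formAct_snd _ hpq fun t => hx₁ _ _,
    δ.formAct_snd (w := fun i => u i + ∑ s, w i s) (b := fun i => b i + ∑ s, c i s) _ hp
      fun i => I.act_mem (n i) (u i) (b i) (w i) (c i) (q i) _ (hu i) (hx₁ i),
    sum_block, Finset.smul_sum]
  refine Finset.sum_congr rfl fun i _ => ?_
  rw [δ.formAct_snd (x i) (hq i) (hx₁ i), MultilinearMap.map_update_sum, Finset.smul_sum,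
    Finset.smul_sum]
  refine Finset.sum_congr rfl fun s _ => ?_
  have hflat : Function.update (fun t => (x (blockIndex n t) (blockPos n t)).1)
      (finSigmaFinEquiv ⟨i, s⟩) (x (blockIndex n (finSigmaFinEquiv ⟨i, s⟩))
        (blockPos n (finSigmaFinEquiv ⟨i, s⟩))).2 =
      fun t => Function.update (fun i s => (x i s).1) i
        (Function.update (fun s => (x i s).1) s (x i s).2) (blockIndex n t) (blockPos n t) := by
    funext t
    obtain ⟨⟨j, r⟩, rfl⟩ := finSigmaFinEquiv.surjective t
    rw [block_apply n (Function.update (fun i s => (x i s).1) i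
        (Function.update (fun s => (x i s).1) s (x i s).2))]
    rcases eq_or_ne j i with rfl | h
    · rw [Function.update_self]
      rcases eq_or_ne r s with rfl | h
      · rw [Function.update_self, Function.update_self]
        exact congrArg Prod.snd (block_apply n x j r)
      · rw [Function.update_of_ne h, Function.update_of_ne (by simpa using h)]
        exact congrArg Prod.fst (block_apply n x j r)
    · have h' : finSigmaFinEquiv ⟨j, r⟩ ≠ finSigmaFinEquiv ⟨i, s⟩ := fun h' =>
        h (congrArg Sigma.fst (finSigmaFinEquiv.injective h'))
      rw [Function.update_of_ne h, Function.update_of_ne h']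
      exact congrArg Prod.fst (block_apply n x j r)
  have hsum : (fun j => ∑ r, Function.update c i (Function.update (c i) s (c i s - 1)) j r) =
      Function.update (fun j => ∑ r, c j r) i (∑ r, c i r - 1) := by
    funext j
    rcases eq_or_ne j i with rfl | h
    · rw [Function.update_self, Function.update_self, sum_update_sub_one]
    · rw [Function.update_of_ne h, Function.update_of_ne h]
  have hact := (congrArg (I.act _ (P.comp n p q)) hflat).trans
    (I.act_assoc n b w (Function.update c i (Function.update (c i) s (c i s - 1))) e p q _
    hp hq (fun j r => by
      rcases eq_or_ne j i with rfl | h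
      · rw [Function.update_self, Function.update_self]
        exact δ.update_mem (hx j) s r
      · rw [Function.update_of_ne h, Function.update_of_ne h]
        exact hx₁ j r))
  refine (congrArg (fun z : E => (_ : ℤˣ) • z) hact).trans ?_
  rw [hsum, shuffleSign_update, MultilinearMap.map_update_intUnits_smul,
    smul_smul, smul_smul, smul_smul, sum_lt_block]
  have harg : (fun j => I.act (n j) (q j) (Function.update (fun i s => (x i s).1) i
      (Function.update (fun s => (x i s).1) s (x i s).2) j)) =
      Function.update (fun j => (δ.formAct (n j) (q j) (x j)).1) i
        (I.act (n i) (q i) (Function.update (fun s => (x i s).1) s (x i s).2)) := by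
    funext j
    rcases eq_or_ne j i with rfl | h
    · rw [Function.update_self, Function.update_self]
    · rw [Function.update_of_ne h, Function.update_of_ne h]
      rfl
  rw [harg]
  congr 1
  rw [mul_left_comm, mul_assoc, ← Int.negOnePow_add, ← Int.negOnePow_add]
  congr 1
  refine Int.negOnePow_eq_of_even_sub ?_
  have hb : ∑ j, b j = ∑ j with j < i, b j + b i + ∑ j with i < j, b j := by
    simp only [Finset.sum_filter]
    rw [← Finset.sum_ite_eq' Finset.univ i b |>.trans (if_pos (Finset.mem_univ i)),
      ← Finset.sum_add_distrib, ← Finset.sum_add_distrib]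
    refine Finset.sum_congr rfl fun j _ => ?_
    rcases lt_trichotomy j i with h | rfl | h
    · simp [h, h.ne, h.not_gt]
    · simp
    · simp [h, h.ne', h.not_gt]
  rw [hb, Finset.sum_add_distrib]
  refine ⟨∑ j with i < j, b j, ?_⟩
  ring

/-- The algebra `I ⊕ θ I` with `d a = D a + θ δ a`. For power series in `t` and `δ = d / dt`, where
`θ = dt`, these are the differential forms on the line with coefficients in `I`. -/
def forms : InternalAlgebra P (E × E) where
  W := δ.formW
  anti h n _ hx := ⟨I.anti h n hx.1, I.anti h (n - 1) hx.2⟩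
  pr n := (I.pr n).prodMap (I.pr (n - 1))
  pr_same hx := Prod.ext (I.pr_same hx.1) (I.pr_same hx.2)
  pr_ne h hx := Prod.ext (I.pr_ne h hx.1) (I.pr_ne (fun h' => h (by omega)) hx.2)
  D := δ.formD
  D_mem := δ.formD_mem
  D_D {p n x} hx := by
    rw [formD_apply, formD_apply]
    refine Prod.ext (I.D_D hx.1) ?_
    change δ.der (I.D x.1) - I.D (δ.der x.1 - I.D x.2) = 0
    rw [map_sub, I.D_D hx.2, δ.der_D hx.1, sub_zero, sub_self]
  complete n x hx hc := by
    obtain ⟨y, hy⟩ := I.complete n (fun p => (x p).1) (fun p => (hx p).imp fun _ h => h.1)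
      fun p q h => (hc p q h).1
    obtain ⟨z, hz⟩ := I.complete (n - 1) (fun p => (x p).2) (fun p => (hx p).imp fun _ h => h.2)
      fun p q h => (hc p q h).2
    exact ⟨(y, z), fun p => ⟨hy p, hz p⟩⟩
  hausdorff n x hx := Prod.ext (I.hausdorff n _ fun p => (hx p).1)
    (I.hausdorff (n - 1) _ fun p => (hx p).2)
  act := δ.formAct
  act_mem := δ.formAct_mem
  D_act := δ.formD_act
  one_act p n x hx := by
    refine Prod.ext (I.one_act p n _ hx.1) ?_
    have hone := fil_le_deg _ _ P.one_mem
    rw [δ.formAct_snd (w := fun _ => p) (b := fun _ => n) _ hone fun _ => hx.1]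
    have h : ∀ y : E, Function.update (fun _ : Fin 1 => x.1) 0 y = fun _ => y := by
      intro y
      funext i
      rw [Subsingleton.elim i 0, Function.update_self]
    simp only [Finset.univ_unique, Finset.sum_singleton, Fin.default_eq_zero, h]
    rw [I.one_act p (n - 1) _ hx.2]
    simp
  act_assoc := δ.formAct_assoc
  act_perm := δ.formAct_perm

end Derivation
end InternalAlgebra

/-! ### Differentiation and summation of convergent power series -/

/-- A submodule of a product that is the graph of a partial map is contained in the graph of a
linear map defined everywhere. -/
theorem Submodule.exists_linearMap_of_graph {k E M : Type*} [Field k] [AddCommGroup E] [Module k E]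
    [AddCommGroup M] [Module k M] (G : Submodule k (E × M))
    (hG : ∀ x ∈ G, x.1 = 0 → x.2 = 0) : ∃ χ : E →ₗ[k] M, ∀ x ∈ G, χ x.1 = x.2 := by
  obtain ⟨χ, hχ⟩ := LinearMap.exists_extend G.toLinearPMap.toFun
  refine ⟨χ, fun x hx => ?_⟩
  have h1 : x.1 ∈ G.map (LinearMap.fst k E M) := ⟨x, hx, rfl⟩
  have h2 := G.mem_graph_toLinearPMap hG ⟨x.1, h1⟩
  have h3 : χ x.1 = G.toLinearPMap ⟨x.1, h1⟩ := congrArg (fun g => g ⟨x.1, h1⟩) hχ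
  have h4 := hG _ (sub_mem h2 hx) (sub_self _)
  rw [h3]
  exact sub_eq_zero.1 h4

/-- The reindexing behind the Leibniz rule for `d/dt`: differentiating the factor `i` of a product
of power series. -/
theorem Finset.sum_piAntidiag_update {n : ℕ} {M : Type*} [AddCommMonoid M] (m : ℕ) (i : Fin n)
    (G : (Fin n → ℕ) → M) :
    ∑ ι ∈ Finset.piAntidiag Finset.univ m, (ι i + 1) • G (Function.update ι i (ι i + 1)) =
      ∑ ι ∈ Finset.piAntidiag Finset.univ (m + 1), ι i • G ι := by
  have hsum : ∀ (ι : Fin n → ℕ) (l : ℕ),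
      (∑ j, Function.update ι i l j) + ι i = (∑ j, ι j) + l := by
    intro ι l
    rw [Finset.sum_update_of_mem (Finset.mem_univ i), ← Finset.erase_eq,
      ← Finset.add_sum_erase _ ι (Finset.mem_univ i)]
    omega
  refine Finset.sum_of_injOn (fun ι => Function.update ι i (ι i + 1)) ?_ ?_ ?_ ?_
  · intro ι _ ι' _ h
    have h' : ∀ j, _ := fun j => congrFun h j
    funext j
    have hj := h' j
    rcases eq_or_ne j i with rfl | hji
    · simpa using hj
    · simpa [hji] using hj
  · intro ι hι
    rw [Finset.mem_coe, Finset.mem_piAntidiag] at hι ⊢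
    have h1 := hsum ι (ι i + 1)
    have h2 : ∑ j, ι j = m := hι.1
    exact ⟨by change ∑ j, Function.update ι i (ι i + 1) j = m + 1; omega, by simp⟩
  · intro κ hκ hκ'
    rcases Nat.eq_zero_or_pos (κ i) with h | h
    · rw [h, zero_smul]
    · refine absurd ⟨Function.update κ i (κ i - 1), ?_, ?_⟩ hκ'
      · rw [Finset.mem_coe, Finset.mem_piAntidiag]
        rw [Finset.mem_piAntidiag] at hκ
        have h1 := hsum κ (κ i - 1)
        have h2 : ∑ j, κ j = m + 1 := hκ.1
        exact ⟨by change ∑ j, Function.update κ i (κ i - 1) j = m; omega, by simp⟩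
      · simp [Nat.sub_add_cancel h]
  · intro ι _
    simp

namespace CompleteAlgebra

open FilteredComplex

variable {k : Type u} [Field k] {P : CompleteOperad k} (A : CompleteAlgebra P)

/-- The derivative `d / dt` of power series. -/
def tateDer : (ℕ → A.obj.Tot) →ₗ[k] (ℕ → A.obj.Tot) :=
  LinearMap.pi fun m => (m + 1) • LinearMap.proj (m + 1)

theorem tateDer_apply (f : ℕ → A.obj.Tot) (m : ℕ) : A.tateDer f m = (m + 1) • f (m + 1) := by
  simp [tateDer]

/-- Differentiation of power series, as a derivation of the algebra of power series. -/
def tateDerivation : A.tate.Derivation where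
  der := A.tateDer
  der_mem {p n f} hf := by
    refine ⟨fun m => ?_, fun q => ?_⟩
    · rw [tateDer_apply]
      exact nsmul_mem (hf.1 _) _
    · obtain ⟨N, hN⟩ := hf.2 q
      refine ⟨N, fun m hm => ?_⟩
      rw [tateDer_apply]
      exact nsmul_mem (hN _ (by omega)) _
  der_D {p n f} _ := by
    funext m
    change A.tateDer (fun m => A.obj.dTot (f m)) m = A.obj.dTot (A.tateDer f m)
    rw [tateDer_apply, tateDer_apply, map_nsmul]
  der_act n e w b p f hp hf := by
    funext m
    change A.tateDer (A.tateAct n p f) m = (∑ i, A.tateAct n p _) m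
    rw [tateDer_apply, tateAct_apply, Finset.sum_apply]
    have h : ∀ i, A.tateAct n p (Function.update f i (A.tateDer (f i))) m =
        ∑ ι ∈ Finset.piAntidiag Finset.univ (m + 1), ι i • A.act n p (fun j => f j (ι j)) := by
      intro i
      rw [tateAct_apply, ← Finset.sum_piAntidiag_update m i fun ι => A.act n p fun j => f j (ι j)]
      refine Finset.sum_congr rfl fun ι _ => ?_
      have h1 : (fun j => f j (Function.update ι i (ι i + 1) j)) =
          Function.update (fun j => f j (ι j)) i (f i (ι i + 1)) := by
        funext j
        rcases eq_or_ne j i with rfl | h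
        · simp
        · simp [h]
      rw [tate_update, tateDer_apply, h1, ← Nat.cast_smul_eq_nsmul k,
        MultilinearMap.map_update_smul, Nat.cast_smul_eq_nsmul]
    rw [Finset.sum_congr rfl fun i _ => h i, Finset.sum_comm, Finset.smul_sum]
    refine Finset.sum_congr rfl fun ι hι => ?_
    rw [← Finset.sum_smul, (Finset.mem_piAntidiag.1 hι).1]
  parity := A.obj.parity.compLeft ℕ
  parity_apply {p n f} hf := by
    funext m
    exact parity_apply (fil_le_deg _ _ (hf.1 m))

variable {A}

theorem sum_range_sub_mem {f : ℕ → A.obj.Tot} {q n : ℤ} {N M : ℕ}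
    (hN : ∀ m, N ≤ m → f m ∈ A.obj.fil q n) (h : N ≤ M) :
    ∑ m ∈ Finset.range M, f m - ∑ m ∈ Finset.range N, f m ∈ A.obj.fil q n := by
  rw [Finset.sum_range_sub_sum_range h]
  exact Submodule.sum_mem _ fun m hm => hN m (Finset.mem_filter.1 hm).2

/-- The coefficients of a series in `tateW` are summable, by completeness. -/
theorem exists_tateSum {p n : ℤ} {f : ℕ → A.obj.Tot} (hf : f ∈ A.tateW p n) :
    ∃ y ∈ A.obj.fil p n, ∀ q N, (∀ m, N ≤ m → f m ∈ A.obj.fil q n) →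
      y - ∑ m ∈ Finset.range N, f m ∈ A.obj.fil q n := by
  choose N hN using hf.2
  have key : ∀ (q q' : ℤ) (M M' : ℕ), (∀ m, M ≤ m → f m ∈ A.obj.fil q n) →
      (∀ m, M' ≤ m → f m ∈ A.obj.fil q' n) → q ≤ q' →
      ∑ m ∈ Finset.range M', f m - ∑ m ∈ Finset.range M, f m ∈ A.obj.fil q n := by
    intro q q' M M' h h' hqq
    have := sub_mem (sum_range_sub_mem h (le_max_left M M'))
      (fil_anti hqq n (sum_range_sub_mem h' (le_max_right M M')))
    rwa [sub_sub_sub_cancel_left] at this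
  have hS : ∀ M, ∑ m ∈ Finset.range M, f m ∈ A.obj.fil p n := fun M =>
    Submodule.sum_mem _ fun m _ => hf.1 m
  obtain ⟨y, -, hy⟩ := A.complete.exists_limit (x := fun q => ∑ m ∈ Finset.range (N q), f m)
    (fun q => fil_le_deg _ _ (hS _)) (fun q q' h => key q q' _ _ (hN q) (hN q') h)
  refine ⟨y, ?_, fun q M hM => ?_⟩
  · have := add_mem (hy p) (hS (N p))
    rwa [sub_add_cancel] at this
  · have := add_mem (hy q) (key q q M (N q) hM (hN q) le_rfl)
    rwa [sub_add_sub_cancel] at this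

variable (A) in
/-- Summation of convergent series as a linear map, with an arbitrary extension to the sequences
that do not converge. -/
theorem exists_tateSum_linearMap : ∃ χ : (ℕ → A.obj.Tot) →ₗ[k] A.obj.Tot,
    ∀ p n, ∀ f ∈ A.tateW p n, χ f ∈ A.obj.fil p n ∧
      ∀ q N, (∀ m, N ≤ m → f m ∈ A.obj.fil q n) →
        χ f - ∑ m ∈ Finset.range N, f m ∈ A.obj.fil q n := by
  -- the graph of summation, in all degrees at once
  let G : Submodule k ((ℕ → A.obj.Tot) × A.obj.Tot) :=
    { carrier := {x | ∀ n q, ∃ N, ∀ M, N ≤ M →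
        A.obj.prTot n (x.2 - ∑ m ∈ Finset.range M, x.1 m) ∈ A.obj.fil q n}
      add_mem' := by
        intro x y hx hy n q
        obtain ⟨N, hN⟩ := hx n q
        obtain ⟨N', hN'⟩ := hy n q
        refine ⟨max N N', fun M hM => ?_⟩
        have := add_mem (hN M (le_of_max_le_left hM)) (hN' M (le_of_max_le_right hM))
        rw [← map_add] at this
        convert this using 2
        simp only [Prod.fst_add, Prod.snd_add, Pi.add_apply, Finset.sum_add_distrib]
        abel
      zero_mem' := fun n q => ⟨0, fun M _ => by simp⟩
      smul_mem' := by
        intro c x hx n q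
        obtain ⟨N, hN⟩ := hx n q
        refine ⟨N, fun M hM => ?_⟩
        have := Submodule.smul_mem _ c (hN M hM)
        rw [← map_smul] at this
        convert this using 2
        simp only [Prod.smul_fst, Prod.smul_snd, Pi.smul_apply, ← Finset.smul_sum, smul_sub] }
  obtain ⟨χ, hχ⟩ := G.exists_linearMap_of_graph (by
    rintro ⟨f, y⟩ hx (rfl : f = 0)
    refine ext_coord fun n => ?_
    apply inj_injective n
    rw [map_zero, map_zero]
    refine A.complete.eq_zero (n := n) fun q => ?_
    obtain ⟨N, hN⟩ := hx n q
    have h := hN N le_rfl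
    simp only [Pi.zero_apply, Finset.sum_const_zero, sub_zero] at h
    exact h)
  refine ⟨χ, fun p n f hf => ?_⟩
  obtain ⟨y, hy, hy'⟩ := exists_tateSum hf
  have hG : (f, y) ∈ G := by
    intro l q
    rcases eq_or_ne l n with rfl | h
    · obtain ⟨N, hN⟩ := hf.2 q
      refine ⟨N, fun M hM => ?_⟩
      have := hy' q M fun m hm => hN m (hM.trans hm)
      rwa [prTot_of_mem_deg (fil_le_deg _ _ this)]
    · refine ⟨0, fun M _ => ?_⟩
      have : y - ∑ m ∈ Finset.range M, f m ∈ A.obj.deg n :=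
        sub_mem (fil_le_deg _ _ hy) (Submodule.sum_mem _ fun m _ => fil_le_deg _ _ (hf.1 m))
      rw [prTot_of_mem_deg_ne h this]
      exact zero_mem _
  have h := hχ _ hG
  rw [show χ f = y from h]
  exact ⟨hy, hy'⟩

variable (A) in
/-- The value of a convergent power series at `t = 1`. -/
def tateSum : (ℕ → A.obj.Tot) →ₗ[k] A.obj.Tot := A.exists_tateSum_linearMap.choose

theorem tateSum_mem {p n : ℤ} {f : ℕ → A.obj.Tot} (hf : f ∈ A.tateW p n) :
    A.tateSum f ∈ A.obj.fil p n := (A.exists_tateSum_linearMap.choose_spec p n f hf).1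

theorem tateSum_sub_mem {p q n : ℤ} {f : ℕ → A.obj.Tot} (hf : f ∈ A.tateW p n) {N : ℕ}
    (hN : ∀ m, N ≤ m → f m ∈ A.obj.fil q n) :
    A.tateSum f - ∑ m ∈ Finset.range N, f m ∈ A.obj.fil q n :=
  (A.exists_tateSum_linearMap.choose_spec p n f hf).2 q N hN

theorem tateSum_eq {p n : ℤ} {f : ℕ → A.obj.Tot} (hf : f ∈ A.tateW p n) {y : A.obj.Tot}
    (hy : ∀ q, ∃ N, (∀ m, N ≤ m → f m ∈ A.obj.fil q n) ∧
      y - ∑ m ∈ Finset.range N, f m ∈ A.obj.fil q n) : A.tateSum f = y := by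
  rw [← sub_eq_zero]
  refine A.complete.eq_zero (n := n) fun q => ?_
  obtain ⟨N, hN, hyN⟩ := hy q
  have := sub_mem (tateSum_sub_mem hf hN) hyN
  rwa [sub_sub_sub_cancel_right] at this

theorem tateSum_dTot {p n : ℤ} {f : ℕ → A.obj.Tot} (hf : f ∈ A.tateW p n) :
    A.tateSum (A.tate.D f) = A.obj.dTot (A.tateSum f) := by
  refine tateSum_eq (A.tate.D_mem hf) fun q => ?_
  obtain ⟨N, hN⟩ := hf.2 q
  refine ⟨N, fun m hm => dTot_mem_fil (hN m hm), ?_⟩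
  have := dTot_mem_fil (tateSum_sub_mem hf hN)
  rw [map_sub, map_sum] at this
  exact this

/-- Evaluation at `t = 1` is compatible with the operations: modulo a given step of the filtration
both sides are finite sums. -/
theorem tateSum_act {n : ℕ} {v e : ℤ} {w b : Fin n → ℤ} {p : (P.obj n).Tot}
    {f : Fin n → ℕ → A.obj.Tot} (hp : p ∈ (P.obj n).fil v e)
    (hf : ∀ i, f i ∈ A.tateW (w i) (b i)) :
    A.tateSum (A.tateAct n p f) = A.act n p (fun i => A.tateSum (f i)) := by
  refine tateSum_eq (A.tateAct_mem n v e w b p f hp hf) fun q => ?_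
  obtain ⟨N, hN⟩ := A.exists_tate_bound hf fun i => q - v - ∑ j ∈ Finset.univ.erase i, w j
  refine ⟨n * N + 1, tateAct_mem_fil hp hf hN, ?_⟩
  let S : Fin n → A.obj.Tot := fun i => ∑ m ∈ Finset.range N, f i m
  have hS : ∀ i, S i ∈ A.obj.fil (w i) (b i) := fun i =>
    Submodule.sum_mem _ fun m _ => (hf i).1 m
  have h1 := A.act_add_sub_mem (a := S) (z := fun i => A.tateSum (f i) - S i) hp hS
    (fun i => sub_mem (tateSum_mem (hf i)) (hS i)) (fun i => tateSum_sub_mem (hf i) (hN i))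
  have h2 : (S + fun i => A.tateSum (f i) - S i) = fun i => A.tateSum (f i) := by
    funext i
    simp
  have h3 : A.act n p S = ∑ ι ∈ Fintype.piFinset fun _ => Finset.range N,
      A.act n p fun i => f i (ι i) := MultilinearMap.map_sum_finset _ _ _
  have h4 : ∑ m ∈ Finset.range (n * N + 1), A.tateAct n p f m =
      ∑ ι ∈ (Finset.range (n * N + 1)).biUnion (Finset.piAntidiag Finset.univ),
        A.act n p fun i => f i (ι i) := by
    rw [Finset.sum_biUnion]
    · exact Finset.sum_congr rfl fun m _ => A.tateAct_apply n p f m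
    · intro m _ m' _ h
      rw [Function.onFun, Finset.disjoint_left]
      intro ι hι hι'
      exact h ((Finset.mem_piAntidiag.1 hι).1.symm.trans (Finset.mem_piAntidiag.1 hι').1)
  have h5 : (Fintype.piFinset fun _ => Finset.range N) ⊆
      (Finset.range (n * N + 1)).biUnion (Finset.piAntidiag (Finset.univ : Finset (Fin n))) := by
    intro ι hι
    rw [Fintype.mem_piFinset] at hι
    rw [Finset.mem_biUnion]
    have h := Finset.sum_le_card_nsmul Finset.univ ι N fun i _ => (Finset.mem_range.1 (hι i)).le
    rw [Finset.card_univ, Fintype.card_fin, smul_eq_mul] at h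
    exact ⟨∑ i, ι i, Finset.mem_range.2 (Nat.lt_succ_of_le h), Finset.mem_piAntidiag.2 ⟨rfl, by simp⟩⟩
  rw [h2, h3] at h1
  rw [h4, ← Finset.sum_sdiff h5, sub_add_eq_sub_sub_swap]
  refine sub_mem h1 (Submodule.sum_mem _ fun ι hι => ?_)
  rw [Finset.mem_sdiff, Fintype.mem_piFinset] at hι
  obtain ⟨i, hi⟩ := not_forall.1 hι.2
  exact A.act_mem_of_mem (w := w) hp (fun j => (hf j).1 _) i
    (hN i _ (not_lt.1 fun h => hi (Finset.mem_range.2 h)))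

end CompleteAlgebra

/-! ### Graded quasi-isomorphisms -/

namespace FilteredComplex

variable {k : Type u} [Field k] {U V W : FilteredComplex k}

theorem grMap_id (V : FilteredComplex k) (p : ℤ) : grMap (𝟙 V) p = 𝟙 (V.gr p) := by
  refine coequalizer.hom_ext ?_
  refine (cokernel.π_desc _ _ _).trans ?_
  exact (Category.id_comp _).trans (Category.comp_id _).symm

theorem grMap_comp (f : U ⟶ V) (g : V ⟶ W) (p : ℤ) :
    grMap (f ≫ g) p = grMap f p ≫ grMap g p := by
  refine coequalizer.hom_ext ?_
  refine (cokernel.π_desc _ _ _).trans ?_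
  refine Eq.trans ?_ (cokernel.π_desc_assoc _ _ _ _).symm
  refine Eq.trans ?_ (Category.assoc _ _ _).symm
  refine Eq.trans ?_ (congrArg (subMap f p ≫ ·) (cokernel.π_desc _ _ _).symm)
  exact Category.assoc (subMap f p) (subMap g p) (cokernel.π (W.subIncl p))

end FilteredComplex

namespace CompleteAlgebra

open FilteredComplex

variable {k : Type u} [Field k] {P : CompleteOperad k} {A B C : CompleteAlgebra P}

theorem gradedQuasiIsos_iff (f : A ⟶ B) : gradedQuasiIsos P f ↔
    ∀ p, HomologicalComplex.quasiIso (ModuleCat.{u} k) (ComplexShape.up ℤ) (grMap f.hom p) :=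
  Iff.rfl

instance : (gradedQuasiIsos P).HasTwoOutOfThreeProperty where
  comp_mem f g hf hg := by
    rw [gradedQuasiIsos_iff] at *
    intro p
    rw [comp_hom, grMap_comp]
    exact MorphismProperty.comp_mem _ _ _ (hf p) (hg p)
  of_postcomp f g hg hfg := by
    rw [gradedQuasiIsos_iff] at *
    intro p
    have := hfg p
    rw [comp_hom, grMap_comp] at this
    exact MorphismProperty.of_postcomp _ _ _ (hg p) this
  of_precomp f g hf hfg := by
    rw [gradedQuasiIsos_iff] at *
    intro p
    have := hfg p
    rw [comp_hom, grMap_comp] at this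
    exact MorphismProperty.of_precomp _ _ _ (hf p) this

theorem gradedQuasiIsos_id (A : CompleteAlgebra P) : gradedQuasiIsos P (𝟙 A) := by
  rw [gradedQuasiIsos_iff]
  intro p
  rw [id_hom, grMap_id]
  exact MorphismProperty.id_mem _ _

/-- A split monomorphism is a graded quasi-isomorphism if the idempotent of the splitting is one. -/
theorem gradedQuasiIsos_of_retraction {i : A ⟶ B} {r : B ⟶ A} (hi : i ≫ r = 𝟙 A)
    (hr : gradedQuasiIsos P (r ≫ i)) : gradedQuasiIsos P i := by
  rw [gradedQuasiIsos_iff] at *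
  intro p
  have h1 : grMap i.hom p ≫ grMap r.hom p = 𝟙 _ := by
    rw [← grMap_comp, ← comp_hom, hi, id_hom, grMap_id]
  have h2 : QuasiIso (grMap r.hom p ≫ grMap i.hom p) := by
    have := hr p
    rwa [comp_hom, grMap_comp] at this
  rw [HomologicalComplex.mem_quasiIso_iff]
  rw [quasiIso_iff] at h2 ⊢
  intro n
  have h3 := h2 n
  rw [quasiIsoAt_iff_isIso_homologyMap, HomologicalComplex.homologyMap_comp] at h3
  rw [quasiIsoAt_iff_isIso_homologyMap]
  have h4 : HomologicalComplex.homologyMap (grMap i.hom p) n ≫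
      HomologicalComplex.homologyMap (grMap r.hom p) n = 𝟙 _ := by
    rw [← HomologicalComplex.homologyMap_comp, h1, HomologicalComplex.homologyMap_id]
  have : IsSplitEpi (HomologicalComplex.homologyMap (grMap i.hom p) n) :=
    ⟨⟨⟨inv (HomologicalComplex.homologyMap (grMap r.hom p) n ≫
        HomologicalComplex.homologyMap (grMap i.hom p) n) ≫
        HomologicalComplex.homologyMap (grMap r.hom p) n, by simp⟩⟩⟩
  have : Mono (HomologicalComplex.homologyMap (grMap i.hom p) n) :=
    mono_of_mono_fac h4
  exact isIso_of_mono_of_isSplitEpi _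

theorem gradedQuasiIsos_of_liftsCochains {f : A ⟶ B} (h : LiftsCochains f.hom) :
    gradedQuasiIsos P f := h.isGradedQuasiIso

/-! ### The terminal algebra -/

theorem filteredSurjections_of_isTerminal {T : CompleteAlgebra P} (hT : IsTerminal T) (f : A ⟶ T) :
    filteredSurjections P f := by
  refine (isFilteredSurjection_iff _).2 fun p n y _ => ⟨0, zero_mem _, ?_⟩
  -- the empty product is zero, and `T` is a retract of it
  let Z := SubProduct.full (fun c : Empty => (c.elim : CompleteAlgebra P))
  let g : T ⟶ Z.alg := Z.lift (fun c => c.elim) fun p n x _ => SubProduct.mem_full.2 fun c => c.elim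
  have h : map (g ≫ hT.from Z.alg) y = y := by
    rw [hT.hom_ext (g ≫ hT.from Z.alg) (𝟙 T), map_id]
  have h0 : map g y = 0 := Z.emb_injective (funext fun c => c.elim)
  have hy : y = 0 := by rw [← h, map_comp, h0, map_zero]
  rw [map_zero, hy]

/-! ### The path object -/

/-- The path object: differential forms on the line with coefficients in `B`. -/
def pathObject (B : CompleteAlgebra P) : CompleteAlgebra P := B.tateDerivation.forms.toAlgebra

/-- The inclusion of a path into the pairs of power series. -/
def pathEmb (B : CompleteAlgebra P) :
    B.pathObject.obj.Tot →ₗ[k] (ℕ → B.obj.Tot) × (ℕ → B.obj.Tot) := B.tateDerivation.forms.emb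

theorem tateAct_apply_zero (B : CompleteAlgebra P) (n : ℕ) (p : (P.obj n).Tot)
    (f : Fin n → ℕ → B.obj.Tot) : B.tateAct n p f 0 = B.act n p fun i => f i 0 := by
  rw [tateAct_apply, Finset.piAntidiag_zero, Finset.sum_singleton]
  rfl

theorem tateAct_single (B : CompleteAlgebra P) (n : ℕ) (p : (P.obj n).Tot)
    (a : Fin n → B.obj.Tot) :
    B.tateAct n p (fun i => Pi.single 0 (a i)) = Pi.single 0 (B.act n p a) := by
  funext m
  rcases Nat.eq_zero_or_pos m with rfl | hm
  · rw [tateAct_apply_zero]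
    simp
  · rw [tateAct_apply, Pi.single_eq_of_ne hm.ne']
    refine Finset.sum_eq_zero fun ι hι => ?_
    obtain ⟨i, hi⟩ : ∃ i, ι i ≠ 0 := by
      by_contra! h
      have h1 : ∑ i, ι i = m := (Finset.mem_piAntidiag.1 hι).1
      simp only [h, Finset.sum_const_zero] at h1
      omega
    exact (B.act n p).map_coord_zero i (Pi.single_eq_of_ne hi _)

theorem single_mem_tateW {B : CompleteAlgebra P} {p n : ℤ} {x : B.obj.Tot} (hx : x ∈ B.obj.fil p n)
    (l : ℕ) : Pi.single l x ∈ B.tateW p n := by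
  refine ⟨fun m => ?_, fun q => ⟨l + 1, fun m hm => ?_⟩⟩
  · rcases eq_or_ne m l with rfl | h
    · rwa [Pi.single_eq_same]
    · rw [Pi.single_eq_of_ne h]
      exact zero_mem _
  · rw [Pi.single_eq_of_ne (by omega)]
    exact zero_mem _

/-- Evaluation at `t = 0`. -/
def pathEvalZero (B : CompleteAlgebra P) : B.pathObject ⟶ B :=
  B.tateDerivation.forms.desc (LinearMap.proj 0 ∘ₗ LinearMap.fst k _ _)
    (fun _ _ _ hx => hx.1.1 0) (fun _ _ _ _ => rfl)
    (fun n _ _ _ _ p _ _ _ => B.tateAct_apply_zero n p _)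

/-- Evaluation at `t = 1`. -/
def pathEvalOne (B : CompleteAlgebra P) : B.pathObject ⟶ B :=
  B.tateDerivation.forms.desc (B.tateSum ∘ₗ LinearMap.fst k _ _)
    (fun _ _ _ hx => tateSum_mem hx.1) (fun _ _ _ hx => tateSum_dTot hx.1)
    (fun _ _ _ _ _ _ _ hp ha => tateSum_act hp fun i => (ha i).1)

/-- The constant paths. -/
def pathConst (B : CompleteAlgebra P) : B ⟶ B.pathObject :=
  B.tateDerivation.forms.lift
    (LinearMap.inl k _ _ ∘ₗ LinearMap.single k (fun _ : ℕ => B.obj.Tot) 0)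
    (fun p n x hx => ⟨single_mem_tateW hx 0, zero_mem _⟩)
    (fun n x hx => by
      refine Prod.ext ?_ ?_
      · funext m
        exact (Pi.apply_single (fun _ => B.obj.dTot) (fun _ => map_zero _) 0 x m).symm
      · symm
        change B.tateDer (Pi.single 0 x) - B.tate.D 0 = 0
        rw [map_zero, sub_zero]
        funext m
        rw [tateDer_apply, Pi.single_eq_of_ne (by omega), smul_zero]
        rfl)
    (fun n e b p a hp ha => by
      choose w hw using fun i => exists_mem_fil (ha i)
      refine Prod.ext (B.tateAct_single n p a).symm ?_
      symm
      refine (B.tateDerivation.formAct_snd (w := w) (b := b)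
        (fun i => (Pi.single 0 (a i), 0)) hp fun i => single_mem_tateW (hw i) 0).trans ?_
      refine Finset.sum_eq_zero fun i _ => ?_
      have := (B.tate.act n p).map_update_zero (fun i => Pi.single 0 (a i)) i
      exact (congrArg _ this).trans (smul_zero _))

theorem map_pathEvalZero (B : CompleteAlgebra P) (x : B.pathObject.obj.Tot) :
    map B.pathEvalZero x = (B.pathEmb x).1 0 := InternalAlgebra.map_desc _ _ _ _ _ x

theorem map_pathEvalOne (B : CompleteAlgebra P) (x : B.pathObject.obj.Tot) :
    map B.pathEvalOne x = B.tateSum (B.pathEmb x).1 := InternalAlgebra.map_desc _ _ _ _ _ x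

theorem pathEmb_pathConst (B : CompleteAlgebra P) (x : B.obj.Tot) :
    B.pathEmb (map B.pathConst x) = (Pi.single 0 x, 0) := InternalAlgebra.emb_map_lift _ _ _ _ _ x

theorem exists_pathEmb (B : CompleteAlgebra P) {p n : ℤ} {x : (ℕ → B.obj.Tot) × (ℕ → B.obj.Tot)}
    (h1 : x.1 ∈ B.tateW p n) (h2 : x.2 ∈ B.tateW p (n - 1)) :
    ∃ y ∈ B.pathObject.obj.fil p n, B.pathEmb y = x :=
  B.tateDerivation.forms.exists_emb (p := p) (n := n) ⟨h1, h2⟩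

theorem pathEmb_dTot (B : CompleteAlgebra P) (x : B.pathObject.obj.Tot) :
    B.pathEmb (B.pathObject.obj.dTot x) =
      (B.tate.D (B.pathEmb x).1, B.tateDer (B.pathEmb x).1 - B.tate.D (B.pathEmb x).2) :=
  B.tateDerivation.forms.emb_dTot x

theorem pathEmb_mem (B : CompleteAlgebra P) {p n : ℤ} {x : B.pathObject.obj.Tot}
    (hx : x ∈ B.pathObject.obj.fil p n) :
    (B.pathEmb x).1 ∈ B.tateW p n ∧ (B.pathEmb x).2 ∈ B.tateW p (n - 1) :=
  B.tateDerivation.forms.emb_mem hx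

theorem pathEmb_injective (B : CompleteAlgebra P) : Function.Injective B.pathEmb :=
  B.tateDerivation.forms.emb_injective

theorem tateSum_eq_sum_range {B : CompleteAlgebra P} {p n : ℤ} {f : ℕ → B.obj.Tot}
    (hf : f ∈ B.tateW p n) (N : ℕ) (hN : ∀ m, N ≤ m → f m = 0) :
    B.tateSum f = ∑ m ∈ Finset.range N, f m :=
  tateSum_eq hf fun q => ⟨N, fun m hm => by rw [hN m hm]; exact zero_mem _, by
    rw [sub_self]
    exact zero_mem _⟩

theorem pathConst_evalZero (B : CompleteAlgebra P) : B.pathConst ≫ B.pathEvalZero = 𝟙 B :=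
  hom_ext fun p n x _ => by
    rw [map_comp, map_pathEvalZero, pathEmb_pathConst, map_id]
    exact Pi.single_eq_same (M := fun _ : ℕ => B.obj.Tot) 0 x

theorem pathConst_evalOne (B : CompleteAlgebra P) : B.pathConst ≫ B.pathEvalOne = 𝟙 B :=
  hom_ext fun p n x hx => by
    rw [map_comp, map_pathEvalOne, pathEmb_pathConst, map_id,
      tateSum_eq_sum_range (single_mem_tateW hx 0) 1 fun m hm => Pi.single_eq_of_ne (by omega) _]
    simp

/-- Evaluation at `t = 0` lifts cochains: a closed form `f + g dt` with `f 0 = d y` is the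
differential of `y + ∫ g dt`. This is where characteristic zero is needed. -/
theorem liftsCochains_pathEvalZero [CharZero k] (B : CompleteAlgebra P) :
    LiftsCochains B.pathEvalZero.hom := by
  intro p n z hz hdz y hy hyz
  replace hyz : B.obj.dTot y = (B.pathEmb z).1 0 := hyz.trans (B.map_pathEvalZero z)
  obtain ⟨hf, hg⟩ := B.pathEmb_mem hz
  have hd := B.pathEmb_dTot z
  rw [hdz, map_zero] at hd
  have hd2 : ∀ m, (m + 1) • (B.pathEmb z).1 (m + 1) = B.obj.dTot ((B.pathEmb z).2 m) := by
    intro m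
    have h1 := congrFun (congrArg Prod.snd hd) m
    rw [← tateDer_apply]
    exact sub_eq_zero.1 h1.symm
  rw [add_sub_cancel_right] at hg
  let h : ℕ → B.obj.Tot := fun m => Nat.casesOn m y fun m => ((m + 1 : ℕ) : k)⁻¹ • (B.pathEmb z).2 m
  have hh : h ∈ B.tateW p n := by
    refine ⟨fun m => ?_, fun q => ?_⟩
    · rcases m with _ | m
      · exact hy
      · exact Submodule.smul_mem _ _ (hg.1 m)
    · obtain ⟨N, hN⟩ := hg.2 q
      refine ⟨N + 1, fun m hm => ?_⟩
      rcases m with _ | m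
      · omega
      · exact Submodule.smul_mem _ _ (hN m (by omega))
  have hne : ∀ m : ℕ, ((m + 1 : ℕ) : k) ≠ 0 := fun m => Nat.cast_ne_zero.2 (Nat.succ_ne_zero m)
  obtain ⟨x, hx, hxe⟩ := B.exists_pathEmb (x := (h, 0)) hh (zero_mem _)
  refine ⟨x, hx, B.pathEmb_injective ?_, (B.map_pathEvalZero x).trans (by rw [hxe]; rfl)⟩
  rw [pathEmb_dTot, hxe]
  refine Prod.ext ?_ ?_
  · funext m
    rcases m with _ | m
    · exact hyz
    · change B.obj.dTot (((m + 1 : ℕ) : k)⁻¹ • (B.pathEmb z).2 m) = _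
      rw [map_smul, ← hd2, ← Nat.cast_smul_eq_nsmul k, smul_smul, inv_mul_cancel₀ (hne m), one_smul]
  · change B.tateDer h - B.tate.D 0 = _
    rw [map_zero, sub_zero]
    funext m
    rw [tateDer_apply]
    change (m + 1) • (((m + 1 : ℕ) : k)⁻¹ • (B.pathEmb z).2 m) = _
    rw [← Nat.cast_smul_eq_nsmul k, smul_smul, mul_inv_cancel₀ (hne m), one_smul]

/-- The product of two copies of an algebra. -/
def square (B : CompleteAlgebra P) : SubProduct (fun _ : Bool => B) := SubProduct.full _

/-- The map to the square of an algebra with the given components. -/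
def toSquare (f g : A ⟶ B) : A ⟶ B.square.alg :=
  B.square.lift (fun c => c.rec f g) fun _ _ _ hx => SubProduct.mem_full.2 fun _ => map_mem_fil _ hx

theorem toSquare_false (f g : A ⟶ B) : toSquare f g ≫ B.square.proj false = f :=
  B.square.lift_proj _ _ false

theorem toSquare_true (f g : A ⟶ B) : toSquare f g ≫ B.square.proj true = g :=
  B.square.lift_proj _ _ true

theorem comp_toSquare (h : C ⟶ A) (f g : A ⟶ B) : h ≫ toSquare f g = toSquare (h ≫ f) (h ≫ g) :=
  B.square.hom_ext fun c => by
    rw [Category.assoc]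
    cases c
    · rw [toSquare_false, toSquare_false]
    · rw [toSquare_true, toSquare_true]

/-- Evaluation at both ends is a filtered surjection: the path `y₀ + (y₁ - y₀) t` joins `y₀` and
`y₁`. -/
theorem filteredSurjections_pathEval (B : CompleteAlgebra P) :
    filteredSurjections P (toSquare B.pathEvalZero B.pathEvalOne) := by
  refine (isFilteredSurjection_iff _).2 fun p n y hy => ?_
  have hy' := SubProduct.mem_full.1 (B.square.mem_fil_iff.1 hy)
  let f : ℕ → B.obj.Tot := Pi.single 0 (B.square.emb y false) +
    Pi.single 1 (B.square.emb y true - B.square.emb y false)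
  have hf : f ∈ B.tateW p n :=
    add_mem (single_mem_tateW (hy' false) 0) (single_mem_tateW (sub_mem (hy' true) (hy' false)) 1)
  obtain ⟨x, hx, hxe⟩ := B.exists_pathEmb (x := (f, 0)) hf (zero_mem _)
  refine ⟨x, hx, B.square.emb_injective (funext fun c => ?_)⟩
  refine (B.square.emb_lift _ _ x c).trans ?_
  cases c
  · refine (B.map_pathEvalZero x).trans ?_
    rw [hxe]
    simp [f]
  · refine (B.map_pathEvalOne x).trans ?_
    rw [hxe]
    have hN : ∀ m, 2 ≤ m → f m = 0 := by
      intro m hm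
      simp only [f, Pi.add_apply]
      rw [Pi.single_eq_of_ne (by omega), Pi.single_eq_of_ne (by omega), add_zero]
    refine (tateSum_eq_sum_range hf 2 hN).trans ?_
    simp [f, Finset.sum_range_succ]

/-- A map with the left lifting property against the filtered surjections is a graded
quasi-isomorphism: it is a deformation retract, as all algebras are fibrant and have a path
object. -/
theorem gradedQuasiIsos_of_llp [CharZero k] {i : A ⟶ B} (hi : (filteredSurjections P).llp i)
    {T : CompleteAlgebra P} (hT : IsTerminal T) : gradedQuasiIsos P i := by
  have h1 := hi _ (filteredSurjections_of_isTerminal hT (hT.from A))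
  have sq1 : CommSq (𝟙 A) i (hT.from A) (hT.from B) := ⟨hT.hom_ext _ _⟩
  let r := sq1.lift
  have hir : i ≫ r = 𝟙 A := sq1.fac_left
  have h2 := hi _ B.filteredSurjections_pathEval
  have sq2 : CommSq (i ≫ B.pathConst) i (toSquare B.pathEvalZero B.pathEvalOne)
      (toSquare (𝟙 B) (r ≫ i)) := ⟨by
    rw [comp_toSquare, comp_toSquare, Category.assoc, pathConst_evalZero, Category.assoc,
      pathConst_evalOne, reassoc_of% hir, Category.comp_id]⟩
  have h3 : sq2.lift ≫ B.pathEvalZero = 𝟙 B := by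
    have := congrArg (· ≫ B.square.proj false) sq2.fac_right
    simpa only [Category.assoc, toSquare_false] using this
  have h4 : sq2.lift ≫ B.pathEvalOne = r ≫ i := by
    have := congrArg (· ≫ B.square.proj true) sq2.fac_right
    simpa only [Category.assoc, toSquare_true] using this
  have w0 : gradedQuasiIsos P B.pathEvalZero :=
    gradedQuasiIsos_of_liftsCochains B.liftsCochains_pathEvalZero
  have wid := gradedQuasiIsos_id B
  have wl : gradedQuasiIsos P sq2.lift :=
    MorphismProperty.of_postcomp _ _ _ w0 (by rwa [h3])
  have wc : gradedQuasiIsos P B.pathConst :=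
    MorphismProperty.of_postcomp _ _ _ w0 (by rwa [pathConst_evalZero])
  have w1 : gradedQuasiIsos P B.pathEvalOne :=
    MorphismProperty.of_precomp _ _ _ wc (by rwa [pathConst_evalOne])
  refine gradedQuasiIsos_of_retraction hir ?_
  rw [← h4]
  exact MorphismProperty.comp_mem _ _ _ wl w1

end CompleteAlgebra

/-! ### Generating cofibrations -/

namespace CompleteAlgebra

attribute [local instance] hasLimitsOfSize hasColimitsOfSize

open FilteredComplex

variable {k : Type u} [Field k] {P : CompleteOperad k} {A B : CompleteAlgebra P}

theorem exists_boundaryMap (P : CompleteOperad k) (p n : ℤ) :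
    ∃ f : sphere P p (n + 1) ⟶ disc P p n,
      map f (sphereGen P p (n + 1)) = (disc P p n).obj.dTot (discGen P p n) :=
  (sphere_existsUnique (dTot_mem_fil (discGen_mem p n)) (dTot_dTot _)).exists

/-- The map from a sphere to a disc that sends the generating cocycle to the coboundary of the
generator. -/
def boundaryMap (P : CompleteOperad k) (p n : ℤ) : sphere P p (n + 1) ⟶ disc P p n :=
  (exists_boundaryMap P p n).choose

theorem map_boundaryMap (p n : ℤ) : map (boundaryMap P p n) (sphereGen P p (n + 1)) =
    (disc P p n).obj.dTot (discGen P p n) := (exists_boundaryMap P p n).choose_spec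

/-- The generating cofibrations: the maps from spheres to discs. -/
def generatingCofibrations (P : CompleteOperad k) : MorphismProperty (CompleteAlgebra P) :=
  MorphismProperty.ofHoms fun x : ℤ × ℤ => boundaryMap P x.1 x.2

/-- The generating trivial cofibrations: the maps from the initial algebra to discs. -/
def generatingTrivialCofibrations (P : CompleteOperad k) : MorphismProperty (CompleteAlgebra P) :=
  MorphismProperty.ofHoms fun x : ℤ × ℤ => initial.to (disc P x.1 x.2)

theorem disc_hom_ext {p n : ℤ} {f g : disc P p n ⟶ A}
    (h : map f (discGen P p n) = map g (discGen P p n)) : f = g :=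
  (disc_existsUnique (map_mem_fil g (discGen_mem p n))).unique h rfl

theorem sphere_hom_ext {p n : ℤ} {f g : sphere P p n ⟶ A}
    (h : map f (sphereGen P p n) = map g (sphereGen P p n)) : f = g :=
  (sphere_existsUnique (map_mem_fil g (sphereGen_mem p n))
    (by rw [← map_dTot, dTot_sphereGen, map_zero])).unique h rfl

theorem hasLiftingProperty_initial_iff (p n : ℤ) (f : A ⟶ B) :
    HasLiftingProperty (initial.to (disc P p n)) f ↔
      ∀ y ∈ B.obj.fil p n, ∃ x ∈ A.obj.fil p n, map f x = y := by
  constructor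
  · intro h y hy
    obtain ⟨g, hg⟩ := (disc_existsUnique (P := P) hy).exists
    have sq : CommSq (initial.to A) (initial.to (disc P p n)) f g := ⟨Subsingleton.elim _ _⟩
    refine ⟨map sq.lift (discGen P p n), map_mem_fil _ (discGen_mem p n), ?_⟩
    rw [← map_comp, sq.fac_right, hg]
  · intro h
    refine ⟨fun {u v} sq => ?_⟩
    obtain ⟨x, hx, hxv⟩ := h _ (map_mem_fil v (discGen_mem p n))
    obtain ⟨g, hg⟩ := (disc_existsUnique (P := P) hx).exists
    exact ⟨⟨g, Subsingleton.elim _ _, disc_hom_ext (by rw [map_comp, hg, hxv])⟩⟩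

theorem hasLiftingProperty_boundaryMap_iff (p n : ℤ) (f : A ⟶ B) :
    HasLiftingProperty (boundaryMap P p n) f ↔
      ∀ z ∈ A.obj.fil p (n + 1), A.obj.dTot z = 0 → ∀ y ∈ B.obj.fil p n,
        B.obj.dTot y = map f z → ∃ x ∈ A.obj.fil p n, A.obj.dTot x = z ∧ map f x = y := by
  constructor
  · intro h z hz hdz y hy hyz
    obtain ⟨u, hu⟩ := (sphere_existsUnique (P := P) hz hdz).exists
    obtain ⟨v, hv⟩ := (disc_existsUnique (P := P) hy).exists
    have sq : CommSq u (boundaryMap P p n) f v := ⟨sphere_hom_ext (by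
      rw [map_comp, map_comp, hu, map_boundaryMap, map_dTot, hv, hyz])⟩
    refine ⟨map sq.lift (discGen P p n), map_mem_fil _ (discGen_mem p n), ?_, ?_⟩
    · rw [← map_dTot, ← map_boundaryMap, ← map_comp, sq.fac_left, hu]
    · rw [← map_comp, sq.fac_right, hv]
  · intro h
    refine ⟨fun {u v} sq => ?_⟩
    obtain ⟨x, hx, hdx, hxv⟩ := h (map u (sphereGen P p (n + 1)))
      (map_mem_fil u (sphereGen_mem p (n + 1))) (by rw [← map_dTot, dTot_sphereGen, map_zero])
      _ (map_mem_fil v (discGen_mem p n))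
      (by rw [← map_dTot, ← map_boundaryMap, ← map_comp, ← map_comp, sq.w])
    obtain ⟨g, hg⟩ := (disc_existsUnique (P := P) hx).exists
    refine ⟨⟨g, sphere_hom_ext ?_, disc_hom_ext (by rw [map_comp, hg, hxv])⟩⟩
    rw [map_comp, map_boundaryMap, map_dTot, hg, hdx]

theorem generatingTrivialCofibrations_rlp (P : CompleteOperad k) :
    (generatingTrivialCofibrations P).rlp = filteredSurjections P := by
  ext A B f
  refine Iff.trans ?_ (isFilteredSurjection_iff f.hom).symm
  constructor
  · intro h p n
    exact (hasLiftingProperty_initial_iff p n f).1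
      (h _ (MorphismProperty.ofHoms.mk (f := fun x : ℤ × ℤ => initial.to (disc P x.1 x.2)) (p, n)))
  · rintro h _ _ _ ⟨⟨p, n⟩⟩
    exact (hasLiftingProperty_initial_iff p n f).2 (h p n)

theorem generatingCofibrations_rlp (P : CompleteOperad k) :
    (generatingCofibrations P).rlp = filteredSurjections P ⊓ gradedQuasiIsos P := by
  ext A B f
  have h1 : (generatingCofibrations P).rlp f ↔ LiftsCochains f.hom := by
    constructor
    · intro h p n
      exact (hasLiftingProperty_boundaryMap_iff p n f).1
        (h _ (MorphismProperty.ofHoms.mk (f := fun x : ℤ × ℤ => boundaryMap P x.1 x.2) (p, n)))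
    · rintro h _ _ _ ⟨⟨p, n⟩⟩
      exact (hasLiftingProperty_boundaryMap_iff p n f).2 (h p n)
  rw [h1]
  exact ⟨fun h => ⟨h.isFilteredSurjection, h.isGradedQuasiIso⟩,
    fun h => liftsCochains A.complete B.complete h.1 h.2⟩

/-! ### The small object argument -/

/-- Every sequence in the ordinal `ω₁` is bounded. -/
theorem exists_le_of_nat [Fact (Cardinal.aleph.{u} 1).IsRegular]
    (s : ℕ → (Cardinal.aleph.{u} 1).ord.ToType) : ∃ j, ∀ n, s n ≤ j := by
  have h : HasCardinalLT ℕ (Cardinal.aleph.{u} 1) := by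
    simp [HasCardinalLT]
  exact ⟨IsCardinalFiltered.max s h, fun n => leOfHom (IsCardinalFiltered.toMax s h n)⟩

/-- The initial algebra and the spheres are small with respect to the first uncountable cardinal. -/
theorem hasSmallObjectArgument_of_source {I : MorphismProperty (CompleteAlgebra P)}
    [MorphismProperty.IsSmall.{u} I] (hI : ∀ (A B : CompleteAlgebra P) (i : A ⟶ B), I i →
      A = (⊥_ (CompleteAlgebra P)) ∨ ∃ p n, A = sphere P p n) :
    MorphismProperty.HasSmallObjectArgument.{u} I := by
  have hreg : Fact (Cardinal.aleph.{u} 1).IsRegular := ⟨Cardinal.isRegular_aleph_one⟩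
  have hne : Nonempty (Cardinal.aleph.{u} 1).ord.ToType :=
    IsCardinalFiltered.nonempty _ (Cardinal.aleph.{u} 1)
  refine ⟨Cardinal.aleph.{u} 1, hreg, WellFoundedLT.toOrderBot _, ?_⟩
  let _ := WellFoundedLT.toOrderBot (Cardinal.aleph.{u} 1).ord.ToType
  exact
    { preservesColimit := fun {A B X Y} i hi f hf => by
        obtain rfl | ⟨p, n, rfl⟩ := hI A B i hi
        · exact preservesColimit_coyoneda_initial
        · exact preservesColimit_coyoneda_sphere exists_le_of_nat p n }

instance (P : CompleteOperad k) : MorphismProperty.IsSmall.{u} (generatingCofibrations P) := by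
  have : Small.{u} (ℤ × ℤ) := Countable.toSmall _
  exact MorphismProperty.isSmall_ofHoms _

instance (P : CompleteOperad k) :
    MorphismProperty.IsSmall.{u} (generatingTrivialCofibrations P) := by
  have : Small.{u} (ℤ × ℤ) := Countable.toSmall _
  exact MorphismProperty.isSmall_ofHoms _

instance (P : CompleteOperad k) :
    MorphismProperty.HasSmallObjectArgument.{u} (generatingCofibrations P) :=
  hasSmallObjectArgument_of_source (by
    rintro _ _ _ ⟨p, n⟩
    exact Or.inr ⟨p, n + 1, rfl⟩)

instance (P : CompleteOperad k) :
    MorphismProperty.HasSmallObjectArgument.{u} (generatingTrivialCofibrations P) :=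
  hasSmallObjectArgument_of_source (by
    rintro _ _ _ ⟨p, n⟩
    exact Or.inl rfl)

/-! ### The model structure -/

/-- The maps with the left lifting property against the filtered surjections are the maps with
the left lifting property against the trivial fibrations that are graded quasi-isomorphisms. -/
theorem llp_filteredSurjections_eq [CharZero k] (P : CompleteOperad k) :
    (filteredSurjections P).llp =
      (filteredSurjections P ⊓ gradedQuasiIsos P).llp ⊓ gradedQuasiIsos P := by
  ext A B f
  constructor
  · exact fun hf => ⟨fun _ _ g hg => hf g hg.1, gradedQuasiIsos_of_llp hf terminalIsTerminal⟩
  · rintro ⟨hf, hf'⟩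
    have d := MorphismProperty.factorizationData (generatingTrivialCofibrations P).rlp.llp
      (generatingTrivialCofibrations P).rlp f
    have hJ := generatingTrivialCofibrations_rlp P
    have hi : (filteredSurjections P).llp d.i := hJ ▸ d.hi
    have hp : filteredSurjections P d.p := hJ ▸ d.hp
    have hw : gradedQuasiIsos P d.p :=
      MorphismProperty.of_precomp _ d.i _ (gradedQuasiIsos_of_llp hi terminalIsTerminal)
        (by rwa [d.fac])
    have := hf d.p ⟨hp, hw⟩
    exact MorphismProperty.of_retract (RetractArrow.ofLeftLiftingProperty d.fac) hi

end CompleteAlgebra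

end

theorem theorem2p5 (k : Type u) [Field k] [CharZero k] (P : CompleteOperad k) :
    HasLimitsOfSize.{u, u} (CompleteAlgebra P) ∧
    HasColimitsOfSize.{u, u} (CompleteAlgebra P) ∧
    ∃ _M : ModelCategory (CompleteAlgebra P),
      weakEquivalences (CompleteAlgebra P) = CompleteAlgebra.gradedQuasiIsos P ∧
      fibrations (CompleteAlgebra P) = CompleteAlgebra.filteredSurjections P ∧
      IsCofibrantlyGenerated (CompleteAlgebra P) ∧
      ∀ A : CompleteAlgebra P, IsFibrant A := by
  have hlim : HasLimitsOfSize.{u, u} (CompleteAlgebra P) := CompleteAlgebra.hasLimitsOfSize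
  have hcolim : HasColimitsOfSize.{u, u} (CompleteAlgebra P) := CompleteAlgebra.hasColimitsOfSize
  refine ⟨hlim, hcolim, ?_⟩
  let _ : CategoryWithFibrations (CompleteAlgebra P) := ⟨CompleteAlgebra.filteredSurjections P⟩
  let _ : CategoryWithWeakEquivalences (CompleteAlgebra P) := ⟨CompleteAlgebra.gradedQuasiIsos P⟩
  let _ : CategoryWithCofibrations (CompleteAlgebra P) :=
    ⟨(CompleteAlgebra.filteredSurjections P ⊓ CompleteAlgebra.gradedQuasiIsos P).llp⟩
  have hI := CompleteAlgebra.generatingCofibrations_rlp P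
  have hJ := CompleteAlgebra.generatingTrivialCofibrations_rlp P
  have : (weakEquivalences (CompleteAlgebra P)).HasTwoOutOfThreeProperty :=
    inferInstanceAs (CompleteAlgebra.gradedQuasiIsos P).HasTwoOutOfThreeProperty
  have : MorphismProperty.IsWeakFactorizationSystem (cofibrations (CompleteAlgebra P))
      (trivialFibrations (CompleteAlgebra P)) := by
    change MorphismProperty.IsWeakFactorizationSystem
      (CompleteAlgebra.filteredSurjections P ⊓ CompleteAlgebra.gradedQuasiIsos P).llp (CompleteAlgebra.filteredSurjections P ⊓ CompleteAlgebra.gradedQuasiIsos P)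
    rw [← hI]
    exact ⟨MorphismProperty.rlp_llp_rlp _, rfl, inferInstance⟩
  have : MorphismProperty.IsWeakFactorizationSystem (trivialCofibrations (CompleteAlgebra P))
      (fibrations (CompleteAlgebra P)) := by
    change MorphismProperty.IsWeakFactorizationSystem
      ((CompleteAlgebra.filteredSurjections P ⊓ CompleteAlgebra.gradedQuasiIsos P).llp ⊓ CompleteAlgebra.gradedQuasiIsos P) (CompleteAlgebra.filteredSurjections P)
    rw [← CompleteAlgebra.llp_filteredSurjections_eq, ← hJ]
    exact ⟨MorphismProperty.rlp_llp_rlp _, rfl, inferInstance⟩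
  refine ⟨ModelCategory.mk' _, rfl, rfl, ⟨CompleteAlgebra.generatingCofibrations P, CompleteAlgebra.generatingTrivialCofibrations P,
    inferInstance, inferInstance, inferInstance, inferInstance, hJ.symm, hI.symm⟩, fun A => ?_⟩
  exact ⟨CompleteAlgebra.filteredSurjections_of_isTerminal terminalIsTerminal _⟩
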